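/- Let $d\ge 2$, $1<\alpha<2$ and $q=2d/(d+\alpha)$. Let $D\subset\mathbb R^d$ be a nonempty bounded open set (not necessarily connected) with $C^{1,1}$ boundary, that is, there is $r>0$ such that for every $Q\in\partial D$ there are balls $B(x',r)\subset D$ and $B(x'',r)\subset\mathbb R^d\setminus D$ which are tangent at $Q$. Let $b\in W^{1,q}(D)$ be an $\mathbb R^d$-valued vector field with $\operatorname{div} b=0$ on $D$ in the sense of distributions. Then there exist $\delta>0$ and a vector field $\tilde b\in W^{1,q}(\mathbb R^d)$ such that the distributional divergence of $\tilde b$ satisfies $$\operatorname{div}\tilde b\in L^\infty(\mathbb R^d),$$ $\tilde b=b$ on $D$, $\tilde b$ has compact support, and $\tilde b$ is smooth outside of $D_\delta:=\{x\in\mathbb R^d:\operatorname{dist}(x,D)<\delta\}$. -/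

import Mathlib

open MeasureTheory Metric
open scoped ContDiff ENNReal

/-- A `C^{1,1}` domain: a nonempty bounded open set `D ⊆ ℝ^d` (not necessarily connected) with
some `r > 0` such that at every boundary point `Q` there are an inner ball
`B(x', r) ⊆ D` and an outer ball `B(x'', r) ⊆ ℝ^d \ D` which are tangent at `Q`. As the two open
balls are disjoint, tangency at `Q` means that `Q` lies on both bounding spheres. -/
structure IsC11Domain {d : ℕ} (D : Set (EuclideanSpace ℝ (Fin d))) : Prop where
  nonempty : D.Nonempty
  isOpen : IsOpen D
  isBounded : Bornology.IsBounded D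
  tangent_balls : ∃ r : ℝ, 0 < r ∧ ∀ Q ∈ frontier D,
    (∃ x' : EuclideanSpace ℝ (Fin d), ball x' r ⊆ D ∧ dist Q x' = r) ∧
    (∃ x'' : EuclideanSpace ℝ (Fin d), ball x'' r ⊆ Dᶜ ∧ dist Q x'' = r)

/-- Test functions: `φ ∈ C_c^∞(Ω)`. -/
structure IsTestFunction {d : ℕ} (Ω : Set (EuclideanSpace ℝ (Fin d)))
    (φ : EuclideanSpace ℝ (Fin d) → ℝ) : Prop where
  contDiff : ContDiff ℝ ∞ φ
  hasCompactSupport : HasCompactSupport φ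
  tsupport_subset : tsupport φ ⊆ Ω

/-- `g` is the weak partial derivative `∂_i f` on the open set `Ω`. -/
def HasWeakPartialDeriv {d : ℕ} (Ω : Set (EuclideanSpace ℝ (Fin d))) (i : Fin d)
    (f g : EuclideanSpace ℝ (Fin d) → ℝ) : Prop :=
  LocallyIntegrableOn f Ω ∧ LocallyIntegrableOn g Ω ∧
    ∀ φ : EuclideanSpace ℝ (Fin d) → ℝ, IsTestFunction Ω φ →
      ∫ x in Ω, f x * fderiv ℝ φ x (EuclideanSpace.single i 1) = -∫ x in Ω, g x * φ x

/-- The scalar Sobolev space `W^{1,p}(Ω)`: functions in `L^p(Ω)` whose weak partial derivatives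
exist and lie in `L^p(Ω)`. -/
def MemW1 {d : ℕ} (Ω : Set (EuclideanSpace ℝ (Fin d))) (p : ℝ≥0∞)
    (f : EuclideanSpace ℝ (Fin d) → ℝ) : Prop :=
  MemLp f p (volume.restrict Ω) ∧
    ∀ i : Fin d, ∃ g : EuclideanSpace ℝ (Fin d) → ℝ,
      MemLp g p (volume.restrict Ω) ∧ HasWeakPartialDeriv Ω i f g

/-- A vector field is in `W^{1,p}(Ω)` if all its components are. -/
def VectorMemW1 {d : ℕ} (Ω : Set (EuclideanSpace ℝ (Fin d))) (p : ℝ≥0∞)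
    (b : EuclideanSpace ℝ (Fin d) → EuclideanSpace ℝ (Fin d)) : Prop :=
  ∀ i : Fin d, MemW1 Ω p (fun x => b x i)

/-- `div b = g` on the open set `Ω` in the sense of distributions:
`∫_Ω b · ∇φ dx = -∫_Ω g φ dx` for all `φ ∈ C_c^∞(Ω)`. -/
def HasWeakDivergence {d : ℕ} (Ω : Set (EuclideanSpace ℝ (Fin d)))
    (b : EuclideanSpace ℝ (Fin d) → EuclideanSpace ℝ (Fin d))
    (g : EuclideanSpace ℝ (Fin d) → ℝ) : Prop :=
  LocallyIntegrableOn b Ω ∧ LocallyIntegrableOn g Ω ∧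
    ∀ φ : EuclideanSpace ℝ (Fin d) → ℝ, IsTestFunction Ω φ →
      ∫ x in Ω, inner ℝ (b x) (gradient φ x) = -∫ x in Ω, g x * φ x

/-! The field is continued in two stages: a divergence-free extension to a neighbourhood of the
closure of `D`, then a cutoff whose divergence stays bounded. The exponent matters only through `1 ≤
q < ∞`.

Stage one (`IsC11Domain.exists_divergenceFree_extension`). The tangent balls make the signed
distance C^{1,1} near the boundary; truncating it gives a defining function ρ, and mollifying ∇ρ
gives a field N transversal to the level sets. For s ≥ 4 the map Φ_s(x) = x - s ρ(x) N(x) fixes the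
boundary and exchanges the sides of a thin collar. Outside `D` the field is a combination of Piola
transforms, -∑ c_s |det DΦ_s| (DΦ_s)⁻¹ b(Φ_s), the sign coming from the reversal of orientation.
Each transform preserves the vanishing of the divergence, and it stays in W^{1,q} because DΦ_s is
Lipschitz. One reflection matches only the normal component of `b` at the boundary. There DΦ_s = I -
s N ⊗ dρ, and the boundary value of the transform is affine in s, so two reflections with ∑ c_s = 1
and ∑ c_s s = 0 match every component (`noJump_shift`).

No traces are used. A test field near the boundary is transported by the Φ_s into `D`, and
`IsDefiningFunction.integral_mul_div_eq` says that a Lipschitz field tangent to the boundary can be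
used on `D` without a boundary term. Both the weak derivatives (`integral_reflectEntry_eq`) and the
divergence (`integral_reflect_gradient_eq_zero`) of the extension follow by writing a suitable
combination of fields that is tangent to the boundary.

Stage two (`exists_compactlySupported_extension`). The product χ b has divergence b · ∇χ, which is
only in L^q. Let S_l f average f over the segments [x - z, x] with weight z_l, where z is uniform on
a small ball. Then div (S_1 f, ..., S_d f) is f minus its ball average, while each S_l b is again
divergence-free. Adding ∑_l (S_l b_j - S_j b_l) ∂_l χ to χ b_j therefore replaces b · ∇χ by (ball
average of b) · ∇χ, which is bounded; the terms with second derivatives of χ cancel by antisymmetry.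
The support can be kept within distance 1 of `D`, so the field is zero, hence smooth, farther out.
-/

section Auxiliary

open Filter Topology Convolution NNReal

/-! ### Calculus of locally Lipschitz functions. -/

/-- `f` is Lipschitz on some neighbourhood of `x`. -/
def LipAt {X Y : Type*} [PseudoEMetricSpace X] [PseudoEMetricSpace Y] (f : X → Y) (x : X) : Prop :=
  ∃ K : ℝ≥0, ∃ t ∈ 𝓝 x, LipschitzOnWith K f t

namespace LipAt

theorem congr {X Y : Type*} [PseudoEMetricSpace X] [PseudoEMetricSpace Y] {f g : X → Y} {x : X}
    (hf : LipAt f x) (h : g =ᶠ[𝓝 x] f) : LipAt g x := by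
  obtain ⟨K, t, ht, hK⟩ := hf
  refine ⟨K, t ∩ {y | g y = f y}, inter_mem ht h, fun a ha b hb => ?_⟩
  rw [ha.2, hb.2]
  exact hK ha.1 hb.1

theorem continuousAt {X Y : Type*} [PseudoEMetricSpace X] [PseudoEMetricSpace Y] {f : X → Y}
    {x : X} (hf : LipAt f x) : ContinuousAt f x := by
  obtain ⟨K, t, ht, hK⟩ := hf
  exact hK.continuousOn.continuousAt ht

theorem comp {X Y Z : Type*} [PseudoEMetricSpace X] [PseudoEMetricSpace Y] [PseudoEMetricSpace Z]
    {g : Y → Z} {f : X → Y} {x : X}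
    (hg : LipAt g (f x)) (hf : LipAt f x) : LipAt (fun y => g (f y)) x := by
  have hc := hf.continuousAt
  obtain ⟨K, t, ht, hK⟩ := hf
  obtain ⟨K', t', ht', hK'⟩ := hg
  refine ⟨K' * K, t ∩ f ⁻¹' t', inter_mem ht (hc ht'), ?_⟩
  exact hK'.comp (hK.mono Set.inter_subset_left) (fun y hy => hy.2)

theorem prodMk {X Y Z : Type*} [PseudoEMetricSpace X] [PseudoEMetricSpace Y] [PseudoEMetricSpace Z]
    {g : X → Z} {f : X → Y} {x : X}
    (hf : LipAt f x) (hg : LipAt g x) : LipAt (fun y => (f y, g y)) x := by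
  obtain ⟨K, t, ht, hK⟩ := hf
  obtain ⟨K', t', ht', hK'⟩ := hg
  exact ⟨max K K', t ∩ t', inter_mem ht ht',
    (hK.mono Set.inter_subset_left).prodMk (hK'.mono Set.inter_subset_right)⟩

theorem of_contDiffAt {F G : Type*} [NormedAddCommGroup F] [NormedSpace ℝ F]
    [NormedAddCommGroup G] [NormedSpace ℝ G] {f : F → G} {x : F} (h : ContDiffAt ℝ 1 f x) :
    LipAt f x :=
  h.exists_lipschitzOnWith

theorem mul {X : Type*} [PseudoEMetricSpace X] {f g : X → ℝ} {x : X}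
    (hf : LipAt f x) (hg : LipAt g x) : LipAt (fun y => f y * g y) x :=
  LipAt.comp (g := fun p : ℝ × ℝ => p.1 * p.2) (f := fun y => (f y, g y))
    (of_contDiffAt (by fun_prop)) (hf.prodMk hg)

theorem sub {X : Type*} [PseudoEMetricSpace X] {f g : X → ℝ} {x : X}
    (hf : LipAt f x) (hg : LipAt g x) : LipAt (fun y => f y - g y) x :=
  LipAt.comp (g := fun p : ℝ × ℝ => p.1 - p.2) (f := fun y => (f y, g y))
    (of_contDiffAt (by fun_prop)) (hf.prodMk hg)

theorem const {X Y : Type*} [PseudoEMetricSpace X] [PseudoEMetricSpace Y] (c : Y) (x : X) :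
    LipAt (fun _ => c) x :=
  ⟨0, Set.univ, univ_mem, (LipschitzWith.const c).lipschitzOnWith⟩

theorem sum {X ι : Type*} [PseudoEMetricSpace X] {s : Finset ι} {f : ι → X → ℝ} {x : X}
    (hf : ∀ i ∈ s, LipAt (f i) x) : LipAt (fun y => ∑ i ∈ s, f i y) x := by
  classical
  induction s using Finset.induction_on with
  | empty => simpa using LipAt.const (0 : ℝ) x
  | insert i s hi ih =>
    simp only [Finset.sum_insert hi]
    exact LipAt.comp (g := fun p : ℝ × ℝ => p.1 + p.2)
      (f := fun y => (f i y, ∑ j ∈ s, f j y)) (of_contDiffAt (by fun_prop))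
      ((hf i (Finset.mem_insert_self _ _)).prodMk
        (ih fun j hj => hf j (Finset.mem_insert_of_mem hj)))

end LipAt

theorem LipschitzWith.lipAt {X Y : Type*} [PseudoEMetricSpace X] [PseudoEMetricSpace Y] {K : ℝ≥0}
    {f : X → Y} (h : LipschitzWith K f) (x : X) : LipAt f x :=
  ⟨K, Set.univ, univ_mem, h.lipschitzOnWith⟩

/-- Pairs at distance at most one that meet the support lie in a compact neighbourhood of it, where
the local constants can be made uniform; for farther pairs twice the supremum suffices. All test
fields built below become globally Lipschitz in this way. -/
theorem HasCompactSupport.exists_lipschitzWith {F : Type*} [NormedAddCommGroup F] [NormedSpace ℝ F]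
    [ProperSpace F] {f : F → ℝ} (hc : HasCompactSupport f) (hf : ∀ x ∈ tsupport f, LipAt f x) :
    ∃ K : ℝ≥0, LipschitzWith K f := by
  have hL : LocallyLipschitz f := by
    intro x
    by_cases hx : x ∈ tsupport f
    · exact hf x hx
    · exact (LipAt.const 0 x).congr (notMem_tsupport_iff_eventuallyEq.1 hx)
  obtain ⟨M, hM⟩ := hc.exists_bound_of_continuous hL.continuous
  have hcomp : IsCompact (cthickening 1 (tsupport f)) := hc.isCompact.cthickening
  obtain ⟨K, hK⟩ := LocallyLipschitzOn.exists_lipschitzOnWith_of_compact hcomp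
    (hL.locallyLipschitzOn (s := cthickening 1 (tsupport f)))
  have hM0 : 0 ≤ M := (norm_nonneg _).trans (hM 0)
  have key : ∀ x y, x ∈ tsupport f → dist (f x) (f y) ≤ (max K (2 * M.toNNReal) : ℝ≥0) * dist x y := by
    intro x y hx
    have h1 : ((max K (2 * M.toNNReal) : ℝ≥0) : ℝ) = max (K : ℝ) (2 * M) := by
      push_cast
      rw [Real.coe_toNNReal _ hM0]
    rw [h1]
    by_cases hxy : dist x y ≤ 1
    · have hx' : x ∈ cthickening 1 (tsupport f) := self_subset_cthickening _ hx
      have hy' : y ∈ cthickening 1 (tsupport f) :=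
        mem_cthickening_of_dist_le y x 1 _ hx (by rwa [dist_comm])
      refine (hK.dist_le_mul x hx' y hy').trans ?_
      gcongr
      exact le_max_left _ _
    · push Not at hxy
      calc dist (f x) (f y) ≤ 2 * M := by
            rw [dist_eq_norm]
            exact (norm_sub_le _ _).trans (by linarith [hM x, hM y])
        _ ≤ 2 * M * dist x y := by nlinarith
        _ ≤ _ := by
            gcongr
            exact le_max_right _ _
  refine ⟨max K (2 * M.toNNReal), LipschitzWith.of_dist_le_mul fun x y => ?_⟩
  by_cases hx : x ∈ tsupport f
  · exact key x y hx
  by_cases hy : y ∈ tsupport f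
  · rw [dist_comm, dist_comm x]
    exact key y x hy
  · rw [image_eq_zero_of_notMem_tsupport hx, image_eq_zero_of_notMem_tsupport hy, dist_self]
    positivity

/-! ### Mollification and Lipschitz test functions. -/

section Mollify

variable {d : ℕ}

/-- A sequence of bump functions whose supports shrink to the origin. -/
noncomputable def shrinkingBump (d n : ℕ) : ContDiffBump (0 : EuclideanSpace ℝ (Fin d)) :=
  ⟨1 / (n + 1), 2 / (n + 1), by positivity, by gcongr; norm_num⟩

theorem tendsto_rOut_shrinkingBump :
    Tendsto (fun n => (shrinkingBump d n).rOut) atTop (𝓝 0) := by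
  have := (tendsto_one_div_add_atTop_nhds_zero_nat (𝕜 := ℝ)).const_mul 2
  simpa [shrinkingBump, div_eq_mul_inv] using this

/-- The mollification of `ψ` at scale `1/(n+1)`. -/
noncomputable def mollify (n : ℕ) (ψ : EuclideanSpace ℝ (Fin d) → ℝ) :
    EuclideanSpace ℝ (Fin d) → ℝ :=
  (shrinkingBump d n).normed volume ⋆[ContinuousLinearMap.lsmul ℝ ℝ, volume] ψ

theorem mollify_apply (n : ℕ) (ψ : EuclideanSpace ℝ (Fin d) → ℝ) (x : EuclideanSpace ℝ (Fin d)) :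
    mollify n ψ x = ∫ z, (shrinkingBump d n).normed volume z * ψ (x - z) := by
  simp [mollify, convolution_def]

theorem contDiff_mollify (n : ℕ) {ψ : EuclideanSpace ℝ (Fin d) → ℝ} (hψ : LocallyIntegrable ψ) :
    ContDiff ℝ ∞ (mollify n ψ) :=
  (shrinkingBump d n).hasCompactSupport_normed.contDiff_convolution_left _
    (shrinkingBump d n).contDiff_normed hψ

theorem tsupport_mollify_subset (n : ℕ) {ψ : EuclideanSpace ℝ (Fin d) → ℝ} :
    tsupport (mollify n ψ) ⊆ cthickening (shrinkingBump d n).rOut (tsupport ψ) := by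
  refine closure_minimal ?_ isClosed_cthickening
  refine (support_convolution_subset _).trans ?_
  rintro _ ⟨a, ha, b, hb, rfl⟩
  rw [ContDiffBump.support_normed_eq] at ha
  refine mem_cthickening_of_dist_le _ b _ _ (subset_tsupport _ hb) ?_
  simpa using (mem_ball_zero_iff.1 ha).le

theorem integrable_normed_mul_comp_sub (n : ℕ) {ψ : EuclideanSpace ℝ (Fin d) → ℝ}
    (hψ : Continuous ψ) (x : EuclideanSpace ℝ (Fin d)) :
    Integrable fun z => (shrinkingBump d n).normed volume z * ψ (x - z) := by
  refine Continuous.integrable_of_hasCompactSupport ?_ ?_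
  · exact (shrinkingBump d n).continuous_normed.mul (hψ.comp (by fun_prop))
  · exact (shrinkingBump d n).hasCompactSupport_normed.mul_right

theorem mollify_lipschitzWith (n : ℕ) {ψ : EuclideanSpace ℝ (Fin d) → ℝ} {K : ℝ≥0}
    (hψ : LipschitzWith K ψ) : LipschitzWith K (mollify n ψ) := by
  refine LipschitzWith.of_dist_le_mul fun x y => ?_
  rw [mollify_apply, mollify_apply, dist_eq_norm, ← integral_sub
    (integrable_normed_mul_comp_sub n hψ.continuous x)
    (integrable_normed_mul_comp_sub n hψ.continuous y)]
  calc _ ≤ ∫ z, (shrinkingBump d n).normed volume z * (K * dist x y) := by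
        refine norm_integral_le_of_norm_le
          ((shrinkingBump d n).integrable_normed.mul_const _) (ae_of_all _ fun z => ?_)
        rw [← mul_sub, norm_mul, Real.norm_of_nonneg ((shrinkingBump d n).nonneg_normed z)]
        refine mul_le_mul_of_nonneg_left ?_ ((shrinkingBump d n).nonneg_normed z)
        have := hψ.dist_le_mul (x - z) (y - z)
        rwa [dist_eq_norm (ψ _), dist_sub_right] at this
    _ = K * dist x y := by
        rw [integral_mul_const, ContDiffBump.integral_normed, one_mul]

/-- Rademacher's theorem supplies the derivative of `ψ` almost everywhere, and the Lipschitz bound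
dominates the difference quotients under the integral. Consequently the derivatives of the
mollifications converge almost everywhere to that of `ψ`. -/
theorem fderiv_mollify_apply (n : ℕ) {ψ : EuclideanSpace ℝ (Fin d) → ℝ} {K : ℝ≥0}
    (hψ : LipschitzWith K ψ) (x e : EuclideanSpace ℝ (Fin d)) :
    fderiv ℝ (mollify n ψ) x e = mollify n (fun y => fderiv ℝ ψ y e) x := by
  have hd : DifferentiableAt ℝ (mollify n ψ) x :=
    ((contDiff_mollify n hψ.continuous.locallyIntegrable).differentiable (by simp)).differentiableAt
  have h1 : HasDerivAt (fun t : ℝ => mollify n ψ (x + t • e)) (fderiv ℝ (mollify n ψ) x e) 0 := by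
    have := hd.hasFDerivAt.hasLineDerivAt e
    exact this
  have h2 : HasDerivAt (fun t : ℝ => ∫ z, (shrinkingBump d n).normed volume z * ψ (x + t • e - z))
      (∫ z, (shrinkingBump d n).normed volume z * fderiv ℝ ψ (x - z) e) 0 := by
    refine (hasDerivAt_integral_of_dominated_loc_of_lip (s := Set.univ)
      (F := fun t z => (shrinkingBump d n).normed volume z * ψ (x + t • e - z))
      (F' := fun z => (shrinkingBump d n).normed volume z * fderiv ℝ ψ (x - z) e)
      (bound := fun z => (shrinkingBump d n).normed volume z * (K * ‖e‖))
      univ_mem ?_ ?_ ?_ ?_ ?_ ?_).2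
    · exact Eventually.of_forall fun t =>
        (integrable_normed_mul_comp_sub n hψ.continuous _).aestronglyMeasurable
    · exact integrable_normed_mul_comp_sub n hψ.continuous _
    · refine ((shrinkingBump d n).continuous_normed.measurable.mul ?_).aestronglyMeasurable
      exact (measurable_fderiv_apply_const ℝ ψ e).comp (measurable_const.sub measurable_id)
    · refine ae_of_all _ fun z => LipschitzWith.lipschitzOnWith ?_
      refine LipschitzWith.of_dist_le_mul fun s t => ?_
      have hb := (shrinkingBump d n).nonneg_normed (μ := volume) z
      rw [dist_eq_norm, ← mul_sub, norm_mul, Real.norm_of_nonneg hb]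
      have h3 := hψ.dist_le_mul (x + s • e - z) (x + t • e - z)
      rw [dist_sub_right, dist_add_left, dist_eq_norm, dist_eq_norm, ← sub_smul, norm_smul] at h3
      rw [Real.coe_nnabs, abs_of_nonneg (by positivity), dist_eq_norm, mul_assoc]
      refine mul_le_mul_of_nonneg_left (h3.trans (le_of_eq (by ring))) hb
    · exact (shrinkingBump d n).integrable_normed.mul_const _
    · have hae : ∀ᵐ z, DifferentiableAt ℝ ψ (x - z) :=
        (Measure.measurePreserving_sub_left volume x).quasiMeasurePreserving.ae hψ.ae_differentiableAt
      filter_upwards [hae] with z hz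
      refine HasDerivAt.const_mul _ ?_
      have h4 : HasDerivAt (fun t : ℝ => ψ ((x - z) + t • e)) (fderiv ℝ ψ (x - z) e) 0 :=
        hz.hasFDerivAt.hasLineDerivAt e
      refine h4.congr_of_eventuallyEq (Eventually.of_forall fun t => ?_)
      simp only
      congr 1
      abel
  rw [mollify_apply]
  refine h1.unique (h2.congr_of_eventuallyEq (Eventually.of_forall fun t => ?_))
  exact mollify_apply n ψ _

theorem locallyIntegrable_fderiv_apply {ψ : EuclideanSpace ℝ (Fin d) → ℝ} {K : ℝ≥0}
    (hψ : LipschitzWith K ψ) (e : EuclideanSpace ℝ (Fin d)) :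
    LocallyIntegrable fun y => fderiv ℝ ψ y e := by
  refine (memLp_top_of_bound (C := K * ‖e‖)
    (measurable_fderiv_apply_const ℝ ψ e).aestronglyMeasurable
    (ae_of_all _ fun y => ?_)).locallyIntegrable le_top
  exact ((fderiv ℝ ψ y).le_opNorm e).trans
    (mul_le_mul_of_nonneg_right (norm_fderiv_le_of_lipschitz ℝ hψ) (norm_nonneg _))

theorem ae_tendsto_mollify {ψ : EuclideanSpace ℝ (Fin d) → ℝ} (hψ : LocallyIntegrable ψ) :
    ∀ᵐ x, Tendsto (fun n => mollify n ψ x) atTop (𝓝 (ψ x)) := by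
  refine ContDiffBump.ae_convolution_tendsto_right_of_locallyIntegrable (K := 2)
    tendsto_rOut_shrinkingBump (Eventually.of_forall fun n => ?_) hψ
  simp only [shrinkingBump]
  exact le_of_eq (by ring)

/-- The identity defining weak partial derivatives holds for Lipschitz test functions. -/
theorem HasWeakPartialDeriv.integral_eq_of_lipschitz {D : Set (EuclideanSpace ℝ (Fin d))}
    (hD : IsOpen D) {i : Fin d} {f g : EuclideanSpace ℝ (Fin d) → ℝ}
    (h : HasWeakPartialDeriv D i f g) {ψ : EuclideanSpace ℝ (Fin d) → ℝ} {K : ℝ≥0}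
    (hψ : LipschitzWith K ψ) (hc : HasCompactSupport ψ) (hs : tsupport ψ ⊆ D) :
    ∫ x in D, f x * fderiv ℝ ψ x (EuclideanSpace.single i 1) = -∫ x in D, g x * ψ x := by
  set e : EuclideanSpace ℝ (Fin d) := EuclideanSpace.single i 1
  -- The mollifications are eventually supported in one compact subset `T` of `D`; there `f` and `g`
  -- are integrable, which gives the dominating functions.
  obtain ⟨δ, hδ, hδD⟩ := hc.isCompact.exists_cthickening_subset_open hD hs
  set T := cthickening δ (tsupport ψ) with hT
  have hTc : IsCompact T := hc.isCompact.cthickening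
  have hsmall : ∀ᶠ n in atTop, (shrinkingBump d n).rOut < δ :=
    tendsto_rOut_shrinkingBump.eventually_lt_const hδ
  have hsupp : ∀ᶠ n in atTop, tsupport (mollify n ψ) ⊆ T :=
    hsmall.mono fun n hn => (tsupport_mollify_subset n).trans (cthickening_mono hn.le _)
  obtain ⟨M, hM⟩ := hc.exists_bound_of_continuous hψ.continuous
  have hli : LocallyIntegrable ψ := hψ.continuous.locallyIntegrable
  have hMn : ∀ n x, ‖mollify n ψ x‖ ≤ M := by
    intro n x
    rw [mollify_apply]
    calc _ ≤ ∫ z, (shrinkingBump d n).normed volume z * M := by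
          refine norm_integral_le_of_norm_le
            ((shrinkingBump d n).integrable_normed.mul_const _) (ae_of_all _ fun z => ?_)
          rw [norm_mul, Real.norm_of_nonneg ((shrinkingBump d n).nonneg_normed z)]
          exact mul_le_mul_of_nonneg_left (hM _) ((shrinkingBump d n).nonneg_normed z)
      _ = M := by rw [integral_mul_const, ContDiffBump.integral_normed, one_mul]
  have hfT : IntegrableOn f T := h.1.integrableOn_compact_subset hδD hTc
  have hgT : IntegrableOn g T := h.2.1.integrableOn_compact_subset hδD hTc
  have hTm : MeasurableSet T := isClosed_cthickening.measurableSet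
  have lim1 : Tendsto (fun n => ∫ x in D, f x * fderiv ℝ (mollify n ψ) x e) atTop
      (𝓝 (∫ x in D, f x * fderiv ℝ ψ x e)) := by
    refine tendsto_integral_filter_of_dominated_convergence
      (fun x => T.indicator (fun x => ‖f x‖ * (K * ‖e‖)) x) ?_ ?_ ?_ ?_
    · refine Eventually.of_forall fun n => ?_
      exact (h.1.aestronglyMeasurable).mul
        (measurable_fderiv_apply_const ℝ _ e).aestronglyMeasurable
    · filter_upwards [hsupp] with n hn
      refine ae_of_all _ fun x => ?_
      by_cases hx : x ∈ T
      · rw [Set.indicator_of_mem hx, norm_mul]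
        refine mul_le_mul_of_nonneg_left ?_ (norm_nonneg _)
        exact ((fderiv ℝ _ x).le_opNorm e).trans (mul_le_mul_of_nonneg_right
          (norm_fderiv_le_of_lipschitz ℝ (mollify_lipschitzWith n hψ)) (norm_nonneg _))
      · have h0 : fderiv ℝ (mollify n ψ) x = 0 :=
          image_eq_zero_of_notMem_tsupport fun hx' => hx (hn (tsupport_fderiv_subset ℝ hx'))
        simp [h0, hx]
    · exact ((integrable_indicator_iff hTm).2 (hfT.norm.mul_const _)).restrict
    · have := ae_tendsto_mollify (locallyIntegrable_fderiv_apply hψ e)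
      filter_upwards [ae_restrict_of_ae this] with x hx
      simp only [fderiv_mollify_apply _ hψ]
      exact hx.const_mul _
  have lim2 : Tendsto (fun n => -∫ x in D, g x * mollify n ψ x) atTop
      (𝓝 (-∫ x in D, g x * ψ x)) := by
    refine (tendsto_integral_filter_of_dominated_convergence
      (fun x => T.indicator (fun x => ‖g x‖ * M) x) ?_ ?_ ?_ ?_).neg
    · refine Eventually.of_forall fun n => ?_
      exact (h.2.1.aestronglyMeasurable).mul
        (contDiff_mollify n hli).continuous.aestronglyMeasurable
    · filter_upwards [hsupp] with n hn
      refine ae_of_all _ fun x => ?_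
      by_cases hx : x ∈ T
      · rw [Set.indicator_of_mem hx, norm_mul]
        exact mul_le_mul_of_nonneg_left (hMn n x) (norm_nonneg _)
      · have h0 : mollify n ψ x = 0 := image_eq_zero_of_notMem_tsupport fun hx' => hx (hn hx')
        simp [h0, hx]
    · exact ((integrable_indicator_iff hTm).2 (hgT.norm.mul_const _)).restrict
    · filter_upwards [ae_restrict_of_ae (ae_tendsto_mollify hli)] with x hx
      exact hx.const_mul _
  refine tendsto_nhds_unique (lim1.congr' ?_) lim2
  filter_upwards [hsupp] with n hn
  exact h.2.2 _ ⟨contDiff_mollify n hli, hTc.of_isClosed_subset (isClosed_tsupport _) hn,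
    hn.trans hδD⟩

end Mollify

/-! ### Defining functions and integration by parts without boundary term. -/

/-- The data of a `C^{1,1}` function that is negative exactly on `D`, does not degenerate near the
boundary of `D`, and has compact sublevel sets there. -/
structure IsDefiningFunction {d : ℕ} (D : Set (EuclideanSpace ℝ (Fin d)))
    (ρ : EuclideanSpace ℝ (Fin d) → ℝ) : Prop where
  contDiff : ContDiff ℝ 1 ρ
  lipschitz_fderiv : ∃ K : ℝ≥0, LipschitzWith K (fderiv ℝ ρ)
  expansion : ∃ C : ℝ, 0 < C ∧ ∀ x h, |ρ (x + h) - ρ x - fderiv ℝ ρ x h| ≤ C * ‖h‖ ^ 2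
  norm_fderiv_le : ∀ x, ‖fderiv ℝ ρ x‖ ≤ 1
  mem_iff : ∀ x, x ∈ D ↔ ρ x < 0
  infDist_le : ∃ C : ℝ, ∀ x ∈ D, infDist x Dᶜ ≤ C * |ρ x|
  collar : ∃ κ : ℝ, 0 < κ ∧ IsCompact {x | ρ x ≤ κ} ∧ ∀ x, |ρ x| ≤ κ → 3 / 4 ≤ ‖fderiv ℝ ρ x‖

theorem Real.smoothTransition.deriv_eq_zero {t : ℝ} (ht : t < 0 ∨ 1 < t) :
    deriv Real.smoothTransition t = 0 := by
  rcases ht with ht | ht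
  · have : Real.smoothTransition =ᶠ[𝓝 t] fun _ => 0 := by
      filter_upwards [gt_mem_nhds ht] with u hu
      exact Real.smoothTransition.zero_of_nonpos hu.le
    rw [this.deriv_eq, deriv_const]
  · have : Real.smoothTransition =ᶠ[𝓝 t] fun _ => 1 := by
      filter_upwards [lt_mem_nhds ht] with u hu
      exact Real.smoothTransition.one_of_one_le hu.le
    rw [this.deriv_eq, deriv_const]

theorem Real.smoothTransition.exists_bound_deriv :
    ∃ B : ℝ, 0 ≤ B ∧ ∀ t, |deriv Real.smoothTransition t| ≤ B := by
  have hc : Continuous (deriv Real.smoothTransition) :=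
    (Real.smoothTransition.contDiff (n := 1)).continuous_deriv le_rfl
  obtain ⟨B, hB⟩ := (isCompact_Icc (a := (0 : ℝ)) (b := 1)).exists_bound_of_continuousOn
    hc.continuousOn
  refine ⟨max B 0, le_max_right _ _, fun t => ?_⟩
  by_cases ht : t ∈ Set.Icc (0 : ℝ) 1
  · exact (hB t ht).trans (le_max_left _ _)
  · have h0 : deriv Real.smoothTransition t = 0 := by
      refine Real.smoothTransition.deriv_eq_zero ?_
      rwa [Set.mem_Icc, not_and_or, not_le, not_le] at ht
    simp [h0]

namespace IsDefiningFunction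

variable {d : ℕ} {D : Set (EuclideanSpace ℝ (Fin d))} {ρ : EuclideanSpace ℝ (Fin d) → ℝ}

theorem isOpen (hρ : IsDefiningFunction D ρ) : IsOpen D := by
  have : D = {x | ρ x < 0} := Set.ext hρ.mem_iff
  rw [this]
  exact isOpen_lt hρ.contDiff.continuous continuous_const

theorem isBounded (hρ : IsDefiningFunction D ρ) : Bornology.IsBounded D := by
  obtain ⟨κ, hκ, hc, -⟩ := hρ.collar
  exact hc.isBounded.subset fun x hx => ((hρ.mem_iff x).1 hx).le.trans hκ.le

/-- A nearest point of the complement lies on the frontier, where `ρ` vanishes. This bounds by |ρ|,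
inside `D`, any Lipschitz function that vanishes on the zero set of `ρ`. -/
theorem exists_zero_dist_le [Nonempty (Fin d)] (hρ : IsDefiningFunction D ρ) :
    ∃ C : ℝ, 0 ≤ C ∧ ∀ x ∈ D, ∃ y, ρ y = 0 ∧ dist x y ≤ C * |ρ x| := by
  obtain ⟨C, hC⟩ := hρ.infDist_le
  refine ⟨max C 0, le_max_right _ _, fun x hx => ?_⟩
  have hne : D ≠ Set.univ := by
    intro h
    have := hρ.isBounded
    rw [h] at this
    exact NormedSpace.unbounded_univ ℝ (EuclideanSpace ℝ (Fin d)) this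
  obtain ⟨y, hy, hxy⟩ := exists_mem_frontier_infDist_compl_eq_dist hx hne
  refine ⟨y, ?_, ?_⟩
  · rw [hρ.isOpen.frontier_eq] at hy
    refine le_antisymm ?_ ?_
    · have : closure D ⊆ {x | ρ x ≤ 0} :=
        closure_minimal (fun z hz => ((hρ.mem_iff z).1 hz).le)
          (isClosed_le hρ.contDiff.continuous continuous_const)
      exact this hy.1
    · exact not_lt.1 fun h => hy.2 ((hρ.mem_iff y).2 h)
  · rw [← hxy]
    refine (hC x hx).trans (mul_le_mul_of_nonneg_right (le_max_left _ _) (abs_nonneg _))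

theorem lipAt_fderiv_apply (hρ : IsDefiningFunction D ρ) (e x : EuclideanSpace ℝ (Fin d)) :
    LipAt (fun y => fderiv ℝ ρ y e) x := by
  obtain ⟨K, hK⟩ := hρ.lipschitz_fderiv
  refine LipAt.comp (g := fun A : EuclideanSpace ℝ (Fin d) →L[ℝ] ℝ => A e) ?_ (hK.lipAt x)
  exact ((ContinuousLinearMap.apply ℝ ℝ e).lipschitz).lipAt _

theorem contDiff_cutoff (hρ : IsDefiningFunction D ρ) (n : ℕ) :
    ContDiff ℝ 1 fun y => Real.smoothTransition (-(n * ρ y) - 1) :=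
  Real.smoothTransition.contDiff.comp (((contDiff_const.mul hρ.contDiff).neg).sub contDiff_const)

theorem fderiv_cutoff (hρ : IsDefiningFunction D ρ) (n : ℕ) (y e : EuclideanSpace ℝ (Fin d)) :
    fderiv ℝ (fun y => Real.smoothTransition (-(n * ρ y) - 1)) y e =
      -(n * deriv Real.smoothTransition (-(n * ρ y) - 1)) * fderiv ℝ ρ y e := by
  have h1 : HasFDerivAt ρ (fderiv ℝ ρ y) y :=
    (hρ.contDiff.differentiable (by simp) y).hasFDerivAt
  have h2 : HasDerivAt Real.smoothTransition (deriv Real.smoothTransition (-(n * ρ y) - 1))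
      (-(n * ρ y) - 1) :=
    ((Real.smoothTransition.contDiff (n := 1)).differentiable (by simp) _).hasDerivAt
  have h3 := h2.comp_hasFDerivAt y (((h1.const_mul (n : ℝ)).neg).sub_const 1)
  rw [show fderiv ℝ (fun y => Real.smoothTransition (-(n * ρ y) - 1)) y = _ from h3.fderiv]
  simp
  ring

/-- Integration by parts against a Lipschitz vector field tangent to the boundary of `D`. -/
theorem integral_mul_div_eq [Nonempty (Fin d)] (hρ : IsDefiningFunction D ρ)
    {f : EuclideanSpace ℝ (Fin d) → ℝ} {g : Fin d → EuclideanSpace ℝ (Fin d) → ℝ}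
    (hf : IntegrableOn f D) (hg : ∀ l, IntegrableOn (g l) D)
    (hfg : ∀ l, HasWeakPartialDeriv D l f (g l))
    {X : Fin d → EuclideanSpace ℝ (Fin d) → ℝ} (hX : ∀ l, ∃ K : ℝ≥0, LipschitzWith K (X l))
    (hXc : ∀ l, HasCompactSupport (X l))
    (htan : ∀ y, ρ y = 0 → ∑ l, X l y * fderiv ℝ ρ y (EuclideanSpace.single l 1) = 0) :
    ∫ x in D, f x * ∑ l, fderiv ℝ (X l) x (EuclideanSpace.single l 1) =
      -∫ x in D, ∑ l, g l x * X l x := by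
  set e : Fin d → EuclideanSpace ℝ (Fin d) := fun l => EuclideanSpace.single l 1 with he
  choose K hK using hX
  have hXb : ∀ l, ∃ M, ∀ x, ‖X l x‖ ≤ M :=
    fun l => (hXc l).exists_bound_of_continuous (hK l).continuous
  choose M hM using hXb
  obtain ⟨B, hB0, hB⟩ := Real.smoothTransition.exists_bound_deriv
  set w : EuclideanSpace ℝ (Fin d) → ℝ := fun y => ∑ l, X l y * fderiv ℝ ρ y (e l) with hw
  obtain ⟨C, hC0, hC⟩ := hρ.exists_zero_dist_le
  have hwl : ∃ L : ℝ≥0, LipschitzWith L w := by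
    have : HasCompactSupport w := by
      have hcl : IsCompact (⋃ l, tsupport (X l)) := isCompact_iUnion fun l => hXc l
      refine HasCompactSupport.intro hcl fun x hx => ?_
      simp only [Set.mem_iUnion, not_exists] at hx
      exact Finset.sum_eq_zero fun l _ => by rw [image_eq_zero_of_notMem_tsupport (hx l), zero_mul]
    exact this.exists_lipschitzWith fun x _ =>
      LipAt.sum fun l _ => ((hK l).lipAt x).mul (hρ.lipAt_fderiv_apply _ _)
  obtain ⟨L, hL⟩ := hwl
  -- Tangency makes the Lipschitz function `w` vanish on the zero set. The resulting factor |ρ| will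
  -- absorb the factor n from the gradient of the cutoff.
  have hwρ : ∀ y ∈ D, |w y| ≤ L * C * |ρ y| := by
    intro y hy
    obtain ⟨z, hz, hyz⟩ := hC y hy
    have := hL.dist_le_mul y z
    rw [dist_eq_norm, show w z = 0 from htan z hz, sub_zero, Real.norm_eq_abs] at this
    refine this.trans ?_
    rw [mul_assoc]
    gcongr
  -- Zero where nρ ≥ -1 and one where nρ ≤ -2: the support stays inside `D`, and the gradient lives
  -- on the layer 1 ≤ n|ρ| ≤ 2.
  set χ : ℕ → EuclideanSpace ℝ (Fin d) → ℝ :=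
    fun n y => Real.smoothTransition (-(n * ρ y) - 1) with hχ
  have hχ1 : ∀ n y, |χ n y| ≤ 1 := fun n y => by
    rw [abs_of_nonneg (Real.smoothTransition.nonneg _)]
    exact Real.smoothTransition.le_one _
  have hχe : ∀ y ∈ D, ∀ᶠ n : ℕ in atTop, 1 < -(n * ρ y) - 1 := by
    intro y hy
    have h0 := (hρ.mem_iff y).1 hy
    filter_upwards [(tendsto_natCast_atTop_atTop (R := ℝ)).eventually_gt_atTop (2 / -ρ y)]
      with n hn
    rw [div_lt_iff₀ (by linarith)] at hn
    linarith
  have hXd : ∀ᵐ x, ∀ l, DifferentiableAt ℝ (X l) x :=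
    ae_all_iff.2 fun l => (hK l).ae_differentiableAt
  have hfX : ∀ l x, |fderiv ℝ (X l) x (e l)| ≤ K l := by
    intro l x
    have h1 := (fderiv ℝ (X l) x).le_opNorm (e l)
    have h2 : ‖e l‖ = 1 := by simp [he]
    rw [h2, mul_one] at h1
    exact h1.trans (norm_fderiv_le_of_lipschitz ℝ (hK l))
  have hYsupp : ∀ n l, tsupport (fun y => χ n y * X l y) ⊆ D := by
    intro n l
    have hcl : IsClosed {y | ρ y * n ≤ -1} :=
      isClosed_le (hρ.contDiff.continuous.mul continuous_const) continuous_const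
    refine (closure_minimal (fun y hy => ?_) hcl).trans fun y hy => ?_
    · by_contra h
      simp only [Set.mem_ofPred_eq, not_le] at h
      refine hy ?_
      have : χ n y = 0 := Real.smoothTransition.zero_of_nonpos (by linarith)
      simp [this]
    · rw [hρ.mem_iff]
      by_contra h
      have h1 : 0 ≤ ρ y * n := mul_nonneg (not_lt.1 h) (Nat.cast_nonneg n)
      have h2 : ρ y * n ≤ -1 := hy
      linarith
  have hYc : ∀ n l, HasCompactSupport (fun y => χ n y * X l y) := fun n l => (hXc l).mul_left
  have hY : ∀ n l, ∃ K' : ℝ≥0, LipschitzWith K' (fun y => χ n y * X l y) := fun n l =>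
    (hYc n l).exists_lipschitzWith fun x _ =>
      (LipAt.of_contDiffAt (hρ.contDiff_cutoff n).contDiffAt).mul ((hK l).lipAt x)
  choose K' hK' using hY
  have hdY : ∀ n, ∀ᵐ x, ∑ l, fderiv ℝ (fun y => χ n y * X l y) x (e l) =
      χ n x * ∑ l, fderiv ℝ (X l) x (e l) -
        n * deriv Real.smoothTransition (-(n * ρ x) - 1) * w x := by
    intro n
    filter_upwards [hXd] with x hx
    rw [hw, Finset.mul_sum, Finset.mul_sum, ← Finset.sum_sub_distrib]
    refine Finset.sum_congr rfl fun l _ => ?_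
    have h1 : DifferentiableAt ℝ (χ n) x := (hρ.contDiff_cutoff n).differentiable (by simp) x
    rw [fderiv_fun_mul h1 (hx l)]
    have h2 := hρ.fderiv_cutoff n x (e l)
    simp only [add_apply, smul_apply, smul_eq_mul]
    change χ n x * _ + X l x * fderiv ℝ (fun y => Real.smoothTransition (-(n * ρ y) - 1)) x (e l) = _
    rw [h2]
    ring
  have hmeasdiv : Measurable fun x => ∑ l, fderiv ℝ (X l) x (e l) :=
    Finset.measurable_sum _ fun l _ => measurable_fderiv_apply_const ℝ _ _
  have hdiv : ∀ x, |∑ l, fderiv ℝ (X l) x (e l)| ≤ ∑ l, (K l : ℝ) := fun x =>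
    (Finset.abs_sum_le_sum_abs _ _).trans (Finset.sum_le_sum fun l _ => hfX l x)
  have hDm : MeasurableSet D := hρ.isOpen.measurableSet
  have lim1 : Tendsto (fun n : ℕ => ∫ x in D, f x * (χ n x * ∑ l, fderiv ℝ (X l) x (e l) -
        n * deriv Real.smoothTransition (-(n * ρ x) - 1) * w x)) atTop
      (𝓝 (∫ x in D, f x * ∑ l, fderiv ℝ (X l) x (e l))) := by
    refine tendsto_integral_of_dominated_convergence
      (fun x => ‖f x‖ * (∑ l, (K l : ℝ) + 2 * B * (L * C))) ?_ ?_ ?_ ?_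
    · intro n
      refine hf.aestronglyMeasurable.mul (Measurable.aestronglyMeasurable ?_)
      refine ((hρ.contDiff_cutoff n).continuous.measurable.mul hmeasdiv).sub ?_
      refine (measurable_const.mul ?_).mul hL.continuous.measurable
      exact (measurable_deriv _).comp
        (((measurable_const.mul hρ.contDiff.continuous.measurable).neg).sub measurable_const)
    · exact hf.norm.mul_const _
    · intro n
      refine (ae_restrict_iff' hDm).2 (ae_of_all _ fun x hx => ?_)
      rw [norm_mul]
      refine mul_le_mul_of_nonneg_left ?_ (norm_nonneg _)
      refine (norm_sub_le _ _).trans (add_le_add ?_ ?_)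
      · rw [norm_mul]
        calc _ ≤ 1 * ∑ l, (K l : ℝ) :=
              mul_le_mul (hχ1 n x) (hdiv x) (abs_nonneg _) zero_le_one
          _ = _ := one_mul _
      -- In the transition layer n|ρ| ≤ 2, so n|w| ≤ 2LC. The gradient term is thus bounded
      -- uniformly in n; it is eventually zero at each point of `D` and disappears in the limit.
      · by_cases ht : -(n * ρ x) - 1 < 0 ∨ 1 < -(n * ρ x) - 1
        · rw [Real.smoothTransition.deriv_eq_zero ht]
          simp only [mul_zero, zero_mul, norm_zero]
          positivity
        · push Not at ht
          have h0 := (hρ.mem_iff x).1 hx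
          have h1 : n * |ρ x| ≤ 2 := by
            rw [abs_of_neg h0]
            linarith [ht.2]
          rw [Real.norm_eq_abs, abs_mul, abs_mul, Nat.abs_cast]
          calc n * |deriv Real.smoothTransition (-(n * ρ x) - 1)| * |w x|
              ≤ n * B * (L * C * |ρ x|) := by
                gcongr
                · exact hB _
                · exact hwρ x hx
            _ = (n * |ρ x|) * (B * (L * C)) := by ring
            _ ≤ 2 * (B * (L * C)) := by gcongr
            _ = _ := by ring
    · refine (ae_restrict_iff' hDm).2 (ae_of_all _ fun x hx => ?_)
      refine tendsto_const_nhds.congr' ?_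
      filter_upwards [hχe x hx] with n hn
      rw [Real.smoothTransition.deriv_eq_zero (Or.inr hn)]
      simp only [hχ]
      rw [Real.smoothTransition.one_of_one_le hn.le]
      ring
  have lim2 : Tendsto (fun n : ℕ => -∫ x in D, ∑ l, g l x * (χ n x * X l x)) atTop
      (𝓝 (-∫ x in D, ∑ l, g l x * X l x)) := by
    refine (tendsto_integral_of_dominated_convergence
      (fun x => ∑ l, ‖g l x‖ * M l) ?_ ?_ ?_ ?_).neg
    · intro n
      refine Finset.aestronglyMeasurable_fun_sum _ fun l _ => ?_
      exact (hg l).aestronglyMeasurable.mul (hK' n l).continuous.aestronglyMeasurable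
    · exact integrable_finsetSum _ fun l _ => (hg l).norm.mul_const _
    · intro n
      refine ae_of_all _ fun x => ?_
      refine (norm_sum_le _ _).trans (Finset.sum_le_sum fun l _ => ?_)
      rw [norm_mul, norm_mul]
      refine mul_le_mul_of_nonneg_left ?_ (norm_nonneg _)
      calc _ ≤ 1 * M l := mul_le_mul (hχ1 n x) (hM l x) (norm_nonneg _) zero_le_one
        _ = _ := one_mul _
    · refine (ae_restrict_iff' hDm).2 (ae_of_all _ fun x hx => ?_)
      refine tendsto_const_nhds.congr' ?_
      filter_upwards [hχe x hx] with n hn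
      simp only [hχ]
      rw [Real.smoothTransition.one_of_one_le hn.le]
      simp
  refine tendsto_nhds_unique lim1 (lim2.congr fun n => ?_)
  have hYint : ∀ l, Integrable (fun x => f x * fderiv ℝ (fun y => χ n y * X l y) x (e l))
      (volume.restrict D) := by
    intro l
    refine Integrable.mul_bdd (c := K' n l) hf
      (measurable_fderiv_apply_const ℝ _ _).aestronglyMeasurable (ae_of_all _ fun x => ?_)
    have h1 := (fderiv ℝ (fun y => χ n y * X l y) x).le_opNorm (e l)
    have h2 : ‖e l‖ = 1 := by simp [he]
    rw [h2, mul_one] at h1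
    exact h1.trans (norm_fderiv_le_of_lipschitz ℝ (hK' n l))
  have hgint : ∀ l, Integrable (fun x => g l x * (χ n x * X l x)) (volume.restrict D) := by
    intro l
    refine Integrable.mul_bdd (c := 1 * M l) (hg l)
      (hK' n l).continuous.aestronglyMeasurable (ae_of_all _ fun x => ?_)
    rw [norm_mul]
    exact mul_le_mul (hχ1 n x) (hM l x) (norm_nonneg _) zero_le_one
  calc -∫ x in D, ∑ l, g l x * (χ n x * X l x)
      = ∑ l, -∫ x in D, g l x * (χ n x * X l x) := by
        rw [integral_finsetSum _ fun l _ => hgint l, Finset.sum_neg_distrib]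
    _ = ∑ l, ∫ x in D, f x * fderiv ℝ (fun y => χ n y * X l y) x (e l) := by
        refine Finset.sum_congr rfl fun l _ => ?_
        exact ((hfg l).integral_eq_of_lipschitz hρ.isOpen (hK' n l) (hYc n l) (hYsupp n l)).symm
    _ = ∫ x in D, ∑ l, f x * fderiv ℝ (fun y => χ n y * X l y) x (e l) :=
        (integral_finsetSum _ fun l _ => hYint l).symm
    _ = _ := by
        refine integral_congr_ae ?_
        filter_upwards [ae_restrict_of_ae (hdY n)] with x hx
        rw [← Finset.mul_sum, hx]

end IsDefiningFunction

/-! ### Reflections of the collar and their inverses. -/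

/-- A `C^{1,1}` map that fixes the zero set of `ρ` and exchanges, bi-Lipschitzly, the two sides of
the collar `{|ρ| < κ}`. -/
structure IsCollarReflection {d : ℕ} (ρ : EuclideanSpace ℝ (Fin d) → ℝ) (κ : ℝ)
    (Φ : EuclideanSpace ℝ (Fin d) → EuclideanSpace ℝ (Fin d)) : Prop where
  contDiff : ContDiff ℝ 1 Φ
  lipAt_fderiv : ∀ x, LipAt (fderiv ℝ Φ) x
  antilipschitz : ∃ c : ℝ≥0, ∀ x y, |ρ x| < κ → |ρ y| < κ → dist x y ≤ c * dist (Φ x) (Φ y)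
  isInvertible : ∀ x, |ρ x| < κ → (fderiv ℝ Φ x).IsInvertible
  neg_of_pos : ∀ x, |ρ x| < κ → 0 < ρ x → ρ (Φ x) < 0
  pos_of_neg : ∀ x, |ρ x| < κ → ρ x < 0 → 0 < ρ (Φ x)
  eq_self : ∀ x, ρ x = 0 → Φ x = x

namespace IsCollarReflection

variable {d : ℕ} {D : Set (EuclideanSpace ℝ (Fin d))} {ρ : EuclideanSpace ℝ (Fin d) → ℝ} {κ : ℝ}
  {Φ : EuclideanSpace ℝ (Fin d) → EuclideanSpace ℝ (Fin d)}

theorem injOn (h : IsCollarReflection ρ κ Φ) : Set.InjOn Φ {x | |ρ x| < κ} := by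
  obtain ⟨c, hc⟩ := h.antilipschitz
  intro x hx y hy hxy
  have := hc x y hx hy
  rw [hxy, dist_self, mul_zero] at this
  exact dist_le_zero.1 this

theorem isOpen_image (h : IsCollarReflection ρ κ Φ) (hρ : Continuous ρ) :
    IsOpen (Φ '' {x | |ρ x| < κ}) := by
  have hO : IsOpen {x | |ρ x| < κ} := isOpen_lt hρ.abs continuous_const
  rw [isOpen_iff_mem_nhds]
  rintro _ ⟨x, hx, rfl⟩
  obtain ⟨A, hA⟩ := h.isInvertible x hx
  have hs : HasStrictFDerivAt Φ (A : EuclideanSpace ℝ (Fin d) →L[ℝ] EuclideanSpace ℝ (Fin d)) x := by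
    rw [hA]
    exact h.contDiff.contDiffAt.hasStrictFDerivAt (by simp)
  rw [← hs.map_nhds_eq_of_equiv]
  exact image_mem_map (hO.mem_nhds hx)

/-- The inverse of the reflection `Φ` of the collar `{|ρ| < κ}`. -/
noncomputable def inv (ρ : EuclideanSpace ℝ (Fin d) → ℝ) (κ : ℝ)
    (Φ : EuclideanSpace ℝ (Fin d) → EuclideanSpace ℝ (Fin d)) :
    EuclideanSpace ℝ (Fin d) → EuclideanSpace ℝ (Fin d) :=
  Function.invFunOn Φ {x | |ρ x| < κ}

theorem inv_apply (h : IsCollarReflection ρ κ Φ) {x : EuclideanSpace ℝ (Fin d)} (hx : |ρ x| < κ) :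
    inv ρ κ Φ (Φ x) = x :=
  Function.invFunOn_apply_eq (s := {x | |ρ x| < κ}) (f := Φ) hx |> fun h' =>
    h.injOn (Function.invFunOn_mem ⟨x, hx, rfl⟩) hx h'

theorem lipAt_inv (h : IsCollarReflection ρ κ Φ) (hρ : Continuous ρ)
    {x : EuclideanSpace ℝ (Fin d)} (hx : |ρ x| < κ) : LipAt (inv ρ κ Φ) (Φ x) := by
  obtain ⟨c, hc⟩ := h.antilipschitz
  refine ⟨c, _, (h.isOpen_image hρ).mem_nhds ⟨x, hx, rfl⟩, LipschitzOnWith.of_dist_le_mul ?_⟩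
  rintro _ ⟨a, ha, rfl⟩ _ ⟨b, hb, rfl⟩
  rw [h.inv_apply ha, h.inv_apply hb]
  exact hc a b ha hb

theorem hasFDerivAt_inv (h : IsCollarReflection ρ κ Φ) (hρ : Continuous ρ)
    {x : EuclideanSpace ℝ (Fin d)} (hx : |ρ x| < κ) :
    HasFDerivAt (inv ρ κ Φ) (fderiv ℝ Φ x).inverse (Φ x) := by
  obtain ⟨A, hA⟩ := h.isInvertible x hx
  have h1 : HasFDerivAt Φ (A : EuclideanSpace ℝ (Fin d) →L[ℝ] EuclideanSpace ℝ (Fin d))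
      (inv ρ κ Φ (Φ x)) := by
    rw [h.inv_apply hx, hA]
    exact (h.contDiff.differentiable (by simp) x).hasFDerivAt
  rw [← hA, ContinuousLinearMap.inverse_equiv]
  refine HasFDerivAt.of_local_left_inverse (h.lipAt_inv hρ hx).continuousAt h1 ?_
  filter_upwards [(h.isOpen_image hρ).mem_nhds ⟨x, hx, rfl⟩]
  rintro _ ⟨a, ha, rfl⟩
  rw [h.inv_apply ha]

theorem lipAt_inverse (h : IsCollarReflection ρ κ Φ) {x : EuclideanSpace ℝ (Fin d)}
    (hx : |ρ x| < κ) : LipAt (fun y => (fderiv ℝ Φ y).inverse) x :=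
  LipAt.comp (g := ContinuousLinearMap.inverse)
    (LipAt.of_contDiffAt (h.isInvertible x hx).contDiffAt_map_inverse) (h.lipAt_fderiv x)

open Classical in
/-- The function `f ∘ Φ⁻¹`, extended by zero outside the image of the collar. -/
noncomputable def push (ρ : EuclideanSpace ℝ (Fin d) → ℝ) (κ : ℝ)
    (Φ : EuclideanSpace ℝ (Fin d) → EuclideanSpace ℝ (Fin d)) (f : EuclideanSpace ℝ (Fin d) → ℝ) :
    EuclideanSpace ℝ (Fin d) → ℝ :=
  fun y => if y ∈ Φ '' {x | |ρ x| < κ} then f (inv ρ κ Φ y) else 0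

theorem push_apply (h : IsCollarReflection ρ κ Φ) (f : EuclideanSpace ℝ (Fin d) → ℝ)
    {x : EuclideanSpace ℝ (Fin d)} (hx : |ρ x| < κ) : push ρ κ Φ f (Φ x) = f x := by
  rw [push, if_pos ⟨x, hx, rfl⟩, h.inv_apply hx]

theorem push_eventuallyEq (h : IsCollarReflection ρ κ Φ) (hρ : Continuous ρ)
    (f : EuclideanSpace ℝ (Fin d) → ℝ) {x : EuclideanSpace ℝ (Fin d)} (hx : |ρ x| < κ) :
    push ρ κ Φ f =ᶠ[𝓝 (Φ x)] fun y => f (inv ρ κ Φ y) := by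
  filter_upwards [(h.isOpen_image hρ).mem_nhds ⟨x, hx, rfl⟩] with y hy
  rw [push, if_pos hy]

theorem tsupport_push_subset (h : IsCollarReflection ρ κ Φ) {f : EuclideanSpace ℝ (Fin d) → ℝ}
    (hf : HasCompactSupport f) :
    tsupport (push ρ κ Φ f) ⊆ Φ '' tsupport f := by
  refine closure_minimal ?_ (hf.isCompact.image h.contDiff.continuous).isClosed
  intro y hy
  by_cases hyV : y ∈ Φ '' {x | |ρ x| < κ}
  · obtain ⟨x, hx, rfl⟩ := hyV
    rw [Function.mem_support, h.push_apply f hx] at hy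
    exact ⟨x, subset_tsupport _ hy, rfl⟩
  · exact absurd (by rw [push, if_neg hyV]) hy

theorem hasCompactSupport_push (h : IsCollarReflection ρ κ Φ) {f : EuclideanSpace ℝ (Fin d) → ℝ}
    (hf : HasCompactSupport f) :
    HasCompactSupport (push ρ κ Φ f) :=
  (hf.isCompact.image h.contDiff.continuous).of_isClosed_subset (isClosed_tsupport _)
    (h.tsupport_push_subset hf)

/-- Every point of the support of the push has the form Φ(x) with x in the support of `f`, and near
it the push is `f` composed with the inverse, which is Lipschitz by the antilipschitz bound. -/
theorem exists_lipschitzWith_push (h : IsCollarReflection ρ κ Φ) (hρ : Continuous ρ)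
    {f : EuclideanSpace ℝ (Fin d) → ℝ}
    (hf : HasCompactSupport f) (hfs : tsupport f ⊆ {x | |ρ x| < κ})
    (hfL : ∀ x ∈ tsupport f, LipAt f x) :
    ∃ K : ℝ≥0, LipschitzWith K (push ρ κ Φ f) := by
  refine (h.hasCompactSupport_push hf).exists_lipschitzWith fun y hy => ?_
  obtain ⟨x, hx, rfl⟩ := h.tsupport_push_subset hf hy
  refine LipAt.congr ?_ (h.push_eventuallyEq hρ f (hfs hx))
  refine LipAt.comp ?_ (h.lipAt_inv hρ (hfs hx))
  rw [h.inv_apply (hfs hx)]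
  exact hfL x hx

/-- The outer half collar `{0 < ρ < κ / 2}`. -/
def outer (ρ : EuclideanSpace ℝ (Fin d) → ℝ) (κ : ℝ) : Set (EuclideanSpace ℝ (Fin d)) :=
  {x | 0 < ρ x ∧ ρ x < κ / 2}

theorem outer_abs_lt {x : EuclideanSpace ℝ (Fin d)} (hx : x ∈ outer ρ κ) : |ρ x| < κ := by
  rw [abs_of_pos hx.1]
  linarith [hx.1, hx.2]

theorem isOpen_outer (hρ : Continuous ρ) : IsOpen (outer ρ κ) :=
  (isOpen_lt continuous_const hρ).inter (isOpen_lt hρ continuous_const)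

theorem image_outer_subset (h : IsCollarReflection ρ κ Φ) (hD : IsDefiningFunction D ρ) :
    Φ '' outer ρ κ ⊆ D := by
  rintro _ ⟨x, hx, rfl⟩
  exact (hD.mem_iff _).2 (h.neg_of_pos x (outer_abs_lt hx) hx.1)

/-- A point with ρ < 0 is sent out of `D`, and one with ρ = 0 stays on the boundary; so a point of
`D` can only be reached from the outer side. -/
theorem mem_image_outer (h : IsCollarReflection ρ κ Φ) (hD : IsDefiningFunction D ρ)
    {x : EuclideanSpace ℝ (Fin d)} (hx : |ρ x| < κ) (hx2 : ρ x < κ / 2) (hxD : Φ x ∈ D) :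
    Φ x ∈ Φ '' outer ρ κ := by
  refine ⟨x, ⟨?_, hx2⟩, rfl⟩
  by_contra h0
  have h1 := (hD.mem_iff _).1 hxD
  rcases (not_lt.1 h0).lt_or_eq with h2 | h2
  · linarith [h.pos_of_neg x hx h2]
  · rw [h.eq_self x h2] at h1
    linarith

theorem hasFDerivWithinAt (h : IsCollarReflection ρ κ Φ) (s : Set (EuclideanSpace ℝ (Fin d))) :
    ∀ x ∈ s, HasFDerivWithinAt Φ (fderiv ℝ Φ x) s x := fun x _ =>
  (h.contDiff.differentiable (by simp) x).hasFDerivAt.hasFDerivWithinAt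

theorem measurableSet_image_outer (h : IsCollarReflection ρ κ Φ) (hρ : Continuous ρ) :
    MeasurableSet (Φ '' outer ρ κ) :=
  measurable_image_of_fderivWithin (isOpen_outer hρ).measurableSet (h.hasFDerivWithinAt _)
    (h.injOn.mono fun _ hx => outer_abs_lt hx)

theorem integral_image (h : IsCollarReflection ρ κ Φ) (hρ : Continuous ρ)
    (F : EuclideanSpace ℝ (Fin d) → ℝ) :
    ∫ y in Φ '' outer ρ κ, F y = ∫ x in outer ρ κ, |(fderiv ℝ Φ x).det| * F (Φ x) :=
  integral_image_eq_integral_abs_det_fderiv_smul volume (isOpen_outer hρ).measurableSet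
    (h.hasFDerivWithinAt _) (h.injOn.mono fun _ hx => outer_abs_lt hx) F

theorem integrableOn_image_iff (h : IsCollarReflection ρ κ Φ) (hρ : Continuous ρ)
    (F : EuclideanSpace ℝ (Fin d) → ℝ) :
    IntegrableOn F (Φ '' outer ρ κ) ↔
      IntegrableOn (fun x => |(fderiv ℝ Φ x).det| * F (Φ x)) (outer ρ κ) :=
  integrableOn_image_iff_integrableOn_abs_det_fderiv_smul volume (isOpen_outer hρ).measurableSet
    (h.hasFDerivWithinAt _) (h.injOn.mono fun _ hx => outer_abs_lt hx) F

theorem exists_bound_det (h : IsCollarReflection ρ κ Φ) (hc : IsCompact {x | ρ x ≤ κ}) (hκ : 0 < κ) :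
    ∃ M : ℝ≥0, ∀ x ∈ outer ρ κ, |(fderiv ℝ Φ x).det| ≤ M := by
  have hcont : Continuous fun x => (fderiv ℝ Φ x).det :=
    ContinuousLinearMap.continuous_det.comp (h.contDiff.continuous_fderiv (by simp))
  obtain ⟨M, hM⟩ := hc.exists_bound_of_continuousOn hcont.continuousOn
  refine ⟨M.toNNReal, fun x hx => ?_⟩
  have hxc : x ∈ {x | ρ x ≤ κ} := by
    have := hx.2
    change ρ x ≤ κ
    linarith
  exact (hM x hxc).trans (Real.le_coe_toNNReal M)

/-- Pulling back along the reflection, with the Jacobian as a weight, preserves `L^p`. -/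
theorem memLp_comp (h : IsCollarReflection ρ κ Φ) (hρ : Continuous ρ)
    (hc : IsCompact {x | ρ x ≤ κ}) (hκ : 0 < κ) {p : ℝ≥0∞} (hp1 : 1 ≤ p) (hp : p ≠ ⊤)
    {F : EuclideanSpace ℝ (Fin d) → ℝ} (hF : MemLp F p (volume.restrict (Φ '' outer ρ κ))) :
    MemLp (fun x => |(fderiv ℝ Φ x).det| * F (Φ x)) p (volume.restrict (outer ρ κ)) := by
  obtain ⟨M, hM⟩ := h.exists_bound_det hc hκ
  have hfin : volume (Φ '' outer ρ κ) < ⊤ := by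
    have h1 : Φ '' outer ρ κ ⊆ Φ '' {x | ρ x ≤ κ} := by
      refine Set.image_mono fun x hx => ?_
      have := hx.2
      change ρ x ≤ κ
      linarith
    exact (measure_mono h1).trans_lt (hc.image h.contDiff.continuous).measure_lt_top
  have : IsFiniteMeasure (volume.restrict (Φ '' outer ρ κ)) :=
    ⟨by rwa [Measure.restrict_apply_univ]⟩
  have hint : IntegrableOn F (Φ '' outer ρ κ) := hF.integrable hp1
  have hint' := (h.integrableOn_image_iff hρ F).1 hint
  refine ⟨hint'.aestronglyMeasurable, ?_⟩
  have hp0 : p ≠ 0 := (zero_lt_one.trans_le hp1).ne'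
  have hpr : 1 ≤ p.toReal := by
    rw [← ENNReal.toReal_one]
    exact ENNReal.toReal_mono hp hp1
  have h2 := hF.2
  rw [eLpNorm_lt_top_iff_lintegral_rpow_enorm_lt_top hp0 hp] at h2 ⊢
  rw [lintegral_image_eq_lintegral_abs_det_fderiv_mul volume (isOpen_outer hρ).measurableSet
    (h.hasFDerivWithinAt _) (h.injOn.mono fun _ hx => outer_abs_lt hx)] at h2
  -- Pointwise |det|^p ≤ M^(p-1) |det|, and the remaining single power is the Jacobian of the change
  -- of variables.
  refine lt_of_le_of_lt ?_ (ENNReal.mul_lt_top (a := (M : ℝ≥0∞) ^ (p.toReal - 1)) ?_ h2)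
  · rw [← lintegral_const_mul' _ _ (ENNReal.rpow_ne_top_of_nonneg (by linarith) ENNReal.coe_ne_top)]
    refine setLIntegral_mono' (isOpen_outer hρ).measurableSet fun x hx => ?_
    have hm : ENNReal.ofReal |(fderiv ℝ Φ x).det| ≤ M := by
      rw [← ENNReal.ofReal_coe_nnreal]
      exact ENNReal.ofReal_le_ofReal (hM x hx)
    rw [enorm_mul, ENNReal.mul_rpow_of_nonneg _ _ (by linarith), ← mul_assoc]
    gcongr
    rw [Real.enorm_eq_ofReal_abs, abs_abs]
    calc ENNReal.ofReal |(fderiv ℝ Φ x).det| ^ p.toReal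
        = ENNReal.ofReal |(fderiv ℝ Φ x).det| ^ (p.toReal - 1) *
            ENNReal.ofReal |(fderiv ℝ Φ x).det| ^ (1 : ℝ) := by
          rw [← ENNReal.rpow_add_of_nonneg _ _ (by linarith) zero_le_one, sub_add_cancel]
      _ ≤ _ := by
          rw [ENNReal.rpow_one]
          gcongr
  · exact ENNReal.rpow_lt_top_of_nonneg (by linarith) ENNReal.coe_ne_top

/-- A `C^1` cutoff equal to one on `{|ρ| ≤ κ / 2}` and supported in the collar `{|ρ| < κ}`. -/
noncomputable def cutoff (ρ : EuclideanSpace ℝ (Fin d) → ℝ) (κ : ℝ) (x : EuclideanSpace ℝ (Fin d)) :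
    ℝ :=
  Real.smoothTransition (3 - 6 * (ρ x / κ) ^ 2)

theorem contDiff_cutoff (hρ : ContDiff ℝ 1 ρ) : ContDiff ℝ 1 (cutoff ρ κ) := by
  unfold cutoff
  exact Real.smoothTransition.contDiff.comp (by fun_prop)

theorem cutoff_eq_one (hκ : 0 < κ) {x : EuclideanSpace ℝ (Fin d)} (hx : |ρ x| ≤ κ / 2) :
    cutoff ρ κ x = 1 := by
  -- At |ρ| = κ/2 the argument equals 3/2; it falls to zero at (ρ/κ)² = 1/2, still strictly inside
  -- the collar.
  refine Real.smoothTransition.one_of_one_le ?_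
  have h1 : |ρ x / κ| ≤ 1 / 2 := by
    rw [abs_div, abs_of_pos hκ, div_le_iff₀ hκ]
    linarith
  have h2 : (ρ x / κ) ^ 2 ≤ (1 / 2) ^ 2 := sq_le_sq' (by linarith [(abs_le.1 h1).1]) (abs_le.1 h1).2
  linarith

theorem tsupport_cutoff_subset (hρ : Continuous ρ) (hκ : 0 < κ) :
    tsupport (cutoff ρ κ) ⊆ {x | |ρ x| < κ} := by
  have hcl : IsClosed {x | (ρ x / κ) ^ 2 ≤ 1 / 2} :=
    isClosed_le ((hρ.div_const _).pow 2) continuous_const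
  refine (closure_minimal (fun x hx => ?_) hcl).trans fun x hx => ?_
  · by_contra h
    rw [Set.mem_ofPred_eq, not_le] at h
    exact hx (Real.smoothTransition.zero_of_nonpos (by linarith))
  · have h1 : (ρ x / κ) ^ 2 < 1 := lt_of_le_of_lt hx (by norm_num)
    have h2 : |ρ x / κ| < 1 := by rwa [sq_lt_one_iff_abs_lt_one] at h1
    rwa [abs_div, abs_of_pos hκ, div_lt_one hκ] at h2

theorem hasCompactSupport_cutoff (hρ : Continuous ρ) (hκ : 0 < κ) (hc : IsCompact {x | ρ x ≤ κ}) :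
    HasCompactSupport (cutoff ρ κ) := by
  refine hc.of_isClosed_subset (isClosed_tsupport _)
    ((tsupport_cutoff_subset hρ hκ).trans fun x hx => ?_)
  exact (lt_of_abs_lt (show |ρ x| < κ from hx)).le

end IsCollarReflection

theorem LipschitzWith.abs_fderiv_single_le {d : ℕ} {f : EuclideanSpace ℝ (Fin d) → ℝ} {K : ℝ≥0}
    (hf : LipschitzWith K f) (x : EuclideanSpace ℝ (Fin d)) (l : Fin d) :
    |fderiv ℝ f x (EuclideanSpace.single l 1)| ≤ K := by
  have h1 := (fderiv ℝ f x).le_opNorm (EuclideanSpace.single l 1)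
  have h2 : ‖(EuclideanSpace.single l 1 : EuclideanSpace ℝ (Fin d))‖ = 1 := by simp
  rw [h2, mul_one] at h1
  exact h1.trans (norm_fderiv_le_of_lipschitz ℝ hf)

theorem IsTestFunction.exists_lipschitzWith {d : ℕ} {Ω : Set (EuclideanSpace ℝ (Fin d))}
    {φ : EuclideanSpace ℝ (Fin d) → ℝ} (hφ : IsTestFunction Ω φ) :
    ∃ K : ℝ≥0, LipschitzWith K φ :=
  hφ.hasCompactSupport.exists_lipschitzWith fun _ _ =>
    LipAt.of_contDiffAt (hφ.contDiff.of_le (by simp)).contDiffAt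

/-! ### Integration by parts modulo tangential fields. -/

namespace IsDefiningFunction

variable {d : ℕ} {D : Set (EuclideanSpace ℝ (Fin d))} {ρ : EuclideanSpace ℝ (Fin d) → ℝ}

/-- Integration by parts for a Lipschitz field that agrees, up to a tangential field, with a
linear combination of other fields. -/
theorem integral_add_integral_eq_sum [Nonempty (Fin d)] (hρ : IsDefiningFunction D ρ)
    {f : EuclideanSpace ℝ (Fin d) → ℝ} {g : Fin d → EuclideanSpace ℝ (Fin d) → ℝ}
    (hf : IntegrableOn f D) (hg : ∀ l, IntegrableOn (g l) D)
    (hfg : ∀ l, HasWeakPartialDeriv D l f (g l))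
    {X : Fin d → EuclideanSpace ℝ (Fin d) → ℝ} (hX : ∀ l, ∃ K : ℝ≥0, LipschitzWith K (X l))
    (hXc : ∀ l, HasCompactSupport (X l)) {ι : Type*} [Fintype ι] (c : ι → ℝ)
    {Y : ι → Fin d → EuclideanSpace ℝ (Fin d) → ℝ}
    (hY : ∀ s l, ∃ K : ℝ≥0, LipschitzWith K (Y s l)) (hYc : ∀ s l, HasCompactSupport (Y s l))
    (htan : ∀ y, ρ y = 0 → ∑ l, X l y * fderiv ℝ ρ y (EuclideanSpace.single l 1) =
      ∑ s, c s * ∑ l, Y s l y * fderiv ℝ ρ y (EuclideanSpace.single l 1)) :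
    (∫ x in D, f x * ∑ l, fderiv ℝ (X l) x (EuclideanSpace.single l 1)) +
        ∫ x in D, ∑ l, g l x * X l x =
      ∑ s, c s * ((∫ x in D, f x * ∑ l, fderiv ℝ (Y s l) x (EuclideanSpace.single l 1)) +
        ∫ x in D, ∑ l, g l x * Y s l x) := by
  choose K hK using hX
  choose K' hK' using hY
  -- By `htan` this difference is tangent to the boundary, so `integral_mul_div_eq` applies to it;
  -- the rest is linearity.
  set Z : Fin d → EuclideanSpace ℝ (Fin d) → ℝ := fun l y => X l y - ∑ s, c s * Y s l y with hZ
  have hZc : ∀ l, HasCompactSupport (Z l) := by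
    intro l
    have hcomp : IsCompact (tsupport (X l) ∪ ⋃ s, tsupport (Y s l)) :=
      (hXc l).isCompact.union (isCompact_iUnion fun s => hYc s l)
    refine HasCompactSupport.intro hcomp fun x hx => ?_
    simp only [Set.mem_union, Set.mem_iUnion, not_or, not_exists] at hx
    simp only [hZ]
    rw [image_eq_zero_of_notMem_tsupport hx.1, Finset.sum_eq_zero, sub_zero]
    intro s _
    rw [image_eq_zero_of_notMem_tsupport (hx.2 s), mul_zero]
  have hZL : ∀ l, ∃ L : ℝ≥0, LipschitzWith L (Z l) := fun l =>
    (hZc l).exists_lipschitzWith fun x _ => ((hK l).lipAt x).sub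
      (LipAt.sum fun s _ => (LipAt.const (c s) x).mul ((hK' s l).lipAt x))
  have hbf : ∀ {W : EuclideanSpace ℝ (Fin d) → ℝ} {L : ℝ≥0} (l : Fin d), LipschitzWith L W →
      Integrable (fun x => f x * fderiv ℝ W x (EuclideanSpace.single l 1))
        (volume.restrict D) := fun l hW =>
    Integrable.mul_bdd hf (measurable_fderiv_apply_const ℝ _ _).aestronglyMeasurable
      (ae_of_all _ fun x => hW.abs_fderiv_single_le x l)
  have hbg : ∀ {W : EuclideanSpace ℝ (Fin d) → ℝ} {L : ℝ≥0} (l : Fin d), LipschitzWith L W →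
      HasCompactSupport W → Integrable (fun x => g l x * W x) (volume.restrict D) := by
    intro W L l hW hWc
    obtain ⟨M, hM⟩ := hWc.exists_bound_of_continuous hW.continuous
    exact Integrable.mul_bdd (hg l) hW.continuous.aestronglyMeasurable (ae_of_all _ hM)
  have main := hρ.integral_mul_div_eq hf hg hfg hZL hZc (fun y hy => by
    simp only [hZ, sub_mul, Finset.sum_sub_distrib, htan y hy, Finset.sum_mul, Finset.mul_sum]
    rw [Finset.sum_comm]
    simp [mul_assoc])
  have e1 : ∫ x in D, f x * ∑ l, fderiv ℝ (Z l) x (EuclideanSpace.single l 1) =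
      (∫ x in D, f x * ∑ l, fderiv ℝ (X l) x (EuclideanSpace.single l 1)) -
      ∑ s, c s * ∫ x in D, f x * ∑ l, fderiv ℝ (Y s l) x (EuclideanSpace.single l 1) := by
    have hi : ∀ s, Integrable
        (fun x => f x * ∑ l, fderiv ℝ (Y s l) x (EuclideanSpace.single l 1))
        (volume.restrict D) := fun s => by
      simp only [Finset.mul_sum]
      exact integrable_finsetSum _ fun l _ => hbf l (hK' s l)
    have hi0 : Integrable
        (fun x => f x * ∑ l, fderiv ℝ (X l) x (EuclideanSpace.single l 1))
        (volume.restrict D) := by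
      simp only [Finset.mul_sum]
      exact integrable_finsetSum _ fun l _ => hbf l (hK l)
    rw [← Finset.sum_congr rfl fun s _ => integral_const_mul (c s) _,
      ← integral_finsetSum _ fun s _ => (hi s).const_mul (c s),
      ← integral_sub hi0 (integrable_finsetSum _ fun s _ => (hi s).const_mul (c s))]
    refine integral_congr_ae ?_
    have h1 : ∀ᵐ x, ∀ l, DifferentiableAt ℝ (X l) x :=
      ae_all_iff.2 fun l => (hK l).ae_differentiableAt
    have h2 : ∀ᵐ x, ∀ s l, DifferentiableAt ℝ (Y s l) x :=
      ae_all_iff.2 fun s => ae_all_iff.2 fun l => (hK' s l).ae_differentiableAt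
    filter_upwards [ae_restrict_of_ae h1, ae_restrict_of_ae h2] with x hx1 hx2
    have h3 : ∀ l, fderiv ℝ (Z l) x (EuclideanSpace.single l 1) =
        fderiv ℝ (X l) x (EuclideanSpace.single l 1) -
          ∑ s, c s * fderiv ℝ (Y s l) x (EuclideanSpace.single l 1) := by
      intro l
      have h4 : HasFDerivAt (Z l) (fderiv ℝ (X l) x - ∑ s, c s • fderiv ℝ (Y s l) x) x :=
        (hx1 l).hasFDerivAt.sub
          (HasFDerivAt.fun_sum fun s _ => (hx2 s l).hasFDerivAt.const_mul (c s))
      rw [h4.fderiv]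
      simp
    simp only [h3, Finset.sum_sub_distrib, mul_sub]
    congr 1
    rw [Finset.sum_comm, Finset.mul_sum]
    refine Finset.sum_congr rfl fun s _ => ?_
    rw [← Finset.mul_sum]
    ring
  have e2 : ∫ x in D, ∑ l, g l x * Z l x =
      (∫ x in D, ∑ l, g l x * X l x) - ∑ s, c s * ∫ x in D, ∑ l, g l x * Y s l x := by
    have hi : ∀ s, Integrable (fun x => ∑ l, g l x * Y s l x) (volume.restrict D) := fun s =>
      integrable_finsetSum _ fun l _ => hbg l (hK' s l) (hYc s l)
    have hi0 : Integrable (fun x => ∑ l, g l x * X l x) (volume.restrict D) :=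
      integrable_finsetSum _ fun l _ => hbg l (hK l) (hXc l)
    rw [← Finset.sum_congr rfl fun s _ => integral_const_mul (c s) _,
      ← integral_finsetSum _ fun s _ => (hi s).const_mul (c s),
      ← integral_sub hi0 (integrable_finsetSum _ fun s _ => (hi s).const_mul (c s))]
    congr 1
    funext x
    simp only [hZ, mul_sub, Finset.sum_sub_distrib]
    congr 1
    simp only [Finset.mul_sum]
    rw [Finset.sum_comm]
    refine Finset.sum_congr rfl fun s _ => Finset.sum_congr rfl fun l _ => by ring
  rw [e1, e2] at main
  simp only [mul_add, Finset.sum_add_distrib]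
  linarith

end IsDefiningFunction

/-! ### Transport of test fields through a reflection. -/

namespace IsCollarReflection

variable {d : ℕ} {D : Set (EuclideanSpace ℝ (Fin d))} {ρ : EuclideanSpace ℝ (Fin d) → ℝ} {κ : ℝ}
  {Φ : EuclideanSpace ℝ (Fin d) → EuclideanSpace ℝ (Fin d)}

/-- The components of the vector field `p ∂Φ/∂e`, cut off to the collar. -/
noncomputable def coeff (ρ : EuclideanSpace ℝ (Fin d) → ℝ) (κ : ℝ)
    (Φ : EuclideanSpace ℝ (Fin d) → EuclideanSpace ℝ (Fin d)) (p : EuclideanSpace ℝ (Fin d) → ℝ)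
    (e : EuclideanSpace ℝ (Fin d)) (l : Fin d) (x : EuclideanSpace ℝ (Fin d)) : ℝ :=
  cutoff ρ κ x * (p x * fderiv ℝ Φ x e l)

/-- The divergence of the pushed forward field `coeff`. -/
noncomputable def divCoeff (ρ : EuclideanSpace ℝ (Fin d) → ℝ) (κ : ℝ)
    (Φ : EuclideanSpace ℝ (Fin d) → EuclideanSpace ℝ (Fin d)) (p : EuclideanSpace ℝ (Fin d) → ℝ)
    (e : EuclideanSpace ℝ (Fin d)) (y : EuclideanSpace ℝ (Fin d)) : ℝ :=
  ∑ l, fderiv ℝ (push ρ κ Φ (coeff ρ κ Φ p e l)) y (EuclideanSpace.single l 1)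

section Transport

variable {p : EuclideanSpace ℝ (Fin d) → ℝ} {e : EuclideanSpace ℝ (Fin d)}

theorem lipAt_coeff (h : IsCollarReflection ρ κ Φ) (hρ : ContDiff ℝ 1 ρ) (l : Fin d)
    {x : EuclideanSpace ℝ (Fin d)} (hp : LipAt p x) : LipAt (coeff ρ κ Φ p e l) x := by
  refine (LipAt.of_contDiffAt (contDiff_cutoff hρ).contDiffAt).mul (hp.mul ?_)
  refine LipAt.comp (g := fun A : EuclideanSpace ℝ (Fin d) →L[ℝ] EuclideanSpace ℝ (Fin d) => A e l)
    ?_ (h.lipAt_fderiv x)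
  exact LipAt.of_contDiffAt (((EuclideanSpace.proj l : EuclideanSpace ℝ (Fin d) →L[ℝ] ℝ).comp
    (ContinuousLinearMap.apply ℝ (EuclideanSpace ℝ (Fin d)) e)).contDiff.contDiffAt)

theorem tsupport_coeff_subset (l : Fin d) :
    tsupport (coeff ρ κ Φ p e l) ⊆ tsupport (cutoff ρ κ) :=
  tsupport_mul_subset_left

theorem hasCompactSupport_coeff (hρ : Continuous ρ) (hκ : 0 < κ) (hc : IsCompact {x | ρ x ≤ κ})
    (l : Fin d) : HasCompactSupport (coeff ρ κ Φ p e l) :=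
  (hasCompactSupport_cutoff hρ hκ hc).mul_right

theorem exists_lipschitzWith_push_coeff (h : IsCollarReflection ρ κ Φ) (hρ : ContDiff ℝ 1 ρ)
    (hκ : 0 < κ) (hc : IsCompact {x | ρ x ≤ κ}) (hp : ∀ x, |ρ x| < κ → LipAt p x) (l : Fin d) :
    ∃ K : ℝ≥0, LipschitzWith K (push ρ κ Φ (coeff ρ κ Φ p e l)) := by
  have hs : tsupport (coeff ρ κ Φ p e l) ⊆ {x | |ρ x| < κ} :=
    (tsupport_coeff_subset l).trans (tsupport_cutoff_subset hρ.continuous hκ)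
  exact h.exists_lipschitzWith_push hρ.continuous (hasCompactSupport_coeff hρ.continuous hκ hc l)
    hs fun x hx => h.lipAt_coeff hρ l (hp x (hs hx))

variable {φ : EuclideanSpace ℝ (Fin d) → ℝ}

theorem tsupport_coeff_mul_subset (hρ : Continuous ρ) (hκ : 0 < κ) (l : Fin d) :
    tsupport (fun x => coeff ρ κ Φ p e l x * φ x) ⊆ {x | |ρ x| < κ} :=
  tsupport_mul_subset_left.trans
    ((tsupport_coeff_subset l).trans (tsupport_cutoff_subset hρ hκ))

theorem hasCompactSupport_push_coeff_mul (h : IsCollarReflection ρ κ Φ) (hρ : Continuous ρ)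
    (hκ : 0 < κ) (hc : IsCompact {x | ρ x ≤ κ}) (l : Fin d) :
    HasCompactSupport (push ρ κ Φ fun x => coeff ρ κ Φ p e l x * φ x) :=
  h.hasCompactSupport_push (hasCompactSupport_coeff hρ hκ hc l).mul_right

theorem exists_lipschitzWith_push_coeff_mul (h : IsCollarReflection ρ κ Φ) (hρ : ContDiff ℝ 1 ρ)
    (hκ : 0 < κ) (hc : IsCompact {x | ρ x ≤ κ}) (hp : ∀ x, |ρ x| < κ → LipAt p x)
    (hφ : IsTestFunction {x | ρ x < κ / 2} φ) (l : Fin d) :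
    ∃ K : ℝ≥0, LipschitzWith K (push ρ κ Φ fun x => coeff ρ κ Φ p e l x * φ x) := by
  have hs := tsupport_coeff_mul_subset (Φ := Φ) (p := p) (e := e) (φ := φ) hρ.continuous hκ l
  refine h.exists_lipschitzWith_push hρ.continuous
    (hasCompactSupport_coeff hρ.continuous hκ hc l).mul_right hs fun x hx => ?_
  exact (h.lipAt_coeff hρ l (hp x (hs hx))).mul
    (LipAt.of_contDiffAt (hφ.contDiff.of_le (by simp)).contDiffAt)

/-- The reflection is the identity on the boundary and the cutoff is one there. These boundary
values enter the tangency condition. -/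
theorem push_coeff_mul_eq_of_eq_zero (h : IsCollarReflection ρ κ Φ) (hκ : 0 < κ) (l : Fin d)
    {y : EuclideanSpace ℝ (Fin d)} (hy : ρ y = 0) :
    push ρ κ Φ (fun x => coeff ρ κ Φ p e l x * φ x) y = p y * φ y * fderiv ℝ Φ y e l := by
  have hy' : |ρ y| < κ := by rwa [hy, abs_zero]
  have h1 := h.push_apply (fun x => coeff ρ κ Φ p e l x * φ x) hy'
  rw [h.eq_self y hy] at h1
  rw [h1, coeff, cutoff_eq_one hκ (by rw [hy, abs_zero]; linarith)]
  ring

/-- A push forward of a function supported in `{ρ < κ / 2}` vanishes near the points of `D` outside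
the image of the outer half collar. -/
theorem push_eventuallyEq_zero (h : IsCollarReflection ρ κ Φ) (hD : IsDefiningFunction D ρ)
    {f : EuclideanSpace ℝ (Fin d) → ℝ} (hf : HasCompactSupport f)
    (hfs : tsupport f ⊆ {x | |ρ x| < κ}) (hfs' : tsupport f ⊆ {x | ρ x < κ / 2})
    {y : EuclideanSpace ℝ (Fin d)} (hy : y ∈ D) (hyU : y ∉ Φ '' outer ρ κ) :
    push ρ κ Φ f =ᶠ[𝓝 y] 0 := by
  refine notMem_tsupport_iff_eventuallyEq.1 fun hy' => ?_
  obtain ⟨x, hx, rfl⟩ := h.tsupport_push_subset hf hy'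
  exact hyU (h.mem_image_outer hD (hfs hx) (hfs' hx) hy)

theorem push_coeff_mul_eq (h : IsCollarReflection ρ κ Φ) (hD : IsDefiningFunction D ρ)
    (hκ : 0 < κ) (hc : IsCompact {x | ρ x ≤ κ}) (hφ : IsTestFunction {x | ρ x < κ / 2} φ)
    (l : Fin d) {y : EuclideanSpace ℝ (Fin d)} (hy : y ∈ D) :
    push ρ κ Φ (fun x => coeff ρ κ Φ p e l x * φ x) y =
      (Φ '' outer ρ κ).indicator
        (fun y => push ρ κ Φ (coeff ρ κ Φ p e l) y * φ (inv ρ κ Φ y)) y := by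
  by_cases hyU : y ∈ Φ '' outer ρ κ
  · rw [Set.indicator_of_mem hyU]
    obtain ⟨x, hx, rfl⟩ := hyU
    rw [h.push_apply _ (outer_abs_lt hx), h.push_apply _ (outer_abs_lt hx),
      h.inv_apply (outer_abs_lt hx)]
  · rw [Set.indicator_of_notMem hyU]
    exact (h.push_eventuallyEq_zero hD
      (hasCompactSupport_coeff hD.contDiff.continuous hκ hc l).mul_right
      (tsupport_coeff_mul_subset hD.contDiff.continuous hκ l)
      (tsupport_mul_subset_right.trans hφ.tsupport_subset) hy hyU).self_of_nhds

/-- The pushed field is pφ DΦ(e), and the derivative of φ ∘ Φ⁻¹ along DΦ(e) is ∂_e φ by the chain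
rule. Leibniz' rule thus separates the derivative of the test function from `divCoeff`, which does
not involve φ. -/
theorem ae_div_push_coeff_mul (h : IsCollarReflection ρ κ Φ) (hD : IsDefiningFunction D ρ)
    (hκ : 0 < κ) (hc : IsCompact {x | ρ x ≤ κ}) (hp : ∀ x, |ρ x| < κ → LipAt p x)
    (hφ : IsTestFunction {x | ρ x < κ / 2} φ) :
    ∀ᵐ y, y ∈ D →
      ∑ l, fderiv ℝ (push ρ κ Φ fun x => coeff ρ κ Φ p e l x * φ x) y
          (EuclideanSpace.single l 1) =
      (Φ '' outer ρ κ).indicator (fun y => p (inv ρ κ Φ y) * fderiv ℝ φ (inv ρ κ Φ y) e +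
          φ (inv ρ κ Φ y) * divCoeff ρ κ Φ p e y) y := by
  have hρ := hD.contDiff.continuous
  have hae : ∀ᵐ y, ∀ l, DifferentiableAt ℝ (push ρ κ Φ (coeff ρ κ Φ p e l)) y :=
    ae_all_iff.2 fun l => by
      obtain ⟨K, hK⟩ := h.exists_lipschitzWith_push_coeff (p := p) (e := e) hD.contDiff hκ hc hp l
      exact hK.ae_differentiableAt
  filter_upwards [hae] with y hy hyD
  by_cases hyU : y ∈ Φ '' outer ρ κ
  · rw [Set.indicator_of_mem hyU]
    obtain ⟨x, hx, rfl⟩ := hyU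
    have hx' := outer_abs_lt hx
    have hΨ := h.hasFDerivAt_inv hρ hx'
    have hφΨ : HasFDerivAt (fun y => φ (inv ρ κ Φ y))
        ((fderiv ℝ φ x).comp (fderiv ℝ Φ x).inverse) (Φ x) := by
      refine HasFDerivAt.comp (g := φ) (Φ x) ?_ hΨ
      rw [h.inv_apply hx']
      exact (hφ.contDiff.differentiable (by simp) x).hasFDerivAt
    have hl : ∀ l, fderiv ℝ (push ρ κ Φ fun x => coeff ρ κ Φ p e l x * φ x) (Φ x)
          (EuclideanSpace.single l 1) =
        (p x * fderiv ℝ Φ x e l) *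
          fderiv ℝ φ x ((fderiv ℝ Φ x).inverse (EuclideanSpace.single l 1)) +
        φ x * fderiv ℝ (push ρ κ Φ (coeff ρ κ Φ p e l)) (Φ x) (EuclideanSpace.single l 1) := by
      intro l
      have heq : (push ρ κ Φ fun x => coeff ρ κ Φ p e l x * φ x) =ᶠ[𝓝 (Φ x)]
          fun y => push ρ κ Φ (coeff ρ κ Φ p e l) y * φ (inv ρ κ Φ y) := by
        filter_upwards [h.push_eventuallyEq hρ (fun x => coeff ρ κ Φ p e l x * φ x) hx',
          h.push_eventuallyEq hρ (coeff ρ κ Φ p e l) hx'] with z h1 h2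
        rw [h1, h2]
      rw [heq.fderiv_eq, fderiv_fun_mul (hy l) hφΨ.differentiableAt, hφΨ.fderiv, h.push_apply _ hx', h.inv_apply hx',
        coeff, cutoff_eq_one hκ (by rw [abs_of_pos hx.1]; exact hx.2.le)]
      simp
    rw [Finset.sum_congr rfl fun l _ => hl l, Finset.sum_add_distrib, h.inv_apply hx', divCoeff,
      Finset.mul_sum]
    congr 1
    simp only [mul_assoc]
    rw [← Finset.mul_sum]
    congr 1
    have h1 : (∑ l, fderiv ℝ Φ x e l • (EuclideanSpace.single l 1 : EuclideanSpace ℝ (Fin d))) =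
        fderiv ℝ Φ x e := by
      simpa using (EuclideanSpace.basisFun (Fin d) ℝ).sum_repr (fderiv ℝ Φ x e)
    calc _ = fderiv ℝ φ x ((fderiv ℝ Φ x).inverse
          (∑ l, fderiv ℝ Φ x e l • (EuclideanSpace.single l 1 : EuclideanSpace ℝ (Fin d)))) := by
          simp only [map_sum, map_smul, smul_eq_mul]
      _ = fderiv ℝ φ x e := by rw [h1, (h.isInvertible x hx').inverse_apply_self]
  · rw [Set.indicator_of_notMem hyU]
    refine Finset.sum_eq_zero fun l _ => ?_
    have h0 : (push ρ κ Φ fun x => coeff ρ κ Φ p e l x * φ x) =ᶠ[𝓝 y] 0 :=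
      (h.push_eventuallyEq_zero hD
      (hasCompactSupport_coeff (Φ := Φ) (p := p) (e := e) hρ hκ hc l).mul_right
      (tsupport_coeff_mul_subset hρ hκ l)
      (tsupport_mul_subset_right.trans hφ.tsupport_subset) hyD hyU)
    rw [h0.fderiv_eq]
    simp

/-- The substitution y = Φ(x) turns the integral over `D` into one over the outer half collar
against φ itself; the Jacobian that appears is the weight in the Piola transform. -/
theorem integral_mul_div_push (h : IsCollarReflection ρ κ Φ) (hD : IsDefiningFunction D ρ)
    (hκ : 0 < κ) (hc : IsCompact {x | ρ x ≤ κ}) (hp : ∀ x, |ρ x| < κ → LipAt p x)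
    (hφ : IsTestFunction {x | ρ x < κ / 2} φ) (f : EuclideanSpace ℝ (Fin d) → ℝ) :
    ∫ y in D, f y * ∑ l, fderiv ℝ (push ρ κ Φ fun x => coeff ρ κ Φ p e l x * φ x) y
          (EuclideanSpace.single l 1) =
      ∫ x in outer ρ κ, (|(fderiv ℝ Φ x).det| * f (Φ x) * (p x * fderiv ℝ φ x e) +
        |(fderiv ℝ Φ x).det| * (f (Φ x) * divCoeff ρ κ Φ p e (Φ x)) * φ x) := by
  have hm := h.measurableSet_image_outer hD.contDiff.continuous
  have e1 : ∫ y in D, f y * ∑ l, fderiv ℝ (push ρ κ Φ fun x => coeff ρ κ Φ p e l x * φ x) y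
          (EuclideanSpace.single l 1) =
      ∫ y in D, (Φ '' outer ρ κ).indicator (fun y => f y * (p (inv ρ κ Φ y) *
        fderiv ℝ φ (inv ρ κ Φ y) e + φ (inv ρ κ Φ y) * divCoeff ρ κ Φ p e y)) y := by
    refine integral_congr_ae ((ae_restrict_iff' hD.isOpen.measurableSet).2 ?_)
    filter_upwards [h.ae_div_push_coeff_mul hD hκ hc hp hφ] with y hy hyD
    rw [hy hyD]
    by_cases hyU : y ∈ Φ '' outer ρ κ
    · simp only [Set.indicator_of_mem hyU]
    · simp only [Set.indicator_of_notMem hyU, mul_zero]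
  rw [e1, setIntegral_indicator hm,
    Set.inter_eq_self_of_subset_right (h.image_outer_subset hD),
    h.integral_image hD.contDiff.continuous]
  refine setIntegral_congr_fun (isOpen_outer hD.contDiff.continuous).measurableSet fun x hx => ?_
  simp only [h.inv_apply (outer_abs_lt hx)]
  ring

theorem integral_sum_mul_push (h : IsCollarReflection ρ κ Φ) (hD : IsDefiningFunction D ρ)
    (hκ : 0 < κ) (hc : IsCompact {x | ρ x ≤ κ}) (hφ : IsTestFunction {x | ρ x < κ / 2} φ)
    (g : Fin d → EuclideanSpace ℝ (Fin d) → ℝ) :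
    ∫ y in D, ∑ l, g l y * push ρ κ Φ (fun x => coeff ρ κ Φ p e l x * φ x) y =
      ∫ x in outer ρ κ, |(fderiv ℝ Φ x).det| *
        (∑ l, g l (Φ x) * push ρ κ Φ (coeff ρ κ Φ p e l) (Φ x)) * φ x := by
  have hm := h.measurableSet_image_outer hD.contDiff.continuous
  have e1 : ∫ y in D, ∑ l, g l y * push ρ κ Φ (fun x => coeff ρ κ Φ p e l x * φ x) y =
      ∫ y in D, (Φ '' outer ρ κ).indicator (fun y =>
        (∑ l, g l y * push ρ κ Φ (coeff ρ κ Φ p e l) y) * φ (inv ρ κ Φ y)) y := by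
    refine setIntegral_congr_fun hD.isOpen.measurableSet fun y hy => ?_
    simp only [h.push_coeff_mul_eq hD hκ hc hφ _ hy]
    by_cases hyU : y ∈ Φ '' outer ρ κ
    · simp only [Set.indicator_of_mem hyU, Finset.sum_mul, mul_assoc]
    · simp only [Set.indicator_of_notMem hyU, mul_zero, Finset.sum_const_zero]
  rw [e1, setIntegral_indicator hm,
    Set.inter_eq_self_of_subset_right (h.image_outer_subset hD),
    h.integral_image hD.contDiff.continuous]
  refine setIntegral_congr_fun (isOpen_outer hD.contDiff.continuous).measurableSet fun x hx => ?_
  simp only [h.inv_apply (outer_abs_lt hx)]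
  ring

end Transport

end IsCollarReflection

/-! ### Coefficients of the reflected field and its derivatives. -/

namespace IsCollarReflection

variable {d : ℕ} {D : Set (EuclideanSpace ℝ (Fin d))} {ρ : EuclideanSpace ℝ (Fin d) → ℝ} {κ : ℝ}
  {Φ : EuclideanSpace ℝ (Fin d) → EuclideanSpace ℝ (Fin d)}

/-- The matrix entries of the inverse of the derivative of `Φ`. -/
noncomputable def invEntry (Φ : EuclideanSpace ℝ (Fin d) → EuclideanSpace ℝ (Fin d)) (j k : Fin d)
    (x : EuclideanSpace ℝ (Fin d)) : ℝ :=
  (fderiv ℝ Φ x).inverse (EuclideanSpace.single k 1) j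

theorem lipAt_invEntry (h : IsCollarReflection ρ κ Φ) (j k : Fin d)
    {x : EuclideanSpace ℝ (Fin d)} (hx : |ρ x| < κ) : LipAt (invEntry Φ j k) x := by
  refine LipAt.comp (g := fun A : EuclideanSpace ℝ (Fin d) →L[ℝ] EuclideanSpace ℝ (Fin d) =>
    A (EuclideanSpace.single k 1) j) ?_ (h.lipAt_inverse hx)
  exact LipAt.of_contDiffAt (((EuclideanSpace.proj j : EuclideanSpace ℝ (Fin d) →L[ℝ] ℝ).comp
    (ContinuousLinearMap.apply ℝ (EuclideanSpace ℝ (Fin d))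
      (EuclideanSpace.single k 1 : EuclideanSpace ℝ (Fin d)))).contDiff.contDiffAt)

theorem memLp_top_invEntry (h : IsCollarReflection ρ κ Φ) (hρ : Continuous ρ) (hκ : 0 < κ)
    (hc : IsCompact {x | ρ x ≤ κ}) (j k : Fin d) :
    MemLp (invEntry Φ j k) ⊤ (volume.restrict (outer ρ κ)) := by
  have hO : ContinuousOn (invEntry Φ j k) {x | |ρ x| < κ} := fun x hx =>
    (h.lipAt_invEntry j k hx).continuousAt.continuousWithinAt
  have hcomp : IsCompact {x | |ρ x| ≤ κ / 2} := by
    refine hc.of_isClosed_subset (isClosed_le hρ.abs continuous_const) fun x hx => ?_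
    have h1 : |ρ x| ≤ κ / 2 := hx
    change ρ x ≤ κ
    linarith [le_abs_self (ρ x)]
  have hsub : {x | |ρ x| ≤ κ / 2} ⊆ {x | |ρ x| < κ} := fun x hx => by
    have h1 : |ρ x| ≤ κ / 2 := hx
    change |ρ x| < κ
    linarith
  obtain ⟨M, hM⟩ := hcomp.exists_bound_of_continuousOn (hO.mono hsub)
  have hU : outer ρ κ ⊆ {x | |ρ x| ≤ κ / 2} := fun x hx => by
    change |ρ x| ≤ κ / 2
    rw [abs_of_pos hx.1]
    exact hx.2.le
  refine memLp_top_of_bound (C := M) ?_ ?_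
  · exact (hO.mono (hU.trans hsub)).aestronglyMeasurable (isOpen_outer hρ).measurableSet
  · exact (ae_restrict_iff' (isOpen_outer hρ).measurableSet).2
      (ae_of_all _ fun x hx => hM x (hU hx))

theorem inverse_apply_eq_sum (v : EuclideanSpace ℝ (Fin d)) (x : EuclideanSpace ℝ (Fin d))
    (j : Fin d) : (fderiv ℝ Φ x).inverse v j = ∑ k, v k * invEntry Φ j k x := by
  have h1 : (∑ l, v l • (EuclideanSpace.single l 1 : EuclideanSpace ℝ (Fin d))) = v := by
    simpa using (EuclideanSpace.basisFun (Fin d) ℝ).sum_repr v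
  conv_lhs => rw [← h1]
  simp [invEntry]

/-- The coefficient of the weak derivative of the pulled back field contributed by one component. -/
noncomputable def pullDeriv (ρ : EuclideanSpace ℝ (Fin d) → ℝ) (κ : ℝ)
    (Φ : EuclideanSpace ℝ (Fin d) → EuclideanSpace ℝ (Fin d)) (f : EuclideanSpace ℝ (Fin d) → ℝ)
    (g : Fin d → EuclideanSpace ℝ (Fin d) → ℝ) (p : EuclideanSpace ℝ (Fin d) → ℝ)
    (e y : EuclideanSpace ℝ (Fin d)) : ℝ :=
  f y * divCoeff ρ κ Φ p e y + ∑ l, g l y * push ρ κ Φ (coeff ρ κ Φ p e l) y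

/-- All factors of `f` and `g` are bounded: `divCoeff` consists of derivatives of Lipschitz
functions, and the pushes are continuous with compact support. -/
theorem memLp_pullDeriv (h : IsCollarReflection ρ κ Φ) (hρ : ContDiff ℝ 1 ρ)
    (hκ : 0 < κ) (hc : IsCompact {x | ρ x ≤ κ}) {q : ℝ≥0∞}
    {f : EuclideanSpace ℝ (Fin d) → ℝ} {g : Fin d → EuclideanSpace ℝ (Fin d) → ℝ}
    (hf : MemLp f q (volume.restrict D)) (hg : ∀ l, MemLp (g l) q (volume.restrict D))
    {p : EuclideanSpace ℝ (Fin d) → ℝ} (hp : ∀ x, |ρ x| < κ → LipAt p x)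
    (e : EuclideanSpace ℝ (Fin d)) :
    MemLp (pullDeriv ρ κ Φ f g p e) q (volume.restrict D) := by
  have hL := fun l => h.exists_lipschitzWith_push_coeff (e := e) hρ hκ hc hp l
  choose K hK using hL
  unfold pullDeriv
  refine MemLp.add ?_ (memLp_finsetSum _ fun l _ => ?_)
  · refine MemLp.mul (p := q) (q := ⊤) ?_ hf
    refine memLp_top_of_bound (C := ∑ l, (K l : ℝ)) ?_ (ae_of_all _ fun x => ?_)
    · exact (Finset.measurable_sum _ fun l _ =>
        measurable_fderiv_apply_const ℝ _ _).aestronglyMeasurable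
    · exact (Finset.abs_sum_le_sum_abs _ _).trans
        (Finset.sum_le_sum fun l _ => (hK l).abs_fderiv_single_le x l)
  · refine MemLp.mul (p := q) (q := ⊤) ?_ (hg l)
    obtain ⟨M, hM⟩ := (h.hasCompactSupport_push
      (hasCompactSupport_coeff (Φ := Φ) (p := p) (e := e) hρ.continuous hκ hc
        l)).exists_bound_of_continuous (hK l).continuous
    exact memLp_top_of_bound (hK l).continuous.aestronglyMeasurable M (ae_of_all _ hM)

end IsCollarReflection

/-! ### Gluing across the boundary. -/

section Glue

variable {d : ℕ}

theorem memLp_indicator_add_indicator {D U : Set (EuclideanSpace ℝ (Fin d))}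
    (hD : MeasurableSet D) (hU : MeasurableSet U) {q : ℝ≥0∞}
    {F G : EuclideanSpace ℝ (Fin d) → ℝ} (hF : MemLp F q (volume.restrict D))
    (hG : MemLp G q (volume.restrict U)) :
    MemLp (fun x => D.indicator F x + U.indicator G x) q volume :=
  ((memLp_indicator_iff_restrict hD).2 hF).add ((memLp_indicator_iff_restrict hU).2 hG)

theorem setIntegral_indicator_add_indicator_mul {D U W : Set (EuclideanSpace ℝ (Fin d))}
    (hD : MeasurableSet D) (hU : MeasurableSet U) (hDW : D ⊆ W) (hUW : U ⊆ W)
    {F G ψ : EuclideanSpace ℝ (Fin d) → ℝ} (hF : IntegrableOn (fun x => F x * ψ x) D)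
    (hG : IntegrableOn (fun x => G x * ψ x) U) :
    ∫ x in W, (D.indicator F x + U.indicator G x) * ψ x =
      (∫ x in D, F x * ψ x) + ∫ x in U, G x * ψ x := by
  have e : ∀ x, (D.indicator F x + U.indicator G x) * ψ x =
      D.indicator (fun x => F x * ψ x) x + U.indicator (fun x => G x * ψ x) x := by
    intro x
    by_cases h1 : x ∈ D <;> by_cases h2 : x ∈ U <;> simp [h1, h2, add_mul]
  simp only [e]
  rw [integral_add ((integrable_indicator_iff hD).2 hF).restrict
    ((integrable_indicator_iff hU).2 hG).restrict, setIntegral_indicator hD,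
    setIntegral_indicator hU, Set.inter_eq_self_of_subset_right hDW,
    Set.inter_eq_self_of_subset_right hUW]

end Glue

namespace IsDefiningFunction

open IsCollarReflection

variable {d : ℕ} {D : Set (EuclideanSpace ℝ (Fin d))} {ρ : EuclideanSpace ℝ (Fin d) → ℝ} {κ : ℝ}
  {ι : Type*} [Fintype ι] {c : ι → ℝ}
  {Φ : ι → EuclideanSpace ℝ (Fin d) → EuclideanSpace ℝ (Fin d)}

/-- The values outside `D` of the extension of the `j`-th component of `b` by reflections. -/
noncomputable def reflectEntry (c : ι → ℝ)
    (Φ : ι → EuclideanSpace ℝ (Fin d) → EuclideanSpace ℝ (Fin d))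
    (b : EuclideanSpace ℝ (Fin d) → EuclideanSpace ℝ (Fin d)) (j : Fin d)
    (x : EuclideanSpace ℝ (Fin d)) : ℝ :=
  -∑ s, ∑ k, c s * (|(fderiv ℝ (Φ s) x).det| * b (Φ s x) k * invEntry (Φ s) j k x)

/-- The weak partial derivatives outside `D` of the extension of the `j`-th component of `b`. -/
noncomputable def reflectDeriv (ρ : EuclideanSpace ℝ (Fin d) → ℝ) (κ : ℝ) (c : ι → ℝ)
    (Φ : ι → EuclideanSpace ℝ (Fin d) → EuclideanSpace ℝ (Fin d))
    (b : EuclideanSpace ℝ (Fin d) → EuclideanSpace ℝ (Fin d))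
    (g : Fin d → Fin d → EuclideanSpace ℝ (Fin d) → ℝ) (j i : Fin d)
    (x : EuclideanSpace ℝ (Fin d)) : ℝ :=
  -∑ s, ∑ k, c s * (|(fderiv ℝ (Φ s) x).det| * pullDeriv ρ κ (Φ s) (fun y => b y k) (g k)
    (invEntry (Φ s) j k) (EuclideanSpace.single i 1) (Φ s x))

theorem memLp_det_mul_comp (hD : IsDefiningFunction D ρ) (hκ : 0 < κ)
    (hc : IsCompact {x | ρ x ≤ κ}) {Φ : EuclideanSpace ℝ (Fin d) → EuclideanSpace ℝ (Fin d)}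
    (hΦ : IsCollarReflection ρ κ Φ) {q : ℝ≥0∞} (hq : 1 ≤ q) (hq' : q ≠ ⊤)
    {f : EuclideanSpace ℝ (Fin d) → ℝ} (hf : MemLp f q (volume.restrict D)) :
    MemLp (fun x => |(fderiv ℝ Φ x).det| * f (Φ x)) q (volume.restrict (outer ρ κ)) :=
  hΦ.memLp_comp hD.contDiff.continuous hc hκ hq hq'
    (hf.mono_measure (Measure.restrict_mono (hΦ.image_outer_subset hD) le_rfl))

theorem memLp_det_mul_comp_mul (hD : IsDefiningFunction D ρ) (hκ : 0 < κ)
    (hc : IsCompact {x | ρ x ≤ κ}) {Φ : EuclideanSpace ℝ (Fin d) → EuclideanSpace ℝ (Fin d)}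
    (hΦ : IsCollarReflection ρ κ Φ) {q : ℝ≥0∞} (hq : 1 ≤ q) (hq' : q ≠ ⊤)
    {f : EuclideanSpace ℝ (Fin d) → ℝ} (hf : MemLp f q (volume.restrict D)) (j k : Fin d) :
    MemLp (fun x => |(fderiv ℝ Φ x).det| * f (Φ x) * invEntry Φ j k x) q
      (volume.restrict (outer ρ κ)) :=
  MemLp.mul (p := q) (q := ⊤) (hΦ.memLp_top_invEntry hD.contDiff.continuous hκ hc j k)
    (hD.memLp_det_mul_comp hκ hc hΦ hq hq' hf)

theorem memLp_reflectEntry (hD : IsDefiningFunction D ρ) (hκ : 0 < κ)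
    (hc : IsCompact {x | ρ x ≤ κ}) (hΦ : ∀ s, IsCollarReflection ρ κ (Φ s)) {q : ℝ≥0∞}
    (hq : 1 ≤ q) (hq' : q ≠ ⊤) {b : EuclideanSpace ℝ (Fin d) → EuclideanSpace ℝ (Fin d)}
    (hb : ∀ k, MemLp (fun y => b y k) q (volume.restrict D)) (j : Fin d) :
    MemLp (reflectEntry c Φ b j) q (volume.restrict (outer ρ κ)) := by
  unfold reflectEntry
  exact (memLp_finsetSum _ fun s _ => memLp_finsetSum _ fun k _ =>
    (hD.memLp_det_mul_comp_mul hκ hc (hΦ s) hq hq' (hb k) j k).const_mul (c s)).neg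

theorem memLp_reflectDeriv (hD : IsDefiningFunction D ρ) (hκ : 0 < κ)
    (hc : IsCompact {x | ρ x ≤ κ}) (hΦ : ∀ s, IsCollarReflection ρ κ (Φ s)) {q : ℝ≥0∞}
    (hq : 1 ≤ q) (hq' : q ≠ ⊤) {b : EuclideanSpace ℝ (Fin d) → EuclideanSpace ℝ (Fin d)}
    (hb : ∀ k, MemLp (fun y => b y k) q (volume.restrict D))
    {g : Fin d → Fin d → EuclideanSpace ℝ (Fin d) → ℝ}
    (hg : ∀ k l, MemLp (g k l) q (volume.restrict D)) (j i : Fin d) :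
    MemLp (reflectDeriv ρ κ c Φ b g j i) q (volume.restrict (outer ρ κ)) := by
  unfold reflectDeriv
  exact (memLp_finsetSum _ fun s _ => memLp_finsetSum _ fun k _ =>
    (hD.memLp_det_mul_comp hκ hc (hΦ s) hq hq' ((hΦ s).memLp_pullDeriv hD.contDiff hκ hc (hb k)
      (hg k) (fun x hx => (hΦ s).lipAt_invEntry j k hx) _)).const_mul (c s)).neg

/-- The condition on a combination of reflections under which reflecting divergence free fields
produces no jump across the zero set of `ρ`. -/
def NoJump (ρ : EuclideanSpace ℝ (Fin d) → ℝ) (c : ι → ℝ)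
    (Φ : ι → EuclideanSpace ℝ (Fin d) → EuclideanSpace ℝ (Fin d)) : Prop :=
  ∀ y, ρ y = 0 → ∀ v w, ∑ s, (c s * fderiv ℝ ρ y (fderiv ℝ (Φ s) y v)) •
    (fderiv ℝ (Φ s) y).inverse w = fderiv ℝ ρ y v • w

theorem fderiv_apply_eq_sum (f : EuclideanSpace ℝ (Fin d) → ℝ) (y v : EuclideanSpace ℝ (Fin d)) :
    fderiv ℝ f y v = ∑ l, v l * fderiv ℝ f y (EuclideanSpace.single l 1) := by
  have h1 : (∑ l, v l • (EuclideanSpace.single l 1 : EuclideanSpace ℝ (Fin d))) = v := by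
    simpa using (EuclideanSpace.basisFun (Fin d) ℝ).sum_repr v
  conv_lhs => rw [← h1]
  simp

variable {b : EuclideanSpace ℝ (Fin d) → EuclideanSpace ℝ (Fin d)}
  {g : Fin d → Fin d → EuclideanSpace ℝ (Fin d) → ℝ} {φ : EuclideanSpace ℝ (Fin d) → ℝ}

theorem integrable_mul_test {μ : Measure (EuclideanSpace ℝ (Fin d))}
    {f ψ : EuclideanSpace ℝ (Fin d) → ℝ} (hf : Integrable f μ) (hψ : Continuous ψ)
    (hc : HasCompactSupport ψ) : Integrable (fun x => f x * ψ x) μ := by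
  obtain ⟨M, hM⟩ := hc.exists_bound_of_continuous hψ
  exact Integrable.mul_bdd hf hψ.aestronglyMeasurable (ae_of_all _ hM)

theorem continuous_fderiv_test {Ω : Set (EuclideanSpace ℝ (Fin d))} (hφ : IsTestFunction Ω φ)
    (e : EuclideanSpace ℝ (Fin d)) : Continuous fun x => fderiv ℝ φ x e :=
  (hφ.contDiff.continuous_fderiv (by simp)).clm_apply continuous_const

theorem hasCompactSupport_fderiv_test {Ω : Set (EuclideanSpace ℝ (Fin d))}
    (hφ : IsTestFunction Ω φ) (e : EuclideanSpace ℝ (Fin d)) :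
    HasCompactSupport fun x => fderiv ℝ φ x e :=
  hφ.hasCompactSupport.fderiv_apply ℝ e

/-- The weak derivative identity across the boundary, before summing over components. -/
theorem integral_component_eq [Nonempty (Fin d)] (hD : IsDefiningFunction D ρ) (hκ : 0 < κ)
    (hc : IsCompact {x | ρ x ≤ κ}) (hΦ : ∀ s, IsCollarReflection ρ κ (Φ s))
    (hJ : NoJump ρ c Φ)
    (hb : ∀ k, MemLp (fun y => b y k) 1 (volume.restrict D))
    (hg : ∀ k l, MemLp (g k l) 1 (volume.restrict D))
    (hbg : ∀ k l, HasWeakPartialDeriv D l (fun y => b y k) (g k l))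
    (hφ : IsTestFunction {x | ρ x < κ / 2} φ) (j i k : Fin d) :
    (if k = j then (∫ x in D, b x j * fderiv ℝ φ x (EuclideanSpace.single i 1)) +
        ∫ x in D, g j i x * φ x else 0) =
      ∑ s, c s * ((∫ x in outer ρ κ, |(fderiv ℝ (Φ s) x).det| * b (Φ s x) k *
          invEntry (Φ s) j k x * fderiv ℝ φ x (EuclideanSpace.single i 1)) +
        ∫ x in outer ρ κ, |(fderiv ℝ (Φ s) x).det| * pullDeriv ρ κ (Φ s) (fun y => b y k) (g k)
          (invEntry (Φ s) j k) (EuclideanSpace.single i 1) (Φ s x) * φ x) := by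
  set e : EuclideanSpace ℝ (Fin d) := EuclideanSpace.single i 1 with he
  have hρ := hD.contDiff.continuous
  have hp : ∀ s x, |ρ x| < κ → LipAt (invEntry (Φ s) j k) x :=
    fun s x hx => (hΦ s).lipAt_invEntry j k hx
  -- The fields `Y s` are the transports of φ e_i weighted by the (j,k) entry of (DΦ_s)⁻¹; they are
  -- compared with `X`, which is φ e_i if k = j and zero otherwise. Integrating `b_k` against both
  -- yields the j-th component of the Piola transform.
  set Y : ι → Fin d → EuclideanSpace ℝ (Fin d) → ℝ := fun s l =>
    push ρ κ (Φ s) fun x => coeff ρ κ (Φ s) (invEntry (Φ s) j k) e l x * φ x with hY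
  set X : Fin d → EuclideanSpace ℝ (Fin d) → ℝ := fun l x =>
    if k = j ∧ l = i then φ x else 0 with hX
  obtain ⟨Kφ, hKφ⟩ := hφ.exists_lipschitzWith
  have main := hD.integral_add_integral_eq_sum (memLp_one_iff_integrable.1 (hb k))
    (fun l => memLp_one_iff_integrable.1 (hg k l)) (hbg k) (X := X) (Y := Y)
    (fun l => by
      by_cases h : k = j ∧ l = i
      · exact ⟨Kφ, by simpa only [hX, h, and_self, if_true] using hKφ⟩
      · exact ⟨0, by simpa only [hX, h, if_false] using LipschitzWith.const 0⟩)
    (fun l => by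
      by_cases h : k = j ∧ l = i
      · simpa only [hX, h, and_self, if_true] using hφ.hasCompactSupport
      · simpa only [hX, h, if_false] using
          HasCompactSupport.intro isCompact_empty fun _ _ => rfl)
    c
    (fun s l => (hΦ s).exists_lipschitzWith_push_coeff_mul hD.contDiff hκ hc (hp s) hφ l)
    (fun s l => (hΦ s).hasCompactSupport_push_coeff_mul hρ hκ hc l)
    (fun y hy => by
      have h1 : ∀ s l, Y s l y = invEntry (Φ s) j k y * φ y * fderiv ℝ (Φ s) y e l :=
        fun s l => (hΦ s).push_coeff_mul_eq_of_eq_zero hκ l hy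
      simp only [h1, mul_assoc, ← Finset.mul_sum, ← fderiv_apply_eq_sum]
      -- The j-th coordinate of the no-jump identity with v = e_i and w = e_k is exactly the
      -- equality of normal components on the boundary.
      have h2 := congrArg (fun v : EuclideanSpace ℝ (Fin d) => v j)
        (hJ y hy e (EuclideanSpace.single k 1))
      simp only [WithLp.ofLp_sum, Finset.sum_apply, PiLp.smul_apply, smul_eq_mul] at h2
      have h3 : ∑ s, c s * (invEntry (Φ s) j k y * (φ y * fderiv ℝ ρ y (fderiv ℝ (Φ s) y e))) =
          φ y * (fderiv ℝ ρ y e * (EuclideanSpace.single k 1 : EuclideanSpace ℝ (Fin d)) j) := by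
        rw [← h2, Finset.mul_sum]
        refine Finset.sum_congr rfl fun s _ => ?_
        simp only [invEntry]
        ring
      rw [h3]
      by_cases hkj : k = j
      · simp [hX, hkj, he]
      · have : j ≠ k := fun h => hkj h.symm
        simp [hX, hkj, this])
  have hL : (∫ x in D, b x k * ∑ l, fderiv ℝ (X l) x (EuclideanSpace.single l 1)) +
        ∫ x in D, ∑ l, g k l x * X l x =
      if k = j then (∫ x in D, b x j * fderiv ℝ φ x e) + ∫ x in D, g j i x * φ x else 0 := by
    by_cases hkj : k = j
    · subst hkj
      have h1 : ∀ x, ∑ l, fderiv ℝ (X l) x (EuclideanSpace.single l 1) = fderiv ℝ φ x e := by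
        intro x
        rw [Finset.sum_eq_single i]
        · simp [hX, he]
        · intro l _ hl
          simp [hX, hl]
        · simp
      have h2 : ∀ x, ∑ l, g k l x * X l x = g k i x * φ x := by
        intro x
        rw [Finset.sum_eq_single i]
        · simp [hX]
        · intro l _ hl
          simp [hX, hl]
        · simp
      simp only [h1, h2, if_true]
    · simp [hX, hkj]
  rw [← hL, main]
  refine Finset.sum_congr rfl fun s _ => ?_
  congr 1
  simp only [hY]
  rw [(hΦ s).integral_mul_div_push hD hκ hc (hp s) hφ, (hΦ s).integral_sum_mul_push hD hκ hc hφ]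
  have i1 : IntegrableOn (fun x => |(fderiv ℝ (Φ s) x).det| * b (Φ s x) k *
      invEntry (Φ s) j k x * fderiv ℝ φ x e) (outer ρ κ) :=
    integrable_mul_test (memLp_one_iff_integrable.1
      (hD.memLp_det_mul_comp_mul hκ hc (hΦ s) le_rfl ENNReal.one_ne_top (hb k) j k))
      (continuous_fderiv_test hφ e) (hasCompactSupport_fderiv_test hφ e)
  -- Putting zero for the derivatives, or for the function, isolates one summand of `pullDeriv`, so
  -- the integrability of each follows from `memLp_pullDeriv`.
  have hz : ∀ l, MemLp ((fun _ _ => 0 : Fin d → EuclideanSpace ℝ (Fin d) → ℝ) l) 1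
      (volume.restrict D) := fun l => MemLp.zero
  have i2 : IntegrableOn (fun x => |(fderiv ℝ (Φ s) x).det| *
      (b (Φ s x) k * divCoeff ρ κ (Φ s) (invEntry (Φ s) j k) e (Φ s x)) * φ x) (outer ρ κ) := by
    have := hD.memLp_det_mul_comp hκ hc (hΦ s) le_rfl ENNReal.one_ne_top
      ((hΦ s).memLp_pullDeriv hD.contDiff hκ hc (hb k) hz (hp s) e)
    simp only [pullDeriv, zero_mul, Finset.sum_const_zero, add_zero] at this
    exact integrable_mul_test (memLp_one_iff_integrable.1 this) hφ.contDiff.continuous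
      hφ.hasCompactSupport
  have i3 : IntegrableOn (fun x => |(fderiv ℝ (Φ s) x).det| *
      (∑ l, g k l (Φ s x) * push ρ κ (Φ s) (coeff ρ κ (Φ s) (invEntry (Φ s) j k) e l) (Φ s x)) *
        φ x) (outer ρ κ) := by
    have := hD.memLp_det_mul_comp hκ hc (hΦ s) le_rfl ENNReal.one_ne_top
      ((hΦ s).memLp_pullDeriv hD.contDiff hκ hc (f := fun _ => 0) MemLp.zero (hg k) (hp s) e)
    simp only [pullDeriv, zero_mul, zero_add] at this
    exact integrable_mul_test (memLp_one_iff_integrable.1 this) hφ.contDiff.continuous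
      hφ.hasCompactSupport
  simp only [← mul_assoc]
  simp only [← mul_assoc] at i1 i2 i3
  rw [integral_add i1 i2, add_assoc, ← integral_add i2 i3]
  congr 2
  funext x
  simp only [pullDeriv]
  ring

end IsDefiningFunction

namespace IsDefiningFunction

open IsCollarReflection

variable {d : ℕ} {D : Set (EuclideanSpace ℝ (Fin d))} {ρ : EuclideanSpace ℝ (Fin d) → ℝ} {κ : ℝ}
  {ι : Type*} [Fintype ι] {c : ι → ℝ}
  {Φ : ι → EuclideanSpace ℝ (Fin d) → EuclideanSpace ℝ (Fin d)}
  {b : EuclideanSpace ℝ (Fin d) → EuclideanSpace ℝ (Fin d)}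
  {g : Fin d → Fin d → EuclideanSpace ℝ (Fin d) → ℝ} {φ : EuclideanSpace ℝ (Fin d) → ℝ}

theorem inner_gradient_eq (f : EuclideanSpace ℝ (Fin d) → ℝ) (v y : EuclideanSpace ℝ (Fin d)) :
    inner ℝ v (gradient f y) = ∑ l, v l * fderiv ℝ f y (EuclideanSpace.single l 1) := by
  rw [← fderiv_apply_eq_sum, real_inner_comm, gradient, InnerProductSpace.toDual_symm_apply]

theorem subset_sublevel (hD : IsDefiningFunction D ρ) (hκ : 0 < κ) : D ⊆ {x | ρ x < κ / 2} :=
  fun x hx => ((hD.mem_iff x).1 hx).trans (by positivity)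

theorem outer_subset_sublevel : outer ρ κ ⊆ {x | ρ x < κ / 2} := fun _ hx => hx.2

/-- The weak derivative identity for the reflected components. -/
theorem integral_reflectEntry_eq [Nonempty (Fin d)] (hD : IsDefiningFunction D ρ) (hκ : 0 < κ)
    (hc : IsCompact {x | ρ x ≤ κ}) (hΦ : ∀ s, IsCollarReflection ρ κ (Φ s))
    (hJ : NoJump ρ c Φ)
    (hb : ∀ k, MemLp (fun y => b y k) 1 (volume.restrict D))
    (hg : ∀ k l, MemLp (g k l) 1 (volume.restrict D))
    (hbg : ∀ k l, HasWeakPartialDeriv D l (fun y => b y k) (g k l))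
    (hφ : IsTestFunction {x | ρ x < κ / 2} φ) (j i : Fin d) :
    (∫ x in D, b x j * fderiv ℝ φ x (EuclideanSpace.single i 1)) +
        ∫ x in outer ρ κ, reflectEntry c Φ b j x * fderiv ℝ φ x (EuclideanSpace.single i 1) =
      -((∫ x in D, g j i x * φ x) + ∫ x in outer ρ κ, reflectDeriv ρ κ c Φ b g j i x * φ x) := by
  have h1 := fun k => hD.integral_component_eq hκ hc hΦ hJ hb hg hbg hφ j i k
  have h2 := Finset.sum_congr (s₁ := Finset.univ) rfl fun k _ => h1 k
  rw [Finset.sum_ite_eq' Finset.univ j, if_pos (Finset.mem_univ j)] at h2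
  have e1 : ∫ x in outer ρ κ, reflectEntry c Φ b j x * fderiv ℝ φ x (EuclideanSpace.single i 1) =
      -∑ s, ∑ k, c s * ∫ x in outer ρ κ, |(fderiv ℝ (Φ s) x).det| * b (Φ s x) k *
          invEntry (Φ s) j k x * fderiv ℝ φ x (EuclideanSpace.single i 1) := by
    have i1 : ∀ s k, IntegrableOn (fun x => |(fderiv ℝ (Φ s) x).det| * b (Φ s x) k *
        invEntry (Φ s) j k x * fderiv ℝ φ x (EuclideanSpace.single i 1)) (outer ρ κ) := fun s k =>
      integrable_mul_test (memLp_one_iff_integrable.1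
        (hD.memLp_det_mul_comp_mul hκ hc (hΦ s) le_rfl ENNReal.one_ne_top (hb k) j k))
        (continuous_fderiv_test hφ _) (hasCompactSupport_fderiv_test hφ _)
    simp only [← integral_const_mul]
    rw [Finset.sum_congr rfl fun s _ => (integral_finsetSum _ fun k _ =>
        (i1 s k).const_mul (c s)).symm, ← integral_finsetSum _ fun s _ =>
        integrable_finsetSum _ fun k _ => (i1 s k).const_mul (c s), ← integral_neg]
    congr 1
    funext x
    simp only [reflectEntry, neg_mul, Finset.sum_mul, mul_assoc]
  have e2 : ∫ x in outer ρ κ, reflectDeriv ρ κ c Φ b g j i x * φ x =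
      -∑ s, ∑ k, c s * ∫ x in outer ρ κ, |(fderiv ℝ (Φ s) x).det| *
        pullDeriv ρ κ (Φ s) (fun y => b y k) (g k)
          (invEntry (Φ s) j k) (EuclideanSpace.single i 1) (Φ s x) * φ x := by
    have i1 : ∀ s k, IntegrableOn (fun x => |(fderiv ℝ (Φ s) x).det| *
        pullDeriv ρ κ (Φ s) (fun y => b y k) (g k)
          (invEntry (Φ s) j k) (EuclideanSpace.single i 1) (Φ s x) * φ x) (outer ρ κ) := fun s k =>
      integrable_mul_test (memLp_one_iff_integrable.1
        (hD.memLp_det_mul_comp hκ hc (hΦ s) le_rfl ENNReal.one_ne_top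
          ((hΦ s).memLp_pullDeriv hD.contDiff hκ hc (hb k)
            (hg k) (fun x hx => (hΦ s).lipAt_invEntry j k hx) _)))
        hφ.contDiff.continuous hφ.hasCompactSupport
    simp only [← integral_const_mul]
    rw [Finset.sum_congr rfl fun s _ => (integral_finsetSum _ fun k _ =>
        (i1 s k).const_mul (c s)).symm, ← integral_finsetSum _ fun s _ =>
        integrable_finsetSum _ fun k _ => (i1 s k).const_mul (c s), ← integral_neg]
    congr 1
    funext x
    simp only [reflectDeriv, neg_mul, Finset.sum_mul, mul_assoc]
  rw [Finset.sum_comm] at h2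
  simp only [mul_add, Finset.sum_add_distrib] at h2
  rw [e1, e2]
  linarith

/-- The weak gradient of a divergence free field has trace zero. -/
theorem ae_trace_eq_zero (hD : IsDefiningFunction D ρ)
    (hg : ∀ k l, MemLp (g k l) 1 (volume.restrict D))
    (hb : ∀ k, MemLp (fun y => b y k) 1 (volume.restrict D))
    (hbg : ∀ k l, HasWeakPartialDeriv D l (fun y => b y k) (g k l))
    (hdiv : HasWeakDivergence D b fun _ => 0) :
    ∀ᵐ x ∂(volume.restrict D), ∑ k, g k k x = 0 := by
  have hint : IntegrableOn (fun x => ∑ k, g k k x) D :=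
    integrable_finsetSum _ fun k _ => memLp_one_iff_integrable.1 (hg k k)
  have := hD.isOpen.ae_eq_zero_of_integral_contDiff_smul_eq_zero (μ := volume)
    (f := fun x => ∑ k, g k k x) hint.locallyIntegrableOn (fun φ hφ hφc hφs => by
    have hφ' : IsTestFunction D φ := ⟨hφ, hφc, hφs⟩
    have h1 := hdiv.2.2 φ hφ'
    simp only [zero_mul, integral_zero, neg_zero, inner_gradient_eq] at h1
    rw [integral_finsetSum _ fun k _ => integrable_mul_test (memLp_one_iff_integrable.1 (hb k))
      (continuous_fderiv_test hφ' _) (hasCompactSupport_fderiv_test hφ' _),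
      Finset.sum_congr rfl fun k _ => (hbg k k).2.2 φ hφ', Finset.sum_neg_distrib,
      ← integral_finsetSum _ fun k _ => integrable_mul_test (memLp_one_iff_integrable.1 (hg k k))
        hφ.continuous hφc] at h1
    rw [← setIntegral_eq_integral_of_forall_compl_eq_zero (s := D) (fun x hx => by
      rw [image_eq_zero_of_notMem_tsupport fun h => hx (hφs h), zero_smul])]
    rw [← neg_eq_zero, ← h1]
    congr 2
    funext x
    rw [smul_eq_mul, mul_comm, Finset.sum_mul])
  exact (ae_restrict_iff' hD.isOpen.measurableSet).2 this

/-- The extension by reflection is divergence free across the boundary. -/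
theorem integral_reflect_gradient_eq_zero [Nonempty (Fin d)] (hD : IsDefiningFunction D ρ)
    (hκ : 0 < κ) (hc : IsCompact {x | ρ x ≤ κ}) (hΦ : ∀ s, IsCollarReflection ρ κ (Φ s))
    (hc1 : ∑ s, c s = 1)
    (hb : ∀ k, MemLp (fun y => b y k) 1 (volume.restrict D))
    (hg : ∀ k l, MemLp (g k l) 1 (volume.restrict D))
    (hbg : ∀ k l, HasWeakPartialDeriv D l (fun y => b y k) (g k l))
    (hdiv : HasWeakDivergence D b fun _ => 0)
    (hφ : IsTestFunction {x | ρ x < κ / 2} φ) :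
    ∑ j, ((∫ x in D, b x j * fderiv ℝ φ x (EuclideanSpace.single j 1)) +
        ∫ x in outer ρ κ, reflectEntry c Φ b j x * fderiv ℝ φ x (EuclideanSpace.single j 1)) =
      0 := by
  have hρ := hD.contDiff.continuous
  obtain ⟨Kφ, hKφ⟩ := hφ.exists_lipschitzWith
  have hfs : tsupport (fun x => cutoff ρ κ x * φ x) ⊆ {x | |ρ x| < κ} :=
    tsupport_mul_subset_left.trans (tsupport_cutoff_subset hρ hκ)
  have hfs' : tsupport (fun x => cutoff ρ κ x * φ x) ⊆ {x | ρ x < κ / 2} :=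
    tsupport_mul_subset_right.trans hφ.tsupport_subset
  have hfc : HasCompactSupport (fun x => cutoff ρ κ x * φ x) :=
    (hasCompactSupport_cutoff hρ hκ hc).mul_right
  -- All `η s` agree with φ on the boundary, so φ - ∑ c_s η_s vanishes there because the weights add
  -- up to one, and it may multiply every e_k as a test field. Summing over k, the zero trace of the
  -- weak gradient removes the remaining terms.
  set η : ι → EuclideanSpace ℝ (Fin d) → ℝ := fun s => push ρ κ (Φ s) fun x => cutoff ρ κ x * φ x
    with hη
  have hηc : ∀ s, HasCompactSupport (η s) := fun s => (hΦ s).hasCompactSupport_push hfc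
  have hηL : ∀ s, ∃ K : ℝ≥0, LipschitzWith K (η s) := fun s =>
    (hΦ s).exists_lipschitzWith_push hρ hfc hfs fun x _ =>
      (LipAt.of_contDiffAt (IsCollarReflection.contDiff_cutoff hD.contDiff).contDiffAt).mul
        (LipAt.of_contDiffAt (hφ.contDiff.of_le (by simp)).contDiffAt)
  choose Kη hKη using hηL
  have hη0 : ∀ s y, ρ y = 0 → η s y = φ y := fun s y hy => by
    have hy' : |ρ y| < κ := by rwa [hy, abs_zero]
    have h1 := (hΦ s).push_apply (fun x => cutoff ρ κ x * φ x) hy'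
    rw [(hΦ s).eq_self y hy, cutoff_eq_one hκ (by rw [hy, abs_zero]; linarith), one_mul] at h1
    exact h1
  have key : ∀ (ψ : EuclideanSpace ℝ (Fin d) → ℝ) (k : Fin d),
      (∫ x in D, b x k * ∑ l, fderiv ℝ (fun x => if l = k then ψ x else 0) x
          (EuclideanSpace.single l 1)) +
        ∫ x in D, ∑ l, g k l x * (if l = k then ψ x else 0) =
      (∫ x in D, b x k * fderiv ℝ ψ x (EuclideanSpace.single k 1)) +
        ∫ x in D, g k k x * ψ x := by
    intro ψ k
    congr 1
    · refine integral_congr_ae (ae_of_all _ fun x => ?_)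
      simp only
      rw [Finset.sum_eq_single k]
      · simp
      · intro l _ hl
        simp [hl]
      · simp
    · refine integral_congr_ae (ae_of_all _ fun x => ?_)
      simp
  have main : ∀ k, (∫ x in D, b x k * fderiv ℝ φ x (EuclideanSpace.single k 1)) +
        ∫ x in D, g k k x * φ x =
      ∑ s, c s * ((∫ x in D, b x k * fderiv ℝ (η s) x (EuclideanSpace.single k 1)) +
        ∫ x in D, g k k x * η s x) := by
    intro k
    have h1 := hD.integral_add_integral_eq_sum (memLp_one_iff_integrable.1 (hb k))
      (fun l => memLp_one_iff_integrable.1 (hg k l)) (hbg k)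
      (X := fun l x => if l = k then φ x else 0) (Y := fun s l x => if l = k then η s x else 0)
      (fun l => by
        by_cases h : l = k
        · exact ⟨Kφ, by simpa only [h, if_true] using hKφ⟩
        · exact ⟨0, by simpa only [h, if_false] using LipschitzWith.const 0⟩)
      (fun l => by
        by_cases h : l = k
        · simpa only [h, if_true] using hφ.hasCompactSupport
        · simpa only [h, if_false] using HasCompactSupport.intro isCompact_empty fun _ _ => rfl)
      c
      (fun s l => by
        by_cases h : l = k
        · exact ⟨Kη s, by simpa only [h, if_true] using hKη s⟩
        · exact ⟨0, by simpa only [h, if_false] using LipschitzWith.const 0⟩)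
      (fun s l => by
        by_cases h : l = k
        · simpa only [h, if_true] using hηc s
        · simpa only [h, if_false] using HasCompactSupport.intro isCompact_empty fun _ _ => rfl)
      (fun y hy => by
        simp only [hη0 _ y hy, ← Finset.sum_mul, hc1, one_mul])
    simpa only [key] using h1
  have htr := hD.ae_trace_eq_zero hg hb hbg hdiv
  have htr' : ∀ {ψ : EuclideanSpace ℝ (Fin d) → ℝ}, Continuous ψ → HasCompactSupport ψ →
      ∑ k, ∫ x in D, g k k x * ψ x = 0 := by
    intro ψ hψ hψc
    rw [← integral_finsetSum _ fun k _ =>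
      integrable_mul_test (memLp_one_iff_integrable.1 (hg k k)) hψ hψc]
    refine integral_eq_zero_of_ae ?_
    filter_upwards [htr] with x hx
    rw [← Finset.sum_mul, hx, zero_mul, Pi.zero_apply]
  have hsum := Finset.sum_congr (s₁ := Finset.univ) rfl fun k _ => main k
  rw [Finset.sum_add_distrib, htr' hφ.contDiff.continuous hφ.hasCompactSupport, add_zero,
    Finset.sum_comm] at hsum
  simp only [← Finset.mul_sum, Finset.sum_add_distrib,
    htr' (hKη _).continuous (hηc _), add_zero] at hsum
  have i1 : ∀ s k j, IntegrableOn (fun x => |(fderiv ℝ (Φ s) x).det| * b (Φ s x) k *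
      invEntry (Φ s) j k x * fderiv ℝ φ x (EuclideanSpace.single j 1)) (outer ρ κ) := fun s k j =>
    integrable_mul_test (memLp_one_iff_integrable.1
      (hD.memLp_det_mul_comp_mul hκ hc (hΦ s) le_rfl ENNReal.one_ne_top (hb k) j k))
      (continuous_fderiv_test hφ _) (hasCompactSupport_fderiv_test hφ _)
  -- Since D(φ ∘ Φ⁻¹) b at Φ(x) equals Dφ applied to (DΦ)⁻¹ b(Φ(x)), the change of variables
  -- produces the pairing of ∇φ with the Piola transform of `b`.
  have hpush : ∀ s, ∑ k, ∫ x in D, b x k * fderiv ℝ (η s) x (EuclideanSpace.single k 1) =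
      ∫ x in outer ρ κ, ∑ j, ∑ k, |(fderiv ℝ (Φ s) x).det| * b (Φ s x) k *
        invEntry (Φ s) j k x * fderiv ℝ φ x (EuclideanSpace.single j 1) := by
    intro s
    rw [← integral_finsetSum _ fun k _ =>
      Integrable.mul_bdd (c := Kη s) (memLp_one_iff_integrable.1 (hb k))
        (measurable_fderiv_apply_const ℝ _ _).aestronglyMeasurable
        (ae_of_all _ fun x => (hKη s).abs_fderiv_single_le x k)]
    have e1 : ∫ y in D, ∑ k, b y k * fderiv ℝ (η s) y (EuclideanSpace.single k 1) =
        ∫ y in D, (Φ s '' outer ρ κ).indicator (fun y => fderiv ℝ φ (inv ρ κ (Φ s) y)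
          ((fderiv ℝ (Φ s) (inv ρ κ (Φ s) y)).inverse (b y))) y := by
      refine setIntegral_congr_fun hD.isOpen.measurableSet fun y hy => ?_
      simp only [← fderiv_apply_eq_sum]
      by_cases hyU : y ∈ Φ s '' outer ρ κ
      · rw [Set.indicator_of_mem hyU]
        obtain ⟨x, hx, rfl⟩ := hyU
        have hx' := outer_abs_lt hx
        have hφΨ : HasFDerivAt (fun y => φ (inv ρ κ (Φ s) y))
            ((fderiv ℝ φ x).comp (fderiv ℝ (Φ s) x).inverse) (Φ s x) := by
          refine HasFDerivAt.comp (g := φ) (Φ s x) ?_ ((hΦ s).hasFDerivAt_inv hρ hx')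
          rw [(hΦ s).inv_apply hx']
          exact (hφ.contDiff.differentiable (by simp) x).hasFDerivAt
        have heq : η s =ᶠ[𝓝 (Φ s x)] fun y => φ (inv ρ κ (Φ s) y) := by
          have hUo : {x | 0 < ρ x ∧ ρ x < κ / 2} ∈ 𝓝 (inv ρ κ (Φ s) (Φ s x)) := by
            rw [(hΦ s).inv_apply hx']
            exact (isOpen_outer hρ).mem_nhds hx
          filter_upwards [(hΦ s).push_eventuallyEq hρ (fun x => cutoff ρ κ x * φ x) hx',
            ((hΦ s).lipAt_inv hρ hx').continuousAt hUo] with z h1 h2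
          rw [show η s z = _ from h1, cutoff_eq_one hκ (by rw [abs_of_pos h2.1]; exact h2.2.le), one_mul]
        rw [heq.fderiv_eq, hφΨ.fderiv, (hΦ s).inv_apply hx']
        rfl
      · rw [Set.indicator_of_notMem hyU,
          ((hΦ s).push_eventuallyEq_zero hD hfc hfs hfs' hy hyU).fderiv_eq]
        simp
    rw [e1, setIntegral_indicator ((hΦ s).measurableSet_image_outer hρ),
      Set.inter_eq_self_of_subset_right ((hΦ s).image_outer_subset hD),
      (hΦ s).integral_image hρ]
    refine setIntegral_congr_fun (isOpen_outer hρ).measurableSet fun x hx => ?_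
    simp only [(hΦ s).inv_apply (outer_abs_lt hx)]
    rw [fderiv_apply_eq_sum, Finset.mul_sum]
    refine Finset.sum_congr rfl fun j _ => ?_
    rw [inverse_apply_eq_sum, Finset.sum_mul, Finset.mul_sum]
    refine Finset.sum_congr rfl fun k _ => by ring
  have e2 : ∑ j, ∫ x in outer ρ κ,
      reflectEntry c Φ b j x * fderiv ℝ φ x (EuclideanSpace.single j 1) =
      -∑ s, c s * ∫ x in outer ρ κ, ∑ j, ∑ k, |(fderiv ℝ (Φ s) x).det| * b (Φ s x) k *
        invEntry (Φ s) j k x * fderiv ℝ φ x (EuclideanSpace.single j 1) := by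
    have i2 : ∀ s j, IntegrableOn (fun x => c s * ∑ k, |(fderiv ℝ (Φ s) x).det| * b (Φ s x) k *
        invEntry (Φ s) j k x * fderiv ℝ φ x (EuclideanSpace.single j 1)) (outer ρ κ) := fun s j =>
      (integrable_finsetSum _ fun k _ => i1 s k j).const_mul (c s)
    have e3 : ∀ j x, reflectEntry c Φ b j x * fderiv ℝ φ x (EuclideanSpace.single j 1) =
        -∑ s, c s * ∑ k, |(fderiv ℝ (Φ s) x).det| * b (Φ s x) k *
        invEntry (Φ s) j k x * fderiv ℝ φ x (EuclideanSpace.single j 1) := by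
      intro j x
      simp only [reflectEntry, neg_mul, Finset.sum_mul, Finset.mul_sum, mul_assoc]
    simp only [e3, integral_neg, Finset.sum_neg_distrib, neg_inj]
    rw [Finset.sum_congr rfl fun j _ => integral_finsetSum _ fun s _ => i2 s j, Finset.sum_comm]
    refine Finset.sum_congr rfl fun s _ => ?_
    rw [← integral_const_mul, ← integral_finsetSum _ fun j _ => i2 s j]
    simp only [Finset.mul_sum]
  rw [Finset.sum_add_distrib, e2, hsum]
  simp only [hpush]
  ring

/-- A divergence free field in `W^{1,q}(D)` extends, by reflection, to a divergence free field in
`W^{1,q}` of a neighbourhood of the closure of `D`. -/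
theorem exists_extension [Nonempty (Fin d)] (hD : IsDefiningFunction D ρ)
    (hκ : 0 < κ) (hc : IsCompact {x | ρ x ≤ κ}) (hΦ : ∀ s, IsCollarReflection ρ κ (Φ s))
    (hc1 : ∑ s, c s = 1) (hJ : NoJump ρ c Φ) {q : ℝ≥0∞} (hq : 1 ≤ q) (hq' : q ≠ ⊤)
    (hb : VectorMemW1 D q b) (hdiv : HasWeakDivergence D b fun _ => 0) :
    ∃ b' : EuclideanSpace ℝ (Fin d) → EuclideanSpace ℝ (Fin d),
      VectorMemW1 {x | ρ x < κ / 2} q b' ∧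
      HasWeakDivergence {x | ρ x < κ / 2} b' (fun _ => 0) ∧ ∀ x ∈ D, b' x = b x := by
  have hρ := hD.contDiff.continuous
  have hDm := hD.isOpen.measurableSet
  have hUm := (isOpen_outer (κ := κ) hρ).measurableSet
  have hDW := hD.subset_sublevel hκ
  have hUW := outer_subset_sublevel (ρ := ρ) (κ := κ)
  have : IsFiniteMeasure (volume.restrict D) :=
    ⟨by rw [Measure.restrict_apply_univ]; exact hD.isBounded.measure_lt_top⟩
  have hUb : Bornology.IsBounded (outer ρ κ) := hc.isBounded.subset fun x hx => by
    have h2 := hx.2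
    change ρ x ≤ κ
    linarith
  have : IsFiniteMeasure (volume.restrict (outer ρ κ)) :=
    ⟨by rw [Measure.restrict_apply_univ]; exact hUb.measure_lt_top⟩
  have hbL := fun k => (hb k).1
  choose g hg hbg using fun k => (hb k).2
  have hb1 : ∀ k, MemLp (fun y => b y k) 1 (volume.restrict D) := fun k => (hbL k).mono_exponent hq
  have hg1 : ∀ k l, MemLp (g k l) 1 (volume.restrict D) := fun k l => (hg k l).mono_exponent hq
  have hre := fun j => hD.memLp_reflectEntry (c := c) hκ hc hΦ hq hq' hbL j
  have hrd := fun j i => hD.memLp_reflectDeriv (c := c) hκ hc hΦ hq hq' hbL hg j i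
  -- Both indicators vanish on the zero set of `ρ`. Its measure never matters, since the identities
  -- to be proved only involve integrals over `D` and over the outer half collar.
  set F : Fin d → EuclideanSpace ℝ (Fin d) → ℝ := fun j x =>
    D.indicator (fun y => b y j) x + (outer ρ κ).indicator (reflectEntry c Φ b j) x with hF
  set G : Fin d → Fin d → EuclideanSpace ℝ (Fin d) → ℝ := fun j i x =>
    D.indicator (g j i) x + (outer ρ κ).indicator (reflectDeriv ρ κ c Φ b g j i) x with hG
  have hFL : ∀ j, MemLp (F j) q volume := fun j =>
    memLp_indicator_add_indicator hDm hUm (hbL j) (hre j)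
  have hGL : ∀ j i, MemLp (G j i) q volume := fun j i =>
    memLp_indicator_add_indicator hDm hUm (hg j i) (hrd j i)
  have hFφ : ∀ j {φ : EuclideanSpace ℝ (Fin d) → ℝ}, IsTestFunction {x | ρ x < κ / 2} φ →
      ∀ i, ∫ x in {x | ρ x < κ / 2}, F j x * fderiv ℝ φ x (EuclideanSpace.single i 1) =
        (∫ x in D, b x j * fderiv ℝ φ x (EuclideanSpace.single i 1)) +
        ∫ x in outer ρ κ, reflectEntry c Φ b j x * fderiv ℝ φ x (EuclideanSpace.single i 1) :=
    fun j φ hφ i => setIntegral_indicator_add_indicator_mul hDm hUm hDW hUW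
      (integrable_mul_test ((hbL j).integrable hq) (continuous_fderiv_test hφ _)
        (hasCompactSupport_fderiv_test hφ _))
      (integrable_mul_test ((hre j).integrable hq) (continuous_fderiv_test hφ _)
        (hasCompactSupport_fderiv_test hφ _))
  refine ⟨fun x => WithLp.toLp 2 fun j => F j x, fun j => ⟨(hFL j).restrict _, fun i =>
    ⟨G j i, (hGL j i).restrict _, ((hFL j).locallyIntegrable hq).locallyIntegrableOn _,
      ((hGL j i).locallyIntegrable hq).locallyIntegrableOn _, fun φ hφ => ?_⟩⟩,
    ⟨?_, (locallyIntegrable_const 0).locallyIntegrableOn _, fun φ hφ => ?_⟩, fun x hx => ?_⟩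
  · rw [hFφ j hφ i, hD.integral_reflectEntry_eq hκ hc hΦ hJ hb1 hg1 hbg hφ j i,
      setIntegral_indicator_add_indicator_mul hDm hUm hDW hUW
      (integrable_mul_test ((hg j i).integrable hq) hφ.contDiff.continuous hφ.hasCompactSupport)
      (integrable_mul_test ((hrd j i).integrable hq) hφ.contDiff.continuous hφ.hasCompactSupport)]
  · refine LocallyIntegrable.locallyIntegrableOn ?_ _
    refine MemLp.locallyIntegrable (p := q) ?_ hq
    exact MemLp.of_eval_piLp fun j => hFL j
  · simp only [inner_gradient_eq, zero_mul, integral_zero, neg_zero]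
    rw [integral_finsetSum _ fun j _ => (integrable_mul_test
      (memLp_one_iff_integrable.1 (memLp_indicator_add_indicator hDm hUm
        ((hbL j).mono_exponent hq) ((hre j).mono_exponent hq))).restrict (continuous_fderiv_test hφ _)
        (hasCompactSupport_fderiv_test hφ _))]
    rw [Finset.sum_congr rfl fun j _ => hFφ j hφ j]
    exact hD.integral_reflect_gradient_eq_zero hκ hc hΦ hc1 hb1 hg1 hbg hdiv hφ
  · ext j
    have hx' : x ∉ outer ρ κ := fun h => by linarith [h.1, (hD.mem_iff x).1 hx]
    simp [hF, hx, hx']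

end IsDefiningFunction

/-! ### C^{1,1} regularity from first-order expansions with quadratic error. -/

theorem hasFDerivAt_of_quadratic_bound {F : Type*} [NormedAddCommGroup F] [NormedSpace ℝ F]
    {f : F → ℝ} {x : F} {p : F →L[ℝ] ℝ} {C : ℝ}
    (h : ∀ v, |f (x + v) - f x - p v| ≤ C * ‖v‖ ^ 2) : HasFDerivAt f p x := by
  rw [hasFDerivAt_iff_isLittleO_nhds_zero]
  refine Asymptotics.IsBigO.trans_isLittleO (g := fun v : F => ‖v‖ ^ 2) ?_
    (Asymptotics.isLittleO_norm_pow_id one_lt_two)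
  refine Asymptotics.IsBigO.of_bound C (Eventually.of_forall fun v => ?_)
  simpa using h v

/-- With δ = ‖y - x‖ and a unit vector u, compare the expansions at x with increments y - x + δu and
y - x and the expansion at y with increment δu. The errors add up to C(4 + 1 + 1)δ², and dividing by
δ gives the constant 6C. -/
theorem lipschitzWith_of_quadratic_bound {F : Type*} [NormedAddCommGroup F] [NormedSpace ℝ F]
    {f : F → ℝ} {p : F → F →L[ℝ] ℝ} {C : ℝ} (hC : 0 ≤ C)
    (h : ∀ x v, |f (x + v) - f x - p x v| ≤ C * ‖v‖ ^ 2) :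
    LipschitzWith (6 * C).toNNReal p := by
  refine LipschitzWith.of_dist_le_mul fun x y => ?_
  rw [Real.coe_toNNReal _ (by positivity), dist_eq_norm]
  rcases eq_or_ne x y with rfl | hxy
  · simp
  have hpos : 0 < dist x y := dist_pos.2 hxy
  refine ContinuousLinearMap.opNorm_le_of_unit_norm (by positivity) fun u hu => ?_
  set δ := dist x y with hδ
  have hyx : ‖y - x‖ = δ := by rw [hδ, dist_comm, dist_eq_norm]
  have h1 := h x (y - x + δ • u)
  have h2 := h y (δ • u)
  have h3 := h x (y - x)
  have n2 : ‖δ • u‖ = δ := by rw [norm_smul, hu, mul_one, Real.norm_of_nonneg hpos.le]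
  have n1 : ‖y - x + δ • u‖ ≤ 2 * δ := (norm_add_le _ _).trans (by rw [hyx, n2]; linarith)
  have n1' : ‖y - x + δ • u‖ ^ 2 ≤ (2 * δ) ^ 2 := by gcongr
  rw [← add_assoc, add_sub_cancel, map_add] at h1
  rw [add_sub_cancel] at h3
  rw [n2] at h2
  rw [hyx] at h3
  have h4 : |p x (δ • u) - p y (δ • u)| ≤ 6 * C * δ * δ := by
    have h1' := h1.trans (mul_le_mul_of_nonneg_left n1' hC)
    rw [abs_le] at h1' h2 h3 ⊢
    constructor <;> nlinarith [h1'.1, h1'.2, h2.1, h2.2, h3.1, h3.2]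
  rw [map_smul, map_smul, ← smul_sub, smul_eq_mul, abs_mul, abs_of_pos hpos, mul_comm] at h4
  exact le_of_mul_le_mul_right h4 hpos

/-! ### Expansion of the signed distance near a boundary with tangent balls. -/

section SignedDistance

section Metric

variable {V : Type*} [PseudoMetricSpace V]

/-- The signed distance to the boundary of `S`, negative inside `S`. -/
noncomputable def signedInfDist (S : Set V) (x : V) : ℝ := infDist x S - infDist x Sᶜ

theorem signedInfDist_compl (S : Set V) (x : V) : signedInfDist Sᶜ x = -signedInfDist S x := by
  rw [signedInfDist, signedInfDist, compl_compl, neg_sub]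

theorem abs_signedInfDist_sub_le (S : Set V) (x y : V) :
    |signedInfDist S x - signedInfDist S y| ≤ 2 * dist x y := by
  have h1 := (lipschitz_infDist_pt S).dist_le_mul x y
  have h2 := (lipschitz_infDist_pt Sᶜ).dist_le_mul x y
  rw [Real.dist_eq, NNReal.coe_one, one_mul] at h1 h2
  rw [abs_le] at h1 h2 ⊢
  simp only [signedInfDist]
  constructor <;> linarith [h1.1, h1.2, h2.1, h2.2]

/-- At every boundary point there are interior and exterior tangent balls of radius `r`. -/
def HasTangentBalls (S : Set V) (r : ℝ) : Prop :=
  ∀ Q ∈ frontier S, (∃ c, ball c r ⊆ S ∧ dist Q c = r) ∧ ∃ c, ball c r ⊆ Sᶜ ∧ dist Q c = r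

theorem HasTangentBalls.compl {S : Set V} {r : ℝ} (h : HasTangentBalls S r) :
    HasTangentBalls Sᶜ r := by
  intro Q hQ
  rw [frontier_compl] at hQ
  rw [compl_compl]
  exact (h Q hQ).symm

end Metric

variable {V : Type*} [NormedAddCommGroup V] [InnerProductSpace ℝ V]

/-- Inside the ball, the complement of `S` is at least as far as the sphere; outside, the radial
projection onto the sphere is a competitor. Applied to the complement as well, this traps the signed
distance between two explicit functions. -/
theorem signedInfDist_le_of_ball_subset {S : Set V} {c : V} {r : ℝ} (hr : 0 < r) (hS : ball c r ⊆ S)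
    (hne : Sᶜ.Nonempty) (y : V) : signedInfDist S y ≤ dist y c - r := by
  rcases lt_or_ge (dist y c) r with hy | hy
  · have h1 : infDist y S = 0 := infDist_zero_of_mem (hS hy)
    have h2 : r - dist y c ≤ infDist y Sᶜ := by
      refine (le_infDist hne).2 fun z hz => ?_
      have h3 : r ≤ dist z c := not_lt.1 fun h => hz (hS h)
      linarith [dist_triangle_left z c y]
    rw [signedInfDist, h1]
    linarith
  · have h1 : infDist y S ≤ dist y c - r := by
      refine (infDist_le_infDist_of_subset hS ⟨c, mem_ball_self hr⟩).trans ?_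
      rw [← infDist_closure, closure_ball c hr.ne']
      have hpos : 0 < dist y c := hr.trans_le hy
      have hw : c + (r / dist y c) • (y - c) ∈ closedBall c r := by
        rw [mem_closedBall, dist_eq_norm, add_sub_cancel_left, norm_smul, ← dist_eq_norm,
          Real.norm_of_nonneg (by positivity), div_mul_cancel₀ _ hpos.ne']
      refine (infDist_le_dist_of_mem hw).trans (le_of_eq ?_)
      rw [dist_eq_norm]
      have e : y - (c + (r / dist y c) • (y - c)) = (1 - r / dist y c) • (y - c) := by
        rw [sub_smul, one_smul]
        abel
      have h0 : 0 ≤ 1 - r / dist y c := by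
        rw [sub_nonneg, div_le_one hpos]
        exact hy
      rw [e, norm_smul, Real.norm_of_nonneg h0, ← dist_eq_norm, sub_mul,
        div_mul_cancel₀ _ hpos.ne', one_mul]
    rw [signedInfDist]
    linarith [infDist_nonneg (x := y) (s := Sᶜ)]

/-- The square of the right side exceeds that of the left by the square of ⟨n,h⟩ + ‖h‖²/(2a), and
the right side is nonnegative because |⟨n,h⟩| ≤ ‖h‖. -/
theorem norm_smul_add_le {n h : V} (hn : ‖n‖ = 1) {a : ℝ} (ha : 0 < a) :
    ‖a • n + h‖ ≤ a + inner ℝ n h + ‖h‖ ^ 2 / (2 * a) := by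
  have h1 : |inner ℝ n h| ≤ ‖h‖ := by simpa [hn] using abs_real_inner_le_norm n h
  have h2 : 0 ≤ a + inner ℝ n h + ‖h‖ ^ 2 / (2 * a) := by
    have h3 : a - ‖h‖ + ‖h‖ ^ 2 / (2 * a) = ((a - ‖h‖) ^ 2 + a ^ 2) / (2 * a) := by
      field_simp
      ring
    have h4 : 0 ≤ ((a - ‖h‖) ^ 2 + a ^ 2) / (2 * a) := by positivity
    linarith [(abs_le.1 h1).1]
  refine abs_le_of_sq_le_sq' ?_ h2 |>.2
  rw [norm_add_sq_real, norm_smul, hn, mul_one, Real.norm_of_nonneg ha.le, real_inner_smul_left]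
  have h3 : (a + inner ℝ n h + ‖h‖ ^ 2 / (2 * a)) ^ 2 =
      a ^ 2 + 2 * (a * inner ℝ n h) + ‖h‖ ^ 2 + (inner ℝ n h + ‖h‖ ^ 2 / (2 * a)) ^ 2 := by
    field_simp
    ring
  rw [h3]
  linarith [sq_nonneg (inner ℝ n h + ‖h‖ ^ 2 / (2 * a))]

/-- The balls at the nearest boundary point Q bound the signed distance at y above by |y - c| - r
and below by r - |y - c'|. Both bounds take the same value and have the same gradient n at x, the
direction from Q to c'. Depth t ≤ r/2 keeps the radius r - t at least r/2, whence the constant 1/r.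
-/
theorem HasTangentBalls.exists_normal_of_mem [FiniteDimensional ℝ V] {S : Set V} {r : ℝ}
    (h : HasTangentBalls S r)
    (hr : 0 < r) (hne : S.Nonempty) (hne' : Sᶜ.Nonempty) {x : V} (hx : x ∈ S)
    (hxr : infDist x Sᶜ ≤ r / 2) :
    ∃ n : V, ‖n‖ = 1 ∧
      ∀ v, |signedInfDist S (x + v) - signedInfDist S x - inner ℝ n v| ≤ ‖v‖ ^ 2 / r := by
  have hS : S ≠ Set.univ := fun hS => by simp [hS] at hne'
  obtain ⟨Q, hQ, hxQ⟩ := exists_mem_frontier_infDist_compl_eq_dist hx hS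
  obtain ⟨⟨c, hc, hQc⟩, c', hc', hQc'⟩ := h Q hQ
  set t := infDist x Sᶜ with ht
  have ht0 : 0 ≤ t := infDist_nonneg
  have hsx : signedInfDist S x = -t := by rw [signedInfDist, infDist_zero_of_mem hx, zero_sub]
  have hlow : ∀ y, r - dist y c' ≤ signedInfDist S y := by
    intro y
    have := signedInfDist_le_of_ball_subset hr hc' (by rwa [compl_compl]) y
    rw [signedInfDist_compl] at this
    linarith
  have hup := signedInfDist_le_of_ball_subset hr hc hne'
  set n : V := r⁻¹ • (c' - Q) with hn
  have hcn : c' - Q = r • n := by rw [hn, smul_smul, mul_inv_cancel₀ hr.ne', one_smul]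
  have hn1 : ‖n‖ = 1 := by
    rw [hn, norm_smul, ← dist_eq_norm, dist_comm, hQc', norm_inv, Real.norm_of_nonneg hr.le,
      inv_mul_cancel₀ hr.ne']
  -- x is at distance t from Q and at least t + r from c', while Q is at distance r from c':
  -- equality in the triangle inequality puts the three points on a line.
  have hxQ' : x - Q = -(t • n) := by
    have h1 : t + r ≤ dist x c' := by linarith [hlow x]
    have h2 : (t + r) ^ 2 ≤ ‖x - c'‖ ^ 2 := by
      rw [← dist_eq_norm]
      gcongr
    have h3 : x - c' = (x - Q) - r • n := by rw [← hcn]; abel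
    have h4 : ‖x - Q‖ = t := by rw [← dist_eq_norm, ← hxQ]
    rw [h3, norm_sub_sq_real, h4, norm_smul, hn1, real_inner_smul_right,
      Real.norm_of_nonneg hr.le] at h2
    have h5 : inner ℝ (x - Q) n ≤ -t := by nlinarith
    have h6 : ‖(x - Q) + t • n‖ ^ 2 ≤ 0 := by
      rw [norm_add_sq_real, h4, norm_smul, hn1, real_inner_smul_right, Real.norm_of_nonneg ht0]
      nlinarith
    have h7 : (x - Q) + t • n = 0 := by
      rw [← norm_eq_zero]
      exact pow_eq_zero_iff two_ne_zero |>.1 (le_antisymm h6 (sq_nonneg _))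
    exact eq_neg_of_add_eq_zero_left h7
  -- The two balls are disjoint, so their centres are at least 2r apart (otherwise the midpoint lies
  -- in both), and the same equality case aligns them with Q.
  have hcQ' : c - Q = -(r • n) := by
    have h1 : 2 * r ≤ dist c c' := by
      by_contra hlt
      push Not at hlt
      have hm1 : midpoint ℝ c c' ∈ ball c r := by
        rw [mem_ball, dist_midpoint_left, Real.norm_of_nonneg (by norm_num)]
        linarith
      have hm2 : midpoint ℝ c c' ∈ ball c' r := by
        rw [mem_ball, dist_midpoint_right, Real.norm_of_nonneg (by norm_num)]
        linarith
      exact hc' hm2 (hc hm1)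
    have h2 : (2 * r) ^ 2 ≤ ‖c - c'‖ ^ 2 := by
      rw [← dist_eq_norm]
      gcongr
    have h3 : c - c' = (c - Q) - r • n := by rw [← hcn]; abel
    have h4 : ‖c - Q‖ = r := by rw [← dist_eq_norm, dist_comm, hQc]
    rw [h3, norm_sub_sq_real, h4, norm_smul, hn1, real_inner_smul_right,
      Real.norm_of_nonneg hr.le] at h2
    have h5 : inner ℝ (c - Q) n ≤ -r := by nlinarith
    have h6 : ‖(c - Q) + r • n‖ ^ 2 ≤ 0 := by
      rw [norm_add_sq_real, h4, norm_smul, hn1, real_inner_smul_right, Real.norm_of_nonneg hr.le]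
      nlinarith
    have h7 : (c - Q) + r • n = 0 := by
      rw [← norm_eq_zero]
      exact pow_eq_zero_iff two_ne_zero |>.1 (le_antisymm h6 (sq_nonneg _))
    exact eq_neg_of_add_eq_zero_left h7
  refine ⟨n, hn1, fun v => ?_⟩
  have hxc : ∀ v, x + v - c = (r - t) • n + v := by
    intro v
    have : x + v - c = (x - Q) - (c - Q) + v := by abel
    rw [this, hxQ', hcQ', sub_smul]
    abel
  have hxc' : ∀ v, x + v - c' = -((r + t) • n + -v) := by
    intro v
    have : x + v - c' = (x - Q) - (c' - Q) + v := by abel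
    rw [this, hxQ', hcn, add_smul]
    abel
  have u1 := hup (x + v)
  rw [dist_eq_norm, hxc] at u1
  have u2 := norm_smul_add_le (h := v) hn1 (a := r - t) (by linarith)
  have u3 : ‖v‖ ^ 2 / (2 * (r - t)) ≤ ‖v‖ ^ 2 / r := by
    gcongr
    linarith
  have l1 := hlow (x + v)
  rw [dist_eq_norm, hxc', norm_neg] at l1
  have l2 := norm_smul_add_le (h := -v) hn1 (a := r + t) (by linarith)
  rw [norm_neg, inner_neg_right] at l2
  have l3 : ‖v‖ ^ 2 / (2 * (r + t)) ≤ ‖v‖ ^ 2 / r := by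
    gcongr
    linarith
  rw [hsx, abs_le]
  constructor <;> linarith

theorem HasTangentBalls.exists_normal [FiniteDimensional ℝ V] {S : Set V} {r : ℝ}
    (h : HasTangentBalls S r)
    (hr : 0 < r) (hne : S.Nonempty) (hne' : Sᶜ.Nonempty) {x : V}
    (hxr : |signedInfDist S x| ≤ r / 2) :
    ∃ n : V, ‖n‖ = 1 ∧
      ∀ v, |signedInfDist S (x + v) - signedInfDist S x - inner ℝ n v| ≤ ‖v‖ ^ 2 / r := by
  by_cases hx : x ∈ S
  · refine h.exists_normal_of_mem hr hne hne' hx ?_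
    rwa [signedInfDist, infDist_zero_of_mem hx, zero_sub, abs_neg, abs_of_nonneg infDist_nonneg] at hxr
  · obtain ⟨n, hn, hv⟩ := h.compl.exists_normal_of_mem hr hne' (by rwa [compl_compl])
      (x := x) hx (by
        rw [compl_compl]
        rwa [signedInfDist, infDist_zero_of_mem (s := Sᶜ) hx, sub_zero,
          abs_of_nonneg infDist_nonneg] at hxr)
    refine ⟨-n, by rwa [norm_neg], fun v => ?_⟩
    have := hv v
    rw [signedInfDist_compl, signedInfDist_compl, ← abs_neg] at this
    rw [inner_neg_left]
    convert this using 2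
    ring

end SignedDistance

/-! ### Truncating the signed distance. -/

section Tent

/-- The tent function of width `τ`. -/
noncomputable def tent (τ u : ℝ) : ℝ := max 0 (1 - |u| / τ)

/-- The primitive of the tent function. -/
noncomputable def tentPrimitive (τ t : ℝ) : ℝ := ∫ u in (0 : ℝ)..t, tent τ u

variable {τ : ℝ}

theorem continuous_tent : Continuous (tent τ) := by
  unfold tent
  fun_prop

theorem tent_nonneg (u : ℝ) : 0 ≤ tent τ u := le_max_left _ _

theorem tent_le_one (hτ : 0 < τ) (u : ℝ) : tent τ u ≤ 1 :=
  max_le zero_le_one (by linarith [div_nonneg (abs_nonneg u) hτ.le])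

theorem tent_eq_zero (hτ : 0 < τ) {u : ℝ} (hu : τ ≤ |u|) : tent τ u = 0 := by
  refine max_eq_left ?_
  rw [sub_nonpos, le_div_iff₀ hτ, one_mul]
  exact hu

theorem abs_tent_sub_le (hτ : 0 < τ) (u v : ℝ) : |tent τ u - tent τ v| ≤ |u - v| / τ := by
  have h1 := abs_max_sub_max_le_max (0 : ℝ) (1 - |u| / τ) 0 (1 - |v| / τ)
  refine h1.trans (max_le (by rw [sub_self, abs_zero]; positivity) ?_)
  have e : 1 - |u| / τ - (1 - |v| / τ) = (|v| - |u|) / τ := by ring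
  rw [e, abs_div, abs_of_pos hτ, abs_sub_comm u v]
  exact div_le_div_of_nonneg_right (abs_abs_sub_abs_le v u) hτ.le

/-- The derivative of the primitive is the tent, which is Lipschitz with constant 1/τ. -/
theorem abs_tentPrimitive_sub_le (hτ : 0 < τ) (s t : ℝ) :
    |tentPrimitive τ t - tentPrimitive τ s - tent τ s * (t - s)| ≤ (t - s) ^ 2 / τ := by
  have hi : ∀ a b, IntervalIntegrable (tent τ) volume a b := fun a b =>
    continuous_tent.intervalIntegrable a b
  have e1 : tentPrimitive τ t - tentPrimitive τ s - tent τ s * (t - s) =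
      ∫ u in s..t, (tent τ u - tent τ s) := by
    rw [intervalIntegral.integral_sub (hi _ _) (by simp), intervalIntegral.integral_const,
      tentPrimitive, tentPrimitive, intervalIntegral.integral_interval_sub_left (hi _ _) (hi _ _),
      smul_eq_mul, mul_comm]
  rw [e1, ← Real.norm_eq_abs]
  refine (intervalIntegral.norm_integral_le_of_norm_le_const (C := |t - s| / τ)
    fun u hu => ?_).trans (le_of_eq ?_)
  · refine (abs_tent_sub_le hτ u s).trans ?_
    gcongr ?_ / τ
    exact Set.abs_sub_left_of_mem_uIcc (Set.uIoc_subset_uIcc hu)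
  · rw [div_mul_eq_mul_div, abs_mul_abs_self, sq]

theorem tentPrimitive_zero : tentPrimitive τ 0 = 0 := by simp [tentPrimitive]

theorem tent_zero : tent τ 0 = 1 := by simp [tent]

theorem tentPrimitive_mono : Monotone (tentPrimitive τ) := by
  intro a b hab
  have hi : ∀ a b, IntervalIntegrable (tent τ) volume a b := fun a b =>
    continuous_tent.intervalIntegrable a b
  have : tentPrimitive τ b - tentPrimitive τ a = ∫ u in a..b, tent τ u := by
    rw [tentPrimitive, tentPrimitive, intervalIntegral.integral_interval_sub_left (hi _ _) (hi _ _)]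
  have h2 := intervalIntegral.integral_nonneg (μ := volume) hab fun u _ => tent_nonneg (τ := τ) u
  linarith

theorem half_le_tentPrimitive (hτ : 0 < τ) {t : ℝ} (ht : 0 ≤ t) (ht' : t ≤ τ / 2) :
    t / 2 ≤ tentPrimitive τ t := by
  have h := abs_tentPrimitive_sub_le hτ 0 t
  rw [tentPrimitive_zero, tent_zero, sub_zero, sub_zero, one_mul, abs_le] at h
  have h2 : t ^ 2 / τ ≤ t / 2 := by
    rw [div_le_iff₀ hτ]
    nlinarith
  linarith [h.1]

theorem tentPrimitive_le_half (hτ : 0 < τ) {t : ℝ} (ht : t ≤ 0) (ht' : -(τ / 2) ≤ t) :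
    tentPrimitive τ t ≤ t / 2 := by
  have h := abs_tentPrimitive_sub_le hτ 0 t
  rw [tentPrimitive_zero, tent_zero, sub_zero, sub_zero, one_mul, abs_le] at h
  have h2 : t ^ 2 / τ ≤ -t / 2 := by
    rw [div_le_iff₀ hτ]
    nlinarith
  linarith [h.2]

theorem min_le_abs_tentPrimitive (hτ : 0 < τ) (t : ℝ) :
    min |t| (τ / 2) / 2 ≤ |tentPrimitive τ t| := by
  rcases le_total 0 t with ht | ht
  · rw [abs_of_nonneg ht]
    have h1 : 0 ≤ min t (τ / 2) := le_min ht (by positivity)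
    exact ((half_le_tentPrimitive hτ h1 (min_le_right _ _)).trans
      (tentPrimitive_mono (min_le_left _ _))).trans (le_abs_self _)
  · rw [abs_of_nonpos ht]
    have h1 : 0 ≤ min (-t) (τ / 2) := le_min (by linarith) (by positivity)
    have h2 := tentPrimitive_le_half hτ (t := -min (-t) (τ / 2)) (by linarith)
      (by linarith [min_le_right (-t) (τ / 2)])
    have h3 : tentPrimitive τ t ≤ tentPrimitive τ (-min (-t) (τ / 2)) :=
      tentPrimitive_mono (by linarith [min_le_left (-t) (τ / 2)])
    linarith [neg_le_abs (tentPrimitive τ t)]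

theorem tentPrimitive_neg_iff (hτ : 0 < τ) (t : ℝ) : tentPrimitive τ t < 0 ↔ t < 0 := by
  constructor
  · intro h
    by_contra ht
    have := tentPrimitive_mono (τ := τ) (not_lt.1 ht)
    rw [tentPrimitive_zero] at this
    linarith
  · intro h
    have h1 := min_le_abs_tentPrimitive hτ t
    have h2 := tentPrimitive_mono (τ := τ) h.le
    rw [tentPrimitive_zero] at h2
    have h3 : 0 < min |t| (τ / 2) / 2 := by
      have := abs_pos.2 h.ne
      positivity
    exact lt_of_le_of_ne h2 fun h0 => by
      rw [h0, abs_zero] at h1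
      linarith

end Tent

/-- Composing the signed distance σ with the primitive of the tent keeps its sign and its zero set,
and gives the derivative tent(σ) n. This vanishes for |σ| ≥ r/2, where σ need not be differentiable,
so a quadratic expansion holds at every point and C^{1,1} regularity follows. -/
theorem IsC11Domain.exists_definingFunction {d : ℕ} [Nonempty (Fin d)]
    {D : Set (EuclideanSpace ℝ (Fin d))} (hD : IsC11Domain D) :
    ∃ ρ, IsDefiningFunction D ρ := by
  obtain ⟨r, hr, hballs⟩ := hD.tangent_balls
  have hT : HasTangentBalls D r := hballs
  have hne' : Dᶜ.Nonempty := by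
    rw [Set.nonempty_compl]
    rintro rfl
    exact NormedSpace.unbounded_univ ℝ (EuclideanSpace ℝ (Fin d)) hD.isBounded
  set τ := r / 2 with hτ
  have hτ0 : 0 < τ := by positivity
  set σ := signedInfDist D with hσ
  have hσmem : ∀ x, x ∈ D ↔ σ x < 0 := by
    intro x
    constructor
    · intro hx
      have h1 : 0 < infDist x Dᶜ := by
        rw [← hD.isOpen.isClosed_compl.notMem_iff_infDist_pos hne']
        exact fun h => h hx
      rw [hσ, signedInfDist, infDist_zero_of_mem hx]
      linarith
    · intro hx
      by_contra hxD
      rw [hσ, signedInfDist, infDist_zero_of_mem (s := Dᶜ) hxD] at hx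
      linarith [infDist_nonneg (x := x) (s := D)]
  -- Outside the layer the normal is given the dummy value zero; the tent factor vanishes there.
  have hn : ∀ x, ∃ n : EuclideanSpace ℝ (Fin d), |σ x| ≤ τ → ‖n‖ = 1 ∧
      ∀ v, |σ (x + v) - σ x - inner ℝ n v| ≤ ‖v‖ ^ 2 / r := by
    intro x
    by_cases hx : |σ x| ≤ τ
    · obtain ⟨n, h1, h2⟩ := hT.exists_normal hr hD.nonempty hne' hx
      exact ⟨n, fun _ => ⟨h1, h2⟩⟩
    · exact ⟨0, fun h => absurd h hx⟩
  choose n hn using hn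
  set ρ : EuclideanSpace ℝ (Fin d) → ℝ := fun x => tentPrimitive τ (σ x) with hρ
  set p : EuclideanSpace ℝ (Fin d) → EuclideanSpace ℝ (Fin d) →L[ℝ] ℝ :=
    fun x => tent τ (σ x) • innerSL ℝ (n x) with hp
  -- The first term is the error of the primitive, with |σ(x + v) - σ(x)| ≤ 2‖v‖; the second is the
  -- error in the expansion of σ.
  set C := 4 / τ + 1 / r with hC
  have hC0 : 0 < C := by positivity
  have hexp : ∀ x v, |ρ (x + v) - ρ x - p x v| ≤ C * ‖v‖ ^ 2 := by
    intro x v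
    have h1 := abs_tentPrimitive_sub_le hτ0 (σ x) (σ (x + v))
    have h2 : (σ (x + v) - σ x) ^ 2 / τ ≤ 4 / τ * ‖v‖ ^ 2 := by
      have h3 := abs_signedInfDist_sub_le D (x + v) x
      rw [dist_eq_norm, add_sub_cancel_left] at h3
      have h4 : (σ (x + v) - σ x) ^ 2 ≤ (2 * ‖v‖) ^ 2 := sq_le_sq.2 (by
        rw [abs_of_nonneg (by positivity : 0 ≤ 2 * ‖v‖)]
        exact h3)
      rw [div_mul_eq_mul_div]
      gcongr
      linarith
    have h5 : |tent τ (σ x) * (σ (x + v) - σ x) - p x v| ≤ 1 / r * ‖v‖ ^ 2 := by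
      have e : tent τ (σ x) * (σ (x + v) - σ x) - p x v =
          tent τ (σ x) * (σ (x + v) - σ x - inner ℝ (n x) v) := by
        simp only [hp, smul_apply, innerSL_apply_apply, smul_eq_mul]
        ring
      rw [e, abs_mul, abs_of_nonneg (tent_nonneg _)]
      by_cases hx : |σ x| ≤ τ
      · calc _ ≤ 1 * (‖v‖ ^ 2 / r) :=
              mul_le_mul (tent_le_one hτ0 _) ((hn x hx).2 v) (abs_nonneg _) zero_le_one
          _ = _ := by ring
      · rw [tent_eq_zero hτ0 (not_le.1 hx).le, zero_mul]
        positivity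
    have h6 : ρ (x + v) - ρ x - p x v =
        (tentPrimitive τ (σ (x + v)) - tentPrimitive τ (σ x) -
          tent τ (σ x) * (σ (x + v) - σ x)) +
        (tent τ (σ x) * (σ (x + v) - σ x) - p x v) := by
      simp only [hρ]
      ring
    rw [h6, hC, add_mul]
    exact (abs_add_le _ _).trans (add_le_add (h1.trans h2) h5)
  have hfd : ∀ x, HasFDerivAt ρ (p x) x := fun x => hasFDerivAt_of_quadratic_bound (hexp x)
  have hfd' : fderiv ℝ ρ = p := funext fun x => (hfd x).fderiv
  have hpL := lipschitzWith_of_quadratic_bound hC0.le hexp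
  have hρc : Continuous ρ := continuous_iff_continuousAt.2 fun x => (hfd x).continuousAt
  -- Where |σ| > τ/4 the primitive is at least τ/8 in modulus. Conversely |σ| ≤ τ/4 gives tent(σ) ≥
  -- 3/4, the lower bound required of the gradient in the collar.
  have hsmall : ∀ x, |ρ x| ≤ τ / 16 → |σ x| ≤ τ / 4 := by
    intro x hx
    have h1 := (min_le_abs_tentPrimitive hτ0 (σ x)).trans hx
    by_contra h2
    push Not at h2
    have h3 : τ / 4 ≤ min |σ x| (τ / 2) := le_min h2.le (by linarith)
    linarith
  refine ⟨ρ, ?_, ?_, ?_, ?_, ?_, ?_, τ / 16, by positivity, ?_, ?_⟩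
  · rw [contDiff_one_iff_fderiv]
    exact ⟨fun x => (hfd x).differentiableAt, by rw [hfd']; exact hpL.continuous⟩
  · rw [hfd']
    exact ⟨_, hpL⟩
  · rw [hfd']
    exact ⟨C, hC0, hexp⟩
  · intro x
    rw [hfd']
    simp only [hp]
    rw [norm_smul, innerSL_apply_norm, Real.norm_of_nonneg (tent_nonneg _)]
    by_cases hx : |σ x| ≤ τ
    · rw [(hn x hx).1, mul_one]
      exact tent_le_one hτ0 _
    · rw [tent_eq_zero hτ0 (not_le.1 hx).le, zero_mul]
      exact zero_le_one
  · intro x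
    rw [hσmem]
    exact (tentPrimitive_neg_iff hτ0 _).symm
  · obtain ⟨z, hz⟩ := hne'
    obtain ⟨M, hM⟩ := hD.isBounded.subset_closedBall z
    -- Up to depth τ/2 one has |σ| ≤ 2|ρ|; deeper, |ρ| ≥ τ/4, and the bound M on the depth gives the
    -- second term.
    refine ⟨2 + 4 * M / τ, fun x hx => ?_⟩
    have h1 : infDist x Dᶜ = |σ x| := by
      rw [hσ, signedInfDist, infDist_zero_of_mem hx, zero_sub, abs_neg,
        abs_of_nonneg infDist_nonneg]
    have h2 : infDist x Dᶜ ≤ M := (infDist_le_dist_of_mem hz).trans (hM hx)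
    have hM0 : 0 ≤ M := infDist_nonneg.trans h2
    have h3 : min |σ x| (τ / 2) / 2 ≤ |ρ x| := min_le_abs_tentPrimitive hτ0 (σ x)
    have h5 : 0 ≤ 4 * M / τ := by positivity
    rw [h1] at h2 ⊢
    rcases le_total |σ x| (τ / 2) with h4 | h4
    · rw [min_eq_left h4] at h3
      nlinarith [abs_nonneg (ρ x)]
    · rw [min_eq_right h4] at h3
      have h6 : M ≤ 4 * M / τ * |ρ x| := by
        calc M = 4 * M / τ * (τ / 2 / 2) := by field_simp; norm_num
          _ ≤ _ := by gcongr
      nlinarith [abs_nonneg (ρ x)]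
  · refine isCompact_of_isClosed_isBounded (isClosed_le hρc continuous_const)
      ((hD.isBounded.thickening (δ := τ)).subset fun x hx => ?_)
    have hx' : ρ x ≤ τ / 16 := hx
    rw [mem_thickening_iff_infDist_lt hD.nonempty]
    by_cases hxD : x ∈ D
    · rwa [infDist_zero_of_mem hxD]
    · have h1 : 0 ≤ ρ x := not_lt.1 fun h => hxD ((hσmem x).2 ((tentPrimitive_neg_iff hτ0 _).1 h))
      have h2 := hsmall x (by rwa [abs_of_nonneg h1])
      rw [hσ, signedInfDist, infDist_zero_of_mem (s := Dᶜ) hxD, sub_zero,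
        abs_of_nonneg infDist_nonneg] at h2
      linarith
  · intro x hx
    have h1 := hsmall x hx
    rw [hfd']
    simp only [hp]
    rw [norm_smul, innerSL_apply_norm, (hn x (by linarith)).1, mul_one,
      Real.norm_of_nonneg (tent_nonneg _)]
    refine le_trans ?_ (le_max_right _ _)
    have : |σ x| / τ ≤ 1 / 4 := by
      rw [div_le_iff₀ hτ0]
      linarith
    linarith

/-! ### Construction of the reflections along a transversal field. -/

namespace IsDefiningFunction

variable {d : ℕ} {D : Set (EuclideanSpace ℝ (Fin d))} {ρ : EuclideanSpace ℝ (Fin d) → ℝ}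

/-- There is a smooth field transversal to the level sets of a defining function near the boundary. -/
theorem exists_transversal (hρ : IsDefiningFunction D ρ) :
    ∃ N : EuclideanSpace ℝ (Fin d) → EuclideanSpace ℝ (Fin d), ContDiff ℝ 2 N ∧
      (∀ x, ‖N x‖ ≤ 2) ∧ ∃ κ : ℝ, 0 < κ ∧ IsCompact {x | ρ x ≤ κ} ∧
        ∀ x, |ρ x| ≤ κ → 1 / 2 ≤ fderiv ℝ ρ x (N x) := by
  obtain ⟨κ, hκ, hc, hlow⟩ := hρ.collar
  obtain ⟨K, hK⟩ := hρ.lipschitz_fderiv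
  have hgL : LipschitzWith K (gradient ρ) := LipschitzWith.of_dist_le_mul fun x y => by
    rw [gradient, gradient, LinearIsometryEquiv.dist_map]
    exact hK.dist_le_mul x y
  -- At this scale the mollified gradient N is within 1/16 of ∇ρ, so dρ(N) ≥ (3/4)² - 1/16 = 1/2 in
  -- the collar. The gradient itself is only Lipschitz, and moving along it need not be a C¹ map.
  set R : ℝ := 1 / (16 * (K + 1)) with hR
  have hR0 : 0 < R := by positivity
  let η : ContDiffBump (0 : EuclideanSpace ℝ (Fin d)) := ⟨R / 2, R, by positivity, by linarith⟩
  set N : EuclideanSpace ℝ (Fin d) → EuclideanSpace ℝ (Fin d) :=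
    η.normed volume ⋆[ContinuousLinearMap.lsmul ℝ ℝ, volume] gradient ρ with hN
  have hclose : ∀ x, dist (N x) (gradient ρ x) ≤ 1 / 16 := by
    intro x
    refine η.dist_normed_convolution_le hgL.continuous.aestronglyMeasurable fun y hy => ?_
    refine (hgL.dist_le_mul y x).trans ?_
    have h1 : dist y x ≤ R := (mem_ball.1 hy).le
    calc K * dist y x ≤ (K + 1) * R := by gcongr; linarith
      _ = 1 / 16 := by
        rw [hR]
        field_simp
  have hgn : ∀ x, ‖gradient ρ x‖ = ‖fderiv ℝ ρ x‖ := fun x => by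
    rw [gradient, LinearIsometryEquiv.norm_map]
  refine ⟨N, ?_, fun x => ?_, κ, hκ, hc, fun x hx => ?_⟩
  · exact η.hasCompactSupport_normed.contDiff_convolution_left (n := 2) _
      η.contDiff_normed hgL.continuous.locallyIntegrable
  · have h1 : ‖N x‖ ≤ ‖gradient ρ x‖ + ‖N x - gradient ρ x‖ := by
      have := norm_add_le (gradient ρ x) (N x - gradient ρ x)
      rwa [add_sub_cancel] at this
    rw [← dist_eq_norm, hgn] at h1
    linarith [hclose x, hρ.norm_fderiv_le x]
  · have h1 : fderiv ℝ ρ x (N x) = inner ℝ (gradient ρ x) (N x) := by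
      rw [gradient, InnerProductSpace.toDual_symm_apply]
    have h2 : inner ℝ (gradient ρ x) (N x) =
        ‖gradient ρ x‖ ^ 2 + inner ℝ (gradient ρ x) (N x - gradient ρ x) := by
      rw [inner_sub_right, real_inner_self_eq_norm_sq]
      ring
    have h3 := abs_real_inner_le_norm (gradient ρ x) (N x - gradient ρ x)
    rw [← dist_eq_norm, hgn] at h3
    have h4 := hclose x
    have h5 := hlow x hx
    have h6 := hρ.norm_fderiv_le x
    rw [h1, h2, hgn]
    have h7 : ‖fderiv ℝ ρ x‖ * dist (N x) (gradient ρ x) ≤ 1 * (1 / 16) := by gcongr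
    nlinarith [(abs_le.1 h3).1]

end IsDefiningFunction

theorem IsCollarReflection.mono {d : ℕ} {ρ : EuclideanSpace ℝ (Fin d) → ℝ} {κ κ' : ℝ}
    {Φ : EuclideanSpace ℝ (Fin d) → EuclideanSpace ℝ (Fin d)} (h : IsCollarReflection ρ κ Φ)
    (hκ : κ' ≤ κ) : IsCollarReflection ρ κ' Φ where
  contDiff := h.contDiff
  lipAt_fderiv := h.lipAt_fderiv
  antilipschitz := by
    obtain ⟨c, hc⟩ := h.antilipschitz
    exact ⟨c, fun x y hx hy => hc x y (hx.trans_le hκ) (hy.trans_le hκ)⟩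
  isInvertible x hx := h.isInvertible x (hx.trans_le hκ)
  neg_of_pos x hx := h.neg_of_pos x (hx.trans_le hκ)
  pos_of_neg x hx := h.pos_of_neg x (hx.trans_le hκ)
  eq_self := h.eq_self

theorem ContinuousLinearMap.isInvertible_of_injective {F : Type*} [NormedAddCommGroup F]
    [NormedSpace ℝ F] [FiniteDimensional ℝ F] {A : F →L[ℝ] F} (hA : Function.Injective A) :
    A.IsInvertible :=
  ⟨(LinearEquiv.ofInjectiveEndo (A : F →ₗ[ℝ] F) hA).toContinuousLinearEquiv, by ext v; rfl⟩

namespace IsDefiningFunction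

variable {d : ℕ} {D : Set (EuclideanSpace ℝ (Fin d))} {ρ : EuclideanSpace ℝ (Fin d) → ℝ}

/-- Moving along `N` by `s` times the defining function. -/
def shift (ρ : EuclideanSpace ℝ (Fin d) → ℝ)
    (N : EuclideanSpace ℝ (Fin d) → EuclideanSpace ℝ (Fin d)) (s : ℝ) (x : EuclideanSpace ℝ (Fin d)) :
    EuclideanSpace ℝ (Fin d) :=
  x - (s * ρ x) • N x

theorem hasFDerivAt_shift (hρ : IsDefiningFunction D ρ)
    {N : EuclideanSpace ℝ (Fin d) → EuclideanSpace ℝ (Fin d)} (hN : ContDiff ℝ 2 N) (s : ℝ)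
    (x : EuclideanSpace ℝ (Fin d)) :
    HasFDerivAt (shift ρ N s) (ContinuousLinearMap.id ℝ _ -
      ((s * ρ x) • fderiv ℝ N x + (s • fderiv ℝ ρ x).smulRight (N x))) x := by
  have h1 : HasFDerivAt ρ (fderiv ℝ ρ x) x :=
    (hρ.contDiff.differentiable (by simp) x).hasFDerivAt
  have h2 : HasFDerivAt N (fderiv ℝ N x) x := (hN.differentiable (by simp) x).hasFDerivAt
  exact (hasFDerivAt_id x).sub ((h1.const_mul s).smul h2)

theorem fderiv_shift_apply (hρ : IsDefiningFunction D ρ)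
    {N : EuclideanSpace ℝ (Fin d) → EuclideanSpace ℝ (Fin d)} (hN : ContDiff ℝ 2 N) (s : ℝ)
    (x v : EuclideanSpace ℝ (Fin d)) :
    fderiv ℝ (shift ρ N s) x v =
      v - (s * fderiv ℝ ρ x v) • N x - (s * ρ x) • fderiv ℝ N x v := by
  rw [(hρ.hasFDerivAt_shift hN s x).fderiv]
  simp
  abel

/-- Applying dρ to w = v - s dρ(v) n multiplies dρ(v) by 1 - s dρ(n), of modulus at least one. Hence
|dρ(v)| ≤ ‖w‖, and v = w + s dρ(v) n is controlled by w. -/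
theorem norm_le_mul_norm_sub_smul (hρ : IsDefiningFunction D ρ) {s : ℝ} (hs : 4 ≤ s)
    {x n v : EuclideanSpace ℝ (Fin d)} (hn : ‖n‖ ≤ 2) (ha : 1 / 2 ≤ fderiv ℝ ρ x n) :
    ‖v‖ ≤ (1 + 2 * s) * ‖v - (s * fderiv ℝ ρ x v) • n‖ := by
  set w := v - (s * fderiv ℝ ρ x v) • n with hw
  have h1 : fderiv ℝ ρ x w = fderiv ℝ ρ x v * (1 - s * fderiv ℝ ρ x n) := by
    rw [hw]
    simp
    ring
  have h2 : |fderiv ℝ ρ x w| ≤ ‖w‖ := by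
    have := (fderiv ℝ ρ x).le_opNorm w
    rw [Real.norm_eq_abs] at this
    exact this.trans (mul_le_of_le_one_left (norm_nonneg _) (hρ.norm_fderiv_le x))
  have h3 : |fderiv ℝ ρ x v| ≤ ‖w‖ := by
    refine le_trans ?_ h2
    rw [h1, abs_mul]
    refine le_mul_of_one_le_right (abs_nonneg _) ?_
    rw [abs_of_nonpos (by nlinarith)]
    nlinarith
  have h4 : v = w + (s * fderiv ℝ ρ x v) • n := by
    rw [hw]
    abel
  have h5 : ‖(s * fderiv ℝ ρ x v) • n‖ ≤ s * ‖w‖ * 2 := by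
    rw [norm_smul, Real.norm_eq_abs, abs_mul, abs_of_nonneg (by linarith : 0 ≤ s)]
    gcongr
  calc ‖v‖ ≤ ‖w‖ + ‖(s * fderiv ℝ ρ x v) • n‖ := by
        conv_lhs => rw [h4]
        exact norm_add_le _ _
    _ ≤ _ := by linarith

/-- The increment of the shift differs from the linear map of `norm_le_mul_norm_sub_smul` by the
Taylor error of ρ, small since ‖y - x‖ ≤ r, and by the variation of N, small since |ρ y| ≤ κ'. After
multiplication by m each is at most ‖y - x‖/4 and can be absorbed. -/
theorem norm_sub_le_mul_norm_shift_sub (hρ : IsDefiningFunction D ρ)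
    {N : EuclideanSpace ℝ (Fin d) → EuclideanSpace ℝ (Fin d)} (hN2 : ∀ x, ‖N x‖ ≤ 2) {C : ℝ}
    (hC0 : 0 < C) (hC : ∀ x h, |ρ (x + h) - ρ x - fderiv ℝ ρ x h| ≤ C * ‖h‖ ^ 2)
    {s m r κ' L : ℝ} (hs : 4 ≤ s) (h3 : 4 * m * s * L * κ' ≤ 1) (hm : m = 1 + 2 * s)
    (hr : r = 1 / (8 * m * s * C)) {x y : EuclideanSpace ℝ (Fin d)} (hxy : ‖y - x‖ ≤ r)
    (ha : 1 / 2 ≤ fderiv ℝ ρ x (N x)) (hy : |ρ y| ≤ κ') (hLN : ‖N y - N x‖ ≤ L * ‖y - x‖) :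
    ‖y - x‖ ≤ 2 * m * ‖shift ρ N s y - shift ρ N s x‖ := by
  have hs0 : 0 < s := by linarith
  have hm0 : 0 < m := by linarith
  have hr0 : 0 ≤ r := (norm_nonneg _).trans hxy
  have hκ' : 0 ≤ κ' := (abs_nonneg _).trans hy
  obtain ⟨E, hE⟩ : ∃ E, E = ρ y - ρ x - fderiv ℝ ρ x (y - x) := ⟨_, rfl⟩
  have hE' : |E| ≤ C * ‖y - x‖ ^ 2 := by
    have := hC x (y - x)
    rwa [add_sub_cancel, ← hE] at this
  have h5 : (y - x) - (s * fderiv ℝ ρ x (y - x)) • N x =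
      (shift ρ N s y - shift ρ N s x) + (s * E) • N x + (s * ρ y) • (N y - N x) := by
    rw [shift, shift, hE]
    module
  have h6 := hρ.norm_le_mul_norm_sub_smul hs (v := y - x) (hN2 x) ha
  rw [h5, ← hm] at h6
  have h7 : ‖(s * E) • N x‖ ≤ s * (C * (r * ‖y - x‖)) * 2 := by
    rw [norm_smul, Real.norm_eq_abs, abs_mul, abs_of_pos hs0]
    gcongr
    · refine hE'.trans ?_
      rw [pow_two]
      gcongr
    · exact hN2 x
  have h8 : ‖(s * ρ y) • (N y - N x)‖ ≤ s * κ' * (L * ‖y - x‖) := by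
    rw [norm_smul, Real.norm_eq_abs, abs_mul, abs_of_pos hs0]
    gcongr
  have h9 := norm_add₃_le (a := shift ρ N s y - shift ρ N s x) (b := (s * E) • N x)
    (c := (s * ρ y) • (N y - N x))
  have h10 : m * (s * (C * (r * ‖y - x‖)) * 2) = ‖y - x‖ / 4 := by
    rw [hr]
    field_simp
    ring
  have h11 : m * (s * κ' * (L * ‖y - x‖)) ≤ ‖y - x‖ / 4 := by
    have := mul_le_mul_of_nonneg_right h3 (norm_nonneg (y - x))
    linarith
  have h12 := mul_le_mul_of_nonneg_left (h9.trans (add_le_add_three le_rfl h7 h8)) hm0.le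
  rw [mul_add, mul_add] at h12
  linarith

theorem exists_isCollarReflection_shift (hρ : IsDefiningFunction D ρ)
    {N : EuclideanSpace ℝ (Fin d) → EuclideanSpace ℝ (Fin d)} (hN : ContDiff ℝ 2 N)
    (hN2 : ∀ x, ‖N x‖ ≤ 2) {κ : ℝ} (hκ : 0 < κ) (hc : IsCompact {x | ρ x ≤ κ})
    (ha : ∀ x, |ρ x| ≤ κ → 1 / 2 ≤ fderiv ℝ ρ x (N x)) {s : ℝ} (hs : 4 ≤ s) :
    ∃ κ' : ℝ, 0 < κ' ∧ κ' ≤ κ ∧ IsCollarReflection ρ κ' (shift ρ N s) := by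
  obtain ⟨C, hC0, hC⟩ := hρ.expansion
  have hρc := hρ.contDiff.continuous
  have hT : IsCompact {x | |ρ x| ≤ κ} :=
    hc.of_isClosed_subset (isClosed_le hρc.abs continuous_const)
      fun x (hx : |ρ x| ≤ κ) => (le_abs_self _).trans hx
  obtain ⟨L₁, hL₁⟩ := LocallyLipschitzOn.exists_lipschitzOnWith_of_compact hT
    (((hN.of_le one_le_two).locallyLipschitz).locallyLipschitzOn (s := {x | |ρ x| ≤ κ}))
  obtain ⟨L₂, hL₂⟩ := hT.exists_bound_of_continuousOn
    (hN.continuous_fderiv (by simp)).continuousOn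
  obtain ⟨L, hL0, hLN, hLD⟩ : ∃ L : ℝ, 0 < L ∧
      (∀ x y, |ρ x| ≤ κ → |ρ y| ≤ κ → ‖N y - N x‖ ≤ L * ‖y - x‖) ∧
      ∀ x v, |ρ x| ≤ κ → ‖fderiv ℝ N x v‖ ≤ L * ‖v‖ := by
    refine ⟨max (L₁ : ℝ) L₂ + 1, by positivity, fun x y hx hy => ?_, fun x v hx => ?_⟩
    · have := hL₁.dist_le_mul y hy x hx
      rw [dist_eq_norm, dist_eq_norm] at this
      refine this.trans ?_
      gcongr
      linarith [le_max_left (L₁ : ℝ) L₂]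
    · refine ((fderiv ℝ N x).le_opNorm v).trans ?_
      gcongr
      linarith [hL₂ x hx, le_max_right (L₁ : ℝ) L₂]
  have hs0 : 0 < s := by linarith
  set m : ℝ := 1 + 2 * s with hm
  have hm0 : 0 < m := by linarith
  set r : ℝ := 1 / (8 * m * s * C) with hr
  have hr0 : 0 < r := by positivity
  -- The last three thresholds serve, in order, pairs farther apart than r, the variation of N
  -- (nearby pairs and invertibility), and the exchange of sides.
  obtain ⟨κ', hκ'0, h1, h2, h3, h4⟩ : ∃ κ' : ℝ, 0 < κ' ∧ κ' ≤ κ ∧ 8 * s * κ' ≤ r ∧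
      4 * m * s * L * κ' ≤ 1 ∧ 8 * C * s ^ 2 * κ' ≤ 1 := by
    refine ⟨min (min κ (r / (8 * s))) (min (1 / (4 * m * s * L)) (1 / (8 * C * s ^ 2))),
      by positivity, (min_le_left _ _).trans (min_le_left _ _), ?_, ?_, ?_⟩
    · rw [← le_div_iff₀' (by positivity)]
      exact (min_le_left _ _).trans (min_le_right _ _)
    · rw [← le_div_iff₀' (by positivity)]
      exact (min_le_right _ _).trans (min_le_left _ _)
    · rw [← le_div_iff₀' (by positivity)]
      exact (min_le_right _ _).trans (min_le_right _ _)
  -- To first order the shift multiplies ρ by 1 - s dρ(N) ≤ -1, and in the thin collar the error is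
  -- at most |ρ|/2, so the sign is reversed.
  have hsign : ∀ x, |ρ (shift ρ N s x) - ρ x * (1 - s * fderiv ℝ ρ x (N x))| ≤
      4 * C * s ^ 2 * (ρ x * ρ x) := by
    intro x
    have h5 := hC x (-((s * ρ x) • N x))
    rw [← sub_eq_add_neg, norm_neg, norm_smul, map_neg, map_smul, smul_eq_mul] at h5
    rw [shift]
    rw [show ρ (x - (s * ρ x) • N x) - ρ x * (1 - s * fderiv ℝ ρ x (N x)) =
      ρ (x - (s * ρ x) • N x) - ρ x - -(s * ρ x * fderiv ℝ ρ x (N x)) by ring]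
    refine h5.trans ?_
    calc C * (‖s * ρ x‖ * ‖N x‖) ^ 2 ≤ C * (‖s * ρ x‖ * 2) ^ 2 := by
          gcongr
          exact hN2 x
      _ = _ := by
        rw [mul_pow, Real.norm_eq_abs, sq_abs]
        ring
  refine ⟨κ', hκ'0, h1, ?_, ?_, ?_, ?_, ?_, ?_, ?_⟩
  · exact contDiff_id.sub ((contDiff_const.mul hρ.contDiff).smul (hN.of_le one_le_two))
  · intro x
    have h5 : fderiv ℝ (shift ρ N s) = fun x => ContinuousLinearMap.id ℝ _ -
        ((s * ρ x) • fderiv ℝ N x + (s • fderiv ℝ ρ x).smulRight (N x)) :=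
      funext fun x => (hρ.hasFDerivAt_shift hN s x).fderiv
    rw [h5]
    obtain ⟨K, hK⟩ := hρ.lipschitz_fderiv
    have h6 : LipAt (fun y => (fderiv ℝ ρ y, y)) x := (hK.lipAt x).prodMk (LipschitzWith.id.lipAt x)
    refine LipAt.comp (g := fun p : (EuclideanSpace ℝ (Fin d) →L[ℝ] ℝ) × EuclideanSpace ℝ (Fin d) =>
      ContinuousLinearMap.id ℝ _ - ((s * ρ p.2) • fderiv ℝ N p.2 + (s • p.1).smulRight (N p.2)))
      (LipAt.of_contDiffAt ?_) h6
    have h7 : ContDiff ℝ 1 (fderiv ℝ N) := hN.fderiv_right (by norm_num)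
    refine ContDiff.contDiffAt (contDiff_const.sub (ContDiff.add ?_ ?_))
    · exact (contDiff_const.mul (hρ.contDiff.comp contDiff_snd)).smul (h7.comp contDiff_snd)
    · have h8 : ContDiff ℝ 1 fun p : (EuclideanSpace ℝ (Fin d) →L[ℝ] ℝ) × EuclideanSpace ℝ (Fin d) =>
          s • p.1 := contDiff_fst.const_smul s
      exact h8.smulRight ((hN.of_le one_le_two).comp contDiff_snd)
  · refine ⟨(2 * m).toNNReal, fun x y hx hy => ?_⟩
    rw [Real.coe_toNNReal _ (by positivity), dist_comm x, dist_comm (shift ρ N s x), dist_eq_norm,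
      dist_eq_norm]
    by_cases hxy : ‖y - x‖ ≤ r
    · exact hρ.norm_sub_le_mul_norm_shift_sub hN2 hC0 hC hs (by linarith) hm hr hxy
        (ha x (hx.le.trans h1)) hy.le (hLN x y (hx.le.trans h1) (hy.le.trans h1))
    -- For pairs at distance more than r no linearization is needed: each point moves by at most
    -- r/4, hence by less than a quarter of their distance.
    · push Not at hxy
      have h5 : ∀ z, |ρ z| < κ' → ‖z - shift ρ N s z‖ ≤ r / 4 := by
        intro z hz
        rw [shift, sub_sub_cancel, norm_smul, Real.norm_eq_abs, abs_mul, abs_of_pos hs0]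
        calc s * |ρ z| * ‖N z‖ ≤ s * κ' * 2 := by
              gcongr
              exact hN2 z
          _ ≤ r / 4 := by linarith
      have h6 : y - x = (y - shift ρ N s y) + (shift ρ N s y - shift ρ N s x) +
          -(x - shift ρ N s x) := by abel
      have h7 := norm_add₃_le (a := y - shift ρ N s y) (b := shift ρ N s y - shift ρ N s x)
        (c := -(x - shift ρ N s x))
      rw [← h6, norm_neg] at h7
      have h8 : ‖y - x‖ ≤ 2 * ‖shift ρ N s y - shift ρ N s x‖ := by
        linarith [h5 x hx, h5 y hy]
      refine h8.trans ?_
      gcongr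
      linarith
  · intro x hx
    refine ContinuousLinearMap.isInvertible_of_injective ?_
    rw [injective_iff_map_eq_zero]
    intro v hv
    rw [hρ.fderiv_shift_apply hN, sub_eq_zero] at hv
    have h6 := hρ.norm_le_mul_norm_sub_smul hs (v := v) (hN2 x) (ha x (hx.le.trans h1))
    rw [hv, ← hm] at h6
    have h8 : ‖(s * ρ x) • fderiv ℝ N x v‖ ≤ s * κ' * (L * ‖v‖) := by
      rw [norm_smul, Real.norm_eq_abs, abs_mul, abs_of_pos hs0]
      gcongr
      exact hLD x v (hx.le.trans h1)
    have h9 := mul_le_mul_of_nonneg_left h8 hm0.le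
    have h10 := mul_le_mul_of_nonneg_right h3 (norm_nonneg v)
    exact norm_le_zero_iff.1 (by linarith)
  · intro x hx hpos
    have h5 := (abs_le.1 (hsign x)).2
    have h6 := ha x (hx.le.trans h1)
    rw [abs_of_pos hpos] at hx
    have h7 : 4 * C * s ^ 2 * (ρ x * ρ x) ≤ ρ x / 2 := by
      have : 8 * C * s ^ 2 * ρ x ≤ 1 := le_trans (by gcongr) h4
      nlinarith
    have h8 : 1 ≤ s * fderiv ℝ ρ x (N x) - 1 := by nlinarith
    nlinarith
  · intro x hx hneg
    have h5 := (abs_le.1 (hsign x)).1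
    have h6 := ha x (hx.le.trans h1)
    rw [abs_of_neg hneg] at hx
    have h7 : 4 * C * s ^ 2 * (ρ x * ρ x) ≤ -ρ x / 2 := by
      have : 8 * C * s ^ 2 * -ρ x ≤ 1 := le_trans (by gcongr) h4
      nlinarith
    have h8 : 1 ≤ s * fderiv ℝ ρ x (N x) - 1 := by nlinarith
    nlinarith
  · intro x hx
    simp [shift, hx]

/-- On the boundary DΦ_s v = v - s dρ(v) N. Hence dρ(DΦ_s v) (DΦ_s)⁻¹ w = dρ(v) (w - s (dρ(N) w -
dρ(w) N)): the denominator 1 - s dρ(N) of the inverse cancels and the result is affine in s, so two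
linear conditions on the weights suffice. -/
theorem noJump_shift (hρ : IsDefiningFunction D ρ)
    {N : EuclideanSpace ℝ (Fin d) → EuclideanSpace ℝ (Fin d)} (hN : ContDiff ℝ 2 N)
    {ι : Type*} [Fintype ι] {c s : ι → ℝ} (hc : ∑ i, c i = 1) (hcs : ∑ i, c i * s i = 0)
    (hinv : ∀ i y, ρ y = 0 → (fderiv ℝ (shift ρ N (s i)) y).IsInvertible) :
    NoJump ρ c fun i => shift ρ N (s i) := by
  intro y hy v w
  have key : ∀ i, (c i * fderiv ℝ ρ y (fderiv ℝ (shift ρ N (s i)) y v)) •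
      (fderiv ℝ (shift ρ N (s i)) y).inverse w =
      fderiv ℝ ρ y v • (c i • w - (c i * s i) • (fderiv ℝ ρ y (N y) • w - fderiv ℝ ρ y w • N y)) := by
    intro i
    set u := (fderiv ℝ (shift ρ N (s i)) y).inverse w with hu
    have hw : u - (s i * fderiv ℝ ρ y u) • N y = w := by
      have := (hinv i y hy).self_apply_inverse w
      rw [← hu, hρ.fderiv_shift_apply hN, hy] at this
      simpa using this
    have hρw : fderiv ℝ ρ y w = fderiv ℝ ρ y u * (1 - s i * fderiv ℝ ρ y (N y)) := by
      rw [← hw]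
      simp
      ring
    rw [hρ.fderiv_shift_apply hN, hy, hρw]
    rw [← hw]
    simp only [map_sub, map_smul, smul_eq_mul, mul_zero, zero_smul, sub_zero]
    module
  rw [Finset.sum_congr rfl fun i _ => key i, ← Finset.smul_sum, Finset.sum_sub_distrib,
    ← Finset.sum_smul, ← Finset.sum_smul, hc, hcs]
  simp

end IsDefiningFunction

/-- A divergence-free Sobolev field on a `C^{1,1}` domain extends to a divergence-free Sobolev field
on a neighbourhood of the closure of the domain. -/
theorem IsC11Domain.exists_divergenceFree_extension {d : ℕ} [Nonempty (Fin d)]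
    {D : Set (EuclideanSpace ℝ (Fin d))} (hD : IsC11Domain D) {q : ℝ≥0∞} (hq : 1 ≤ q) (hq' : q ≠ ⊤)
    {b : EuclideanSpace ℝ (Fin d) → EuclideanSpace ℝ (Fin d)} (hb : VectorMemW1 D q b)
    (hdiv : HasWeakDivergence D b fun _ => 0) :
    ∃ W : Set (EuclideanSpace ℝ (Fin d)), IsOpen W ∧ closure D ⊆ W ∧
      ∃ b' : EuclideanSpace ℝ (Fin d) → EuclideanSpace ℝ (Fin d), VectorMemW1 W q b' ∧
        HasWeakDivergence W b' (fun _ => 0) ∧ ∀ x ∈ D, b' x = b x := by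
  obtain ⟨ρ, hρ⟩ := hD.exists_definingFunction
  obtain ⟨N, hN, hN2, κ, hκ, hc, ha⟩ := hρ.exists_transversal
  obtain ⟨κ₁, hκ₁, hκ₁', h₁⟩ :=
    hρ.exists_isCollarReflection_shift hN hN2 hκ hc ha (s := 4) le_rfl
  obtain ⟨κ₂, hκ₂, hκ₂', h₂⟩ :=
    hρ.exists_isCollarReflection_shift hN hN2 hκ hc ha (s := 8) (by norm_num)
  set κ₀ := min κ₁ κ₂ with hκ₀
  have hκ₀0 : 0 < κ₀ := lt_min hκ₁ hκ₂
  have hρc := hρ.contDiff.continuous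
  have hΦ : ∀ i : Fin 2, IsCollarReflection ρ κ₀
      (IsDefiningFunction.shift ρ N ((![4, 8] : Fin 2 → ℝ) i)) := by
    intro i
    fin_cases i
    · exact h₁.mono (min_le_left _ _)
    · exact h₂.mono (min_le_right _ _)
  have hc₀ : IsCompact {x | ρ x ≤ κ₀} :=
    hc.of_isClosed_subset (isClosed_le hρc continuous_const)
      fun x (hx : ρ x ≤ κ₀) => hx.trans ((min_le_left _ _).trans hκ₁')
  -- The weights satisfy 2 - 1 = 1 and 2 · 4 - 1 · 8 = 0.
  have hJ := hρ.noJump_shift hN (c := ![2, -1]) (s := ![4, 8]) (by norm_num [Fin.sum_univ_two])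
    (by norm_num [Fin.sum_univ_two])
    fun i y hy => (hΦ i).isInvertible y (by simpa [hy] using hκ₀0)
  obtain ⟨b', hb', hdiv', hbb'⟩ := hρ.exists_extension hκ₀0 hc₀ hΦ
    (by norm_num [Fin.sum_univ_two]) hJ hq hq' hb hdiv
  refine ⟨{x | ρ x < κ₀ / 2}, isOpen_lt hρc continuous_const, ?_, b', hb', hdiv', hbb'⟩
  have : closure D ⊆ {x | ρ x ≤ 0} :=
    closure_minimal (fun z hz => ((hρ.mem_iff z).1 hz).le) (isClosed_le hρc continuous_const)
  exact this.trans fun x (hx : ρ x ≤ 0) => show ρ x < κ₀ / 2 by linarith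

/-! ### Averages of translates. -/

section TranslationAverage

variable {d : ℕ} {Ω : Type*} [MeasurableSpace Ω] {P : Measure Ω}
  {a : Ω → ℝ} {τ : Ω → EuclideanSpace ℝ (Fin d)} {f g : EuclideanSpace ℝ (Fin d) → ℝ} {M : ℝ}

/-- The weighted average of the translates of `f` by the vectors `τ s`. -/
noncomputable def translationAverage (P : Measure Ω) (a : Ω → ℝ)
    (τ : Ω → EuclideanSpace ℝ (Fin d)) (f : EuclideanSpace ℝ (Fin d) → ℝ)
    (x : EuclideanSpace ℝ (Fin d)) : ℝ :=
  ∫ s, a s * f (x - τ s) ∂P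

theorem measurePreserving_translation [IsProbabilityMeasure P] (hτ : Measurable τ) :
    MeasurePreserving (fun p : Ω × EuclideanSpace ℝ (Fin d) => p.2 - τ p.1) (P.prod volume)
      volume := by
  have h1 : MeasurePreserving (fun p : Ω × EuclideanSpace ℝ (Fin d) => (p.1, p.2 - τ p.1))
      (P.prod volume) (P.prod volume) :=
    (MeasurePreserving.id P).skew_product (g := fun s x => x - τ s)
      (measurable_snd.sub (hτ.comp measurable_fst))
      (ae_of_all _ fun s => (measurePreserving_sub_right volume (τ s)).map_eq)
  exact measurePreserving_snd.comp h1

theorem memLp_translation [IsProbabilityMeasure P] (ha : Measurable a) (hτ : Measurable τ)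
    (hM : ∀ᵐ s ∂P, |a s| ≤ M) {q : ℝ≥0∞} (hf : MemLp f q volume) :
    MemLp (fun p : Ω × EuclideanSpace ℝ (Fin d) => a p.1 * f (p.2 - τ p.1)) q
      (P.prod volume) := by
  have h1 : MemLp (fun p : Ω × EuclideanSpace ℝ (Fin d) => f (p.2 - τ p.1)) q (P.prod volume) :=
    hf.comp_measurePreserving (measurePreserving_translation hτ)
  have h2 : MemLp (fun p : Ω × EuclideanSpace ℝ (Fin d) => a p.1) ⊤ (P.prod volume) :=
    memLp_top_of_bound (ha.comp measurable_fst).aestronglyMeasurable M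
      (Measure.quasiMeasurePreserving_fst.ae hM)
  exact h1.mul h2

theorem integrable_translation [IsProbabilityMeasure P] (ha : Measurable a) (hτ : Measurable τ)
    (hM : ∀ᵐ s ∂P, |a s| ≤ M) (hf : Integrable f) :
    Integrable (fun p : Ω × EuclideanSpace ℝ (Fin d) => a p.1 * f (p.2 - τ p.1))
      (P.prod volume) :=
  memLp_one_iff_integrable.1 (memLp_translation ha hτ hM (memLp_one_iff_integrable.2 hf))

theorem integrable_translationAverage [IsProbabilityMeasure P] (ha : Measurable a)
    (hτ : Measurable τ) (hM : ∀ᵐ s ∂P, |a s| ≤ M) (hf : Integrable f) :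
    Integrable (translationAverage P a τ f) :=
  (integrable_translation ha hτ hM hf).integral_prod_right

/-- On a probability space the L¹ norm of each slice is at most its L^q norm; Tonelli's theorem then
sums the q-th powers. -/
theorem MeasureTheory.MemLp.integral_prod_right_of_isProbabilityMeasure {X : Type*}
    [MeasurableSpace X] {μ : Measure X} [SFinite μ] [IsProbabilityMeasure P] {q : ℝ≥0∞}
    (hq : 1 ≤ q) (hq' : q ≠ ⊤) {F : Ω × X → ℝ} (hF : MemLp F q (P.prod μ)) :
    MemLp (fun x => ∫ s, F (s, x) ∂P) q μ := by
  have hq0 : q ≠ 0 := (zero_lt_one.trans_le hq).ne'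
  have hm := hF.aestronglyMeasurable
  refine ⟨hm.prod_swap.integral_prod_right', ?_⟩
  rw [eLpNorm_lt_top_iff_lintegral_rpow_enorm_lt_top hq0 hq']
  have h1 := (eLpNorm_lt_top_iff_lintegral_rpow_enorm_lt_top hq0 hq').1 hF.eLpNorm_lt_top
  rw [lintegral_prod_symm _ (hm.enorm.pow_const _)] at h1
  refine lt_of_le_of_lt (lintegral_mono_ae ?_) h1
  filter_upwards [hm.prod_swap.prodMk_left] with x hx
  have h2 : ‖∫ s, F (s, x) ∂P‖ₑ ≤ eLpNorm (fun s => F (s, x)) q P := by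
    refine (enorm_integral_le_lintegral_enorm _).trans ?_
    rw [← eLpNorm_one_eq_lintegral_enorm]
    exact eLpNorm_le_eLpNorm_of_exponent_le hq hx
  refine (ENNReal.rpow_le_rpow h2 ENNReal.toReal_nonneg).trans ?_
  rw [eLpNorm_eq_lintegral_rpow_enorm_toReal hq0 hq', ← ENNReal.rpow_mul,
    one_div, inv_mul_cancel₀ (ENNReal.toReal_pos hq0 hq').ne', ENNReal.rpow_one]

theorem memLp_translationAverage [IsProbabilityMeasure P] (ha : Measurable a)
    (hτ : Measurable τ) (hM : ∀ᵐ s ∂P, |a s| ≤ M) {q : ℝ≥0∞} (hq : 1 ≤ q) (hq' : q ≠ ⊤)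
    (hf : MemLp f q volume) : MemLp (translationAverage P a τ f) q volume :=
  (memLp_translation ha hτ hM hf).integral_prod_right_of_isProbabilityMeasure hq hq'

/-- Fubini's theorem and translation invariance. Moving the translation onto the test function lets
weak identities pass to averages slice by slice. -/
theorem integral_translationAverage_mul [IsProbabilityMeasure P] (ha : Measurable a)
    (hτ : Measurable τ) (hM : ∀ᵐ s ∂P, |a s| ≤ M) (hf : Integrable f)
    {ψ : EuclideanSpace ℝ (Fin d) → ℝ} (hψ : Continuous ψ) (hc : HasCompactSupport ψ) :
    ∫ x, translationAverage P a τ f x * ψ x = ∫ s, a s * (∫ x, f x * ψ (x + τ s)) ∂P := by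
  obtain ⟨B, hB⟩ := hc.exists_bound_of_continuous hψ
  have h1 : Integrable (fun p : Ω × EuclideanSpace ℝ (Fin d) =>
      a p.1 * f (p.2 - τ p.1) * ψ p.2) (P.prod volume) :=
    (integrable_translation ha hτ hM hf).mul_bdd
      (hψ.measurable.comp measurable_snd).aestronglyMeasurable (ae_of_all _ fun p => hB p.2)
  have h2 := integral_integral_swap (f := fun s x => a s * f (x - τ s) * ψ x) h1
  simp only [translationAverage, ← integral_mul_const]
  rw [← h2]
  refine integral_congr_ae (ae_of_all _ fun s => ?_)
  simp only [mul_assoc, integral_const_mul]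
  congr 1
  simpa using integral_sub_right_eq_self (μ := volume) (fun x => f x * ψ (x + τ s)) (τ s)

theorem IsTestFunction.comp_add_right {U V : Set (EuclideanSpace ℝ (Fin d))}
    {φ : EuclideanSpace ℝ (Fin d) → ℝ} (hφ : IsTestFunction U φ) {z : EuclideanSpace ℝ (Fin d)}
    (hz : ∀ x ∈ U, x - z ∈ V) : IsTestFunction V fun x => φ (x + z) where
  contDiff := hφ.contDiff.comp (contDiff_id.add contDiff_const)
  hasCompactSupport := hφ.hasCompactSupport.comp_homeomorph (Homeomorph.addRight z)
  tsupport_subset := by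
    have h := tsupport_comp_eq_preimage φ (Homeomorph.addRight z)
    intro x hx
    have hx' : x + z ∈ tsupport φ := by
      have : x ∈ tsupport (φ ∘ Homeomorph.addRight z) := hx
      rw [h] at this
      exact this
    simpa using hz _ (hφ.tsupport_subset hx')

theorem IsTestFunction.setIntegral_mul {U : Set (EuclideanSpace ℝ (Fin d))}
    {φ : EuclideanSpace ℝ (Fin d) → ℝ} (hφ : IsTestFunction U φ)
    (F : EuclideanSpace ℝ (Fin d) → ℝ) : ∫ x in U, F x * φ x = ∫ x, F x * φ x :=
  setIntegral_eq_integral_of_forall_compl_eq_zero fun x hx => by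
    rw [image_eq_zero_of_notMem_tsupport fun h => hx (hφ.tsupport_subset h), mul_zero]

theorem IsTestFunction.fderiv_eq_zero {U : Set (EuclideanSpace ℝ (Fin d))}
    {φ : EuclideanSpace ℝ (Fin d) → ℝ} (hφ : IsTestFunction U φ) {x : EuclideanSpace ℝ (Fin d)}
    (hx : x ∉ U) : fderiv ℝ φ x = 0 :=
  image_eq_zero_of_notMem_tsupport fun h => hx (hφ.tsupport_subset (tsupport_fderiv_subset ℝ h))

theorem IsTestFunction.setIntegral_mul_fderiv {U : Set (EuclideanSpace ℝ (Fin d))}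
    {φ : EuclideanSpace ℝ (Fin d) → ℝ} (hφ : IsTestFunction U φ)
    (F : EuclideanSpace ℝ (Fin d) → ℝ) (e : EuclideanSpace ℝ (Fin d)) :
    ∫ x in U, F x * fderiv ℝ φ x e = ∫ x, F x * fderiv ℝ φ x e :=
  setIntegral_eq_integral_of_forall_compl_eq_zero fun x hx => by
    rw [hφ.fderiv_eq_zero hx]
    simp

/-- Averages of translates have the averages of translates of the weak derivatives as weak
derivatives. -/
theorem HasWeakPartialDeriv.translationAverage [IsProbabilityMeasure P] (ha : Measurable a)
    (hτ : Measurable τ) (hM : ∀ᵐ s ∂P, |a s| ≤ M) {U V : Set (EuclideanSpace ℝ (Fin d))}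
    (hUV : ∀ᵐ s ∂P, ∀ x ∈ U, x - τ s ∈ V) {i : Fin d} (hf : Integrable f) (hg : Integrable g)
    (h : HasWeakPartialDeriv V i f g) :
    HasWeakPartialDeriv U i (translationAverage P a τ f) (translationAverage P a τ g) := by
  refine ⟨(integrable_translationAverage ha hτ hM hf).locallyIntegrable.locallyIntegrableOn _,
    (integrable_translationAverage ha hτ hM hg).locallyIntegrable.locallyIntegrableOn _,
    fun φ hφ => ?_⟩
  rw [hφ.setIntegral_mul_fderiv, hφ.setIntegral_mul,
    integral_translationAverage_mul ha hτ hM hf (IsDefiningFunction.continuous_fderiv_test hφ _)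
      (IsDefiningFunction.hasCompactSupport_fderiv_test hφ _),
    integral_translationAverage_mul ha hτ hM hg hφ.contDiff.continuous hφ.hasCompactSupport,
    ← integral_neg]
  refine integral_congr_ae (hUV.mono fun s hs => ?_)
  have hφs := hφ.comp_add_right hs
  have h1 := h.2.2 _ hφs
  rw [hφs.setIntegral_mul_fderiv, hφs.setIntegral_mul] at h1
  simp only [fderiv_comp_add_right] at h1
  simp only [h1, mul_neg]

end TranslationAverage

/-! ### Sobolev functions: restriction, cutoff, linear combinations, averages. -/

section SobolevAlgebra

variable {d : ℕ} {U V : Set (EuclideanSpace ℝ (Fin d))} {i : Fin d} {q : ℝ≥0∞}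
  {f f₁ f₂ g g₁ g₂ φ η : EuclideanSpace ℝ (Fin d) → ℝ}

theorem IsTestFunction.mono (hφ : IsTestFunction U φ) (h : U ⊆ V) : IsTestFunction V φ :=
  ⟨hφ.contDiff, hφ.hasCompactSupport, hφ.tsupport_subset.trans h⟩

theorem IsTestFunction.mul_contDiff (hη : IsTestFunction U η) (hφ : ContDiff ℝ ∞ φ) :
    IsTestFunction U fun x => η x * φ x :=
  ⟨hη.contDiff.mul hφ, hη.hasCompactSupport.mul_right,
    (tsupport_mul_subset_left (f := η) (g := φ)).trans hη.tsupport_subset⟩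

theorem IsTestFunction.fderiv_apply (hη : IsTestFunction U η) (e : EuclideanSpace ℝ (Fin d)) :
    IsTestFunction U fun x => fderiv ℝ η x e :=
  ⟨(hη.contDiff.fderiv_right (m := ∞) (by simp)).clm_apply contDiff_const,
    IsDefiningFunction.hasCompactSupport_fderiv_test hη e,
    (tsupport_fderiv_apply_subset ℝ e).trans hη.tsupport_subset⟩

theorem MeasureTheory.LocallyIntegrableOn.integrable_mul_test (hf : LocallyIntegrableOn f U)
    (hη : IsTestFunction U η) : Integrable fun x => f x * η x := by
  have h1 : IntegrableOn f (tsupport η) :=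
    hf.integrableOn_compact_subset hη.tsupport_subset hη.hasCompactSupport
  refine (integrableOn_iff_integrable_of_support_subset (s := tsupport η) fun x hx => ?_).1
    (IsDefiningFunction.integrable_mul_test h1 hη.contDiff.continuous hη.hasCompactSupport)
  exact subset_tsupport _ fun h => hx (by simp [h])

theorem fderiv_mul_apply (hη : Differentiable ℝ η) (hφ : Differentiable ℝ φ)
    (x e : EuclideanSpace ℝ (Fin d)) :
    fderiv ℝ (fun y => η y * φ y) x e = η x * fderiv ℝ φ x e + φ x * fderiv ℝ η x e := by
  rw [fderiv_fun_mul (hη x) (hφ x)]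
  simp

theorem IsTestFunction.differentiable (hη : IsTestFunction U η) : Differentiable ℝ η :=
  hη.contDiff.differentiable (by simp)

theorem HasWeakPartialDeriv.mono (h : HasWeakPartialDeriv V i f g) (hUV : U ⊆ V) :
    HasWeakPartialDeriv U i f g := by
  refine ⟨h.1.mono_set hUV, h.2.1.mono_set hUV, fun φ hφ => ?_⟩
  have h1 := h.2.2 φ (hφ.mono hUV)
  rw [(hφ.mono hUV).setIntegral_mul_fderiv, (hφ.mono hUV).setIntegral_mul] at h1
  rwa [hφ.setIntegral_mul_fderiv, hφ.setIntegral_mul]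

theorem MemW1.mono (h : MemW1 V q f) (hUV : U ⊆ V) : MemW1 U q f := by
  refine ⟨h.1.mono_measure (Measure.restrict_mono_set volume hUV), fun i => ?_⟩
  obtain ⟨g, hg, hfg⟩ := h.2 i
  exact ⟨g, hg.mono_measure (Measure.restrict_mono_set volume hUV), hfg.mono hUV⟩

theorem HasWeakDivergence.mono {b : EuclideanSpace ℝ (Fin d) → EuclideanSpace ℝ (Fin d)}
    (h : HasWeakDivergence V b g) (hUV : U ⊆ V) : HasWeakDivergence U b g := by
  refine ⟨h.1.mono_set hUV, h.2.1.mono_set hUV, fun φ hφ => ?_⟩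
  have h1 := h.2.2 φ (hφ.mono hUV)
  have h2 : ∀ {S : Set (EuclideanSpace ℝ (Fin d))}, IsTestFunction S φ →
      ∫ x in S, inner ℝ (b x) (gradient φ x) = ∫ x, inner ℝ (b x) (gradient φ x) := fun hS =>
    setIntegral_eq_integral_of_forall_compl_eq_zero fun x hx => by
      rw [gradient, image_eq_zero_of_notMem_tsupport fun h =>
        hx (hS.tsupport_subset (tsupport_fderiv_subset ℝ h)), map_zero, inner_zero_right]
  rw [h2 (hφ.mono hUV), (hφ.mono hUV).setIntegral_mul] at h1
  rwa [h2 hφ, hφ.setIntegral_mul]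

theorem HasWeakPartialDeriv.congr_ae (h : HasWeakPartialDeriv U i f₁ g₁)
    (hf : f₁ =ᵐ[volume.restrict U] f₂) (hg : g₁ =ᵐ[volume.restrict U] g₂)
    (hf' : LocallyIntegrableOn f₂ U) (hg' : LocallyIntegrableOn g₂ U) :
    HasWeakPartialDeriv U i f₂ g₂ := by
  refine ⟨hf', hg', fun φ hφ => ?_⟩
  have e1 : ∫ x in U, f₁ x * fderiv ℝ φ x (EuclideanSpace.single i 1) =
      ∫ x in U, f₂ x * fderiv ℝ φ x (EuclideanSpace.single i 1) :=
    integral_congr_ae (hf.mono fun x hx => by simp only [hx])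
  have e2 : ∫ x in U, g₁ x * φ x = ∫ x in U, g₂ x * φ x :=
    integral_congr_ae (hg.mono fun x hx => by simp only [hx])
  rw [← e1, h.2.2 φ hφ, e2]

/-- For any φ on the whole space, ηφ is a test function on `U`; testing with it and expanding by
Leibniz' rule gives the identity on all of space. -/
theorem HasWeakPartialDeriv.mul_test (h : HasWeakPartialDeriv U i f g) (hη : IsTestFunction U η) :
    HasWeakPartialDeriv Set.univ i (fun x => f x * η x)
      (fun x => g x * η x + f x * fderiv ℝ η x (EuclideanSpace.single i 1)) := by
  set e : EuclideanSpace ℝ (Fin d) := EuclideanSpace.single i 1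
  have i1 := h.1.integrable_mul_test hη
  have i2 := h.2.1.integrable_mul_test hη
  have i3 := h.1.integrable_mul_test (hη.fderiv_apply e)
  refine ⟨i1.locallyIntegrable.locallyIntegrableOn _,
    (i2.add i3).locallyIntegrable.locallyIntegrableOn _, fun φ hφ => ?_⟩
  change ∫ x in Set.univ, f x * η x * fderiv ℝ φ x e =
    -∫ x in Set.univ, (g x * η x + f x * fderiv ℝ η x e) * φ x
  simp only [Measure.restrict_univ]
  have h1 := hη.mul_contDiff hφ.contDiff
  have h2 := h.2.2 _ h1
  rw [h1.setIntegral_mul_fderiv, h1.setIntegral_mul] at h2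
  have h3 : ∀ x, f x * η x * fderiv ℝ φ x e =
      f x * fderiv ℝ (fun y => η y * φ y) x e - f x * (fderiv ℝ η x e * φ x) := by
    intro x
    rw [fderiv_mul_apply hη.differentiable hφ.differentiable]
    ring
  simp only [h3, add_mul]
  have i4 := h.1.integrable_mul_test ((hη.fderiv_apply e).mul_contDiff hφ.contDiff)
  rw [integral_sub (h.1.integrable_mul_test (h1.fderiv_apply e)) i4, h2, integral_add]
  · simp only [mul_assoc]
    ring
  · simpa only [mul_assoc] using h.2.1.integrable_mul_test h1
  · simpa only [mul_assoc] using i4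

theorem MeasureTheory.MemLp.mul_test (hU : IsOpen U) (hf : MemLp f q (volume.restrict U))
    (hη : IsTestFunction U η) : MemLp (fun x => f x * η x) q volume := by
  obtain ⟨M, hM⟩ := hη.hasCompactSupport.exists_bound_of_continuous hη.contDiff.continuous
  have h1 : MemLp (fun x => f x * η x) q (volume.restrict U) :=
    (memLp_top_of_bound hη.contDiff.continuous.aestronglyMeasurable M (ae_of_all _ hM)).mul hf
  rw [← memLp_indicator_iff_restrict hU.measurableSet] at h1
  rwa [Set.indicator_eq_self.2 fun x hx => ?_] at h1
  exact hη.tsupport_subset (subset_tsupport _ fun h => hx (by simp [h]))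

theorem MemW1.mul_test (hU : IsOpen U) (hf : MemW1 U q f) (hη : IsTestFunction U η) :
    MemW1 Set.univ q fun x => f x * η x := by
  refine ⟨(hf.1.mul_test hU hη).restrict _, fun i => ?_⟩
  obtain ⟨g, hg, hfg⟩ := hf.2 i
  exact ⟨_, ((hg.mul_test hU hη).add (hf.1.mul_test hU (hη.fderiv_apply _))).restrict _,
    hfg.mul_test hη⟩

theorem HasWeakPartialDeriv.add_const_mul (h₁ : HasWeakPartialDeriv U i f₁ g₁)
    (h₂ : HasWeakPartialDeriv U i f₂ g₂) (c : ℝ) :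
    HasWeakPartialDeriv U i (fun x => f₁ x + c * f₂ x) (fun x => g₁ x + c * g₂ x) := by
  refine ⟨h₁.1.add (h₂.1.smul c), h₁.2.1.add (h₂.2.1.smul c), fun φ hφ => ?_⟩
  have e1 := h₁.2.2 φ hφ
  have e2 := h₂.2.2 φ hφ
  simp only [add_mul, mul_assoc]
  rw [integral_add (h₁.1.integrable_mul_test (hφ.fderiv_apply _)).integrableOn
    ((h₂.1.integrable_mul_test (hφ.fderiv_apply _)).const_mul c).integrableOn,
    integral_add (h₁.2.1.integrable_mul_test hφ).integrableOn
    ((h₂.2.1.integrable_mul_test hφ).const_mul c).integrableOn, integral_const_mul,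
    integral_const_mul, e1, e2]
  ring

theorem MemW1.add_const_mul (h₁ : MemW1 U q f₁) (h₂ : MemW1 U q f₂) (c : ℝ) :
    MemW1 U q fun x => f₁ x + c * f₂ x := by
  refine ⟨h₁.1.add (h₂.1.const_mul c), fun i => ?_⟩
  obtain ⟨g₁, hg₁, hfg₁⟩ := h₁.2 i
  obtain ⟨g₂, hg₂, hfg₂⟩ := h₂.2 i
  exact ⟨_, hg₁.add (hg₂.const_mul c), hfg₁.add_const_mul hfg₂ c⟩

theorem MemW1.add (h₁ : MemW1 U q f₁) (h₂ : MemW1 U q f₂) : MemW1 U q fun x => f₁ x + f₂ x := by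
  simpa using h₁.add_const_mul h₂ 1

theorem MemW1.sub (h₁ : MemW1 U q f₁) (h₂ : MemW1 U q f₂) : MemW1 U q fun x => f₁ x - f₂ x := by
  simpa [sub_eq_add_neg] using h₁.add_const_mul h₂ (-1)

theorem memW1_zero : MemW1 U q fun _ => 0 :=
  ⟨MemLp.zero', fun _ => ⟨fun _ => 0, MemLp.zero', (locallyIntegrable_const 0).locallyIntegrableOn _,
    (locallyIntegrable_const 0).locallyIntegrableOn _, fun φ _ => by simp⟩⟩

theorem MemW1.sum {ι : Type*} {s : Finset ι} {F : ι → EuclideanSpace ℝ (Fin d) → ℝ}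
    (hF : ∀ k ∈ s, MemW1 U q (F k)) : MemW1 U q fun x => ∑ k ∈ s, F k x := by
  classical
  induction s using Finset.induction_on with
  | empty => simpa using memW1_zero
  | insert k s hk ih =>
    simp only [Finset.sum_insert hk]
    exact (hF k (Finset.mem_insert_self _ _)).add
      (ih fun j hj => hF j (Finset.mem_insert_of_mem hj))

/-- An `L^q` function on a set of finite measure has an integrable representative that is defined on
the whole space. -/
theorem MeasureTheory.MemLp.exists_integrable_representative (hU : MeasurableSet U)
    (hU' : volume U ≠ ⊤) (hq : 1 ≤ q) (hf : MemLp f q (volume.restrict U)) :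
    ∃ f' : EuclideanSpace ℝ (Fin d) → ℝ, Integrable f' ∧ MemLp f' q volume ∧
      f =ᵐ[volume.restrict U] f' := by
  have : IsFiniteMeasure (volume.restrict U) :=
    ⟨by rw [Measure.restrict_apply_univ]; exact hU'.lt_top⟩
  refine ⟨U.indicator f, (integrable_indicator_iff hU).2 (hf.integrable hq),
    (memLp_indicator_iff_restrict hU).2 hf, ?_⟩
  filter_upwards [ae_restrict_mem hU] with x hx
  rw [Set.indicator_of_mem hx]

/-- Averages of translates of a Sobolev function are Sobolev functions. -/
theorem MemW1.translationAverage {Ω : Type*} [MeasurableSpace Ω] {P : Measure Ω}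
    [IsProbabilityMeasure P] {a : Ω → ℝ} {τ : Ω → EuclideanSpace ℝ (Fin d)} {M : ℝ}
    (ha : Measurable a) (hτ : Measurable τ) (hM : ∀ᵐ s ∂P, |a s| ≤ M)
    (hUV : ∀ᵐ s ∂P, ∀ x ∈ U, x - τ s ∈ V) (hV : MeasurableSet V) (hq : 1 ≤ q) (hq' : q ≠ ⊤)
    (hf : Integrable f) (hfq : MemLp f q volume) (hV' : volume V ≠ ⊤) (h : MemW1 V q f) :
    MemW1 U q (translationAverage P a τ f) := by
  refine ⟨(memLp_translationAverage ha hτ hM hq hq' hfq).restrict _, fun i => ?_⟩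
  obtain ⟨g, hg, hfg⟩ := h.2 i
  obtain ⟨g', hg', hgq, hgg⟩ := hg.exists_integrable_representative hV hV' hq
  have h1 : HasWeakPartialDeriv V i f g' := hfg.congr_ae EventuallyEq.rfl hgg
    hfg.1 (hg'.locallyIntegrable.locallyIntegrableOn _)
  exact ⟨_, (memLp_translationAverage ha hτ hM hq hq' hgq).restrict _,
    h1.translationAverage ha hτ hM hUV hf hg'⟩

end SobolevAlgebra

/-! ### Segment averages: an approximate right inverse of the divergence. -/

section SegmentAverage

variable {d : ℕ} {f ψ : EuclideanSpace ℝ (Fin d) → ℝ} {U V : Set (EuclideanSpace ℝ (Fin d))}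
  {ν : Measure (EuclideanSpace ℝ (Fin d))} {ε : ℝ}

theorem integrable_mul_integral_comp_add {Ω : Type*} [MeasurableSpace Ω] {P : Measure Ω}
    [IsProbabilityMeasure P] {a : Ω → ℝ} {τ : Ω → EuclideanSpace ℝ (Fin d)} {M : ℝ}
    (ha : Measurable a) (hτ : Measurable τ) (hM : ∀ᵐ s ∂P, |a s| ≤ M) (hf : Integrable f)
    (hψ : Continuous ψ) (hc : HasCompactSupport ψ) :
    Integrable (fun s => a s * ∫ x, f x * ψ (x + τ s)) P := by
  obtain ⟨B, hB⟩ := hc.exists_bound_of_continuous hψ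
  have h1 : Integrable (fun p : Ω × EuclideanSpace ℝ (Fin d) =>
      a p.1 * f (p.2 - τ p.1) * ψ p.2) (P.prod volume) :=
    (integrable_translation ha hτ hM hf).mul_bdd
      (hψ.measurable.comp measurable_snd).aestronglyMeasurable (ae_of_all _ fun p => hB p.2)
  refine h1.integral_prod_left.congr (ae_of_all _ fun s => ?_)
  simp only [mul_assoc, integral_const_mul]
  congr 1
  simpa using (integral_sub_right_eq_self (μ := volume) (fun x => f x * ψ (x + τ s)) (τ s))

theorem integral_fderiv_segment (hψ : ContDiff ℝ ∞ ψ) (x z : EuclideanSpace ℝ (Fin d)) :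
    ∫ t in Set.Icc (0 : ℝ) 1, fderiv ℝ ψ (x + t • z) z = ψ (x + z) - ψ x := by
  rw [integral_Icc_eq_integral_Ioc, ← intervalIntegral.integral_of_le zero_le_one,
    intervalIntegral.integral_eq_sub_of_hasDerivAt (f := fun t : ℝ => ψ (x + t • z))]
  · simp
  · intro t _
    have h1 : HasFDerivAt ψ (fderiv ℝ ψ (x + t • z)) (x + t • z) :=
      (hψ.differentiable (by simp) _).hasFDerivAt
    have h2 : HasDerivAt (fun t : ℝ => x + t • z) z t := by
      simpa using ((hasDerivAt_id t).smul_const z).const_add x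
    exact h1.comp_hasDerivAt t h2
  · refine Continuous.intervalIntegrable ?_ _ _
    exact ((hψ.continuous_fderiv (by simp)).comp (by fun_prop)).clm_apply continuous_const

/-- The average of `f` over the segments `[x - z, x]`, weighted by the `l`-th coordinate of `z`. -/
noncomputable def segmentAverage (ν : Measure (EuclideanSpace ℝ (Fin d))) (l : Fin d)
    (f : EuclideanSpace ℝ (Fin d) → ℝ) : EuclideanSpace ℝ (Fin d) → ℝ :=
  translationAverage (ν.prod (volume.restrict (Set.Icc (0 : ℝ) 1)))
    (fun p => p.1 l) (fun p => p.2 • p.1) f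

instance isProbabilityMeasure_restrict_Icc_zero_one :
    IsProbabilityMeasure (volume.restrict (Set.Icc (0 : ℝ) 1)) :=
  ⟨by simp⟩

theorem measurable_coord (l : Fin d) :
    Measurable fun p : EuclideanSpace ℝ (Fin d) × ℝ => p.1 l := by
  have h : Continuous fun p : EuclideanSpace ℝ (Fin d) × ℝ => p.1 l := by fun_prop
  exact h.measurable

theorem measurable_smul_swap : Measurable fun p : EuclideanSpace ℝ (Fin d) × ℝ => p.2 • p.1 :=
  measurable_snd.smul measurable_fst

theorem ae_abs_coord_le [IsProbabilityMeasure ν] (hν : ∀ᵐ z ∂ν, ‖z‖ ≤ ε) (l : Fin d) :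
    ∀ᵐ p ∂(ν.prod (volume.restrict (Set.Icc (0 : ℝ) 1))), |p.1 l| ≤ ε :=
  Measure.quasiMeasurePreserving_fst.ae (hν.mono fun z hz => (PiLp.norm_apply_le z l).trans hz)

theorem ae_sub_smul_mem [IsProbabilityMeasure ν] (hν : ∀ᵐ z ∂ν, ‖z‖ ≤ ε)
    (hUV : ∀ x ∈ U, ∀ z, ‖z‖ ≤ ε → x - z ∈ V) :
    ∀ᵐ p ∂(ν.prod (volume.restrict (Set.Icc (0 : ℝ) 1))), ∀ x ∈ U, x - p.2 • p.1 ∈ V := by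
  have h1 : ∀ᵐ p ∂(ν.prod (volume.restrict (Set.Icc (0 : ℝ) 1))), ‖p.1‖ ≤ ε :=
    Measure.quasiMeasurePreserving_fst.ae hν
  have h2 : ∀ᵐ p ∂(ν.prod (volume.restrict (Set.Icc (0 : ℝ) 1))), p.2 ∈ Set.Icc (0 : ℝ) 1 :=
    Measure.quasiMeasurePreserving_snd.ae (ae_restrict_mem measurableSet_Icc)
  filter_upwards [h1, h2] with p hp hp' x hx
  refine hUV x hx _ ?_
  rw [norm_smul, Real.norm_of_nonneg hp'.1]
  exact (mul_le_of_le_one_left (norm_nonneg _) hp'.2).trans hp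

theorem integrable_segmentAverage [IsProbabilityMeasure ν] (hν : ∀ᵐ z ∂ν, ‖z‖ ≤ ε) (l : Fin d)
    (hf : Integrable f) : Integrable (segmentAverage ν l f) :=
  integrable_translationAverage (measurable_coord l) measurable_smul_swap (ae_abs_coord_le hν l) hf

theorem MemW1.segmentAverage [IsProbabilityMeasure ν] (hν : ∀ᵐ z ∂ν, ‖z‖ ≤ ε)
    (hUV : ∀ x ∈ U, ∀ z, ‖z‖ ≤ ε → x - z ∈ V) (hV : MeasurableSet V) (hV' : volume V ≠ ⊤)
    {q : ℝ≥0∞} (hq : 1 ≤ q) (hq' : q ≠ ⊤) (hf : Integrable f) (hfq : MemLp f q volume)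
    (h : MemW1 V q f) (l : Fin d) : MemW1 U q (segmentAverage ν l f) :=
  h.translationAverage (measurable_coord l) measurable_smul_swap (ae_abs_coord_le hν l)
    (ae_sub_smul_mem hν hUV) hV hq hq' hf hfq hV'

/-- A segment average of a divergence-free field is divergence-free. -/
theorem sum_integral_segmentAverage_eq_zero [IsProbabilityMeasure ν] (hν : ∀ᵐ z ∂ν, ‖z‖ ≤ ε)
    (hUV : ∀ x ∈ U, ∀ z, ‖z‖ ≤ ε → x - z ∈ V) {F : Fin d → EuclideanSpace ℝ (Fin d) → ℝ}
    (hF : ∀ j, Integrable (F j))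
    (hdiv : ∀ φ, IsTestFunction V φ →
      ∑ j, ∫ x, F j x * fderiv ℝ φ x (EuclideanSpace.single j 1) = 0)
    (hψ : IsTestFunction U ψ) (l : Fin d) :
    ∑ j, ∫ x, segmentAverage ν l (F j) x * fderiv ℝ ψ x (EuclideanSpace.single j 1) = 0 := by
  simp only [segmentAverage]
  rw [Finset.sum_congr rfl fun j _ => integral_translationAverage_mul (measurable_coord l)
    measurable_smul_swap (ae_abs_coord_le hν l) (hF j)
    (hψ.fderiv_apply (EuclideanSpace.single j 1)).contDiff.continuous
    (hψ.fderiv_apply (EuclideanSpace.single j 1)).hasCompactSupport,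
    ← integral_finsetSum _ fun j _ => integrable_mul_integral_comp_add (measurable_coord l)
    measurable_smul_swap (ae_abs_coord_le hν l) (hF j)
    (hψ.fderiv_apply (EuclideanSpace.single j 1)).contDiff.continuous
    (hψ.fderiv_apply (EuclideanSpace.single j 1)).hasCompactSupport]
  refine integral_eq_zero_of_ae ((ae_sub_smul_mem hν hUV).mono fun p hp => ?_)
  have h1 := hdiv _ (hψ.comp_add_right hp)
  simp only [fderiv_comp_add_right] at h1
  simp only [← Finset.mul_sum, h1, mul_zero, Pi.zero_apply]

/-- The divergence of the segment averages is the difference between the average of the translates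
and the function itself. -/
theorem sum_integral_segmentAverage_fderiv [IsProbabilityMeasure ν] (hν : ∀ᵐ z ∂ν, ‖z‖ ≤ ε)
    (hf : Integrable f) (hψ : IsTestFunction U ψ) :
    ∑ j, ∫ x, segmentAverage ν j f x * fderiv ℝ ψ x (EuclideanSpace.single j 1) =
      (∫ x, translationAverage ν (fun _ => 1) id f x * ψ x) - ∫ x, f x * ψ x := by
  have i1 := fun j : Fin d => integrable_mul_integral_comp_add (measurable_coord j)
    measurable_smul_swap (ae_abs_coord_le hν j) hf
    (hψ.fderiv_apply (EuclideanSpace.single j 1)).contDiff.continuous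
    (hψ.fderiv_apply (EuclideanSpace.single j 1)).hasCompactSupport
  -- The weights z_j assemble the partial derivatives into the derivative along z, whose integral
  -- over the segment is ψ(x + z) - ψ(x).
  have hsum : ∀ z w : EuclideanSpace ℝ (Fin d),
      ∑ j, z j * ∫ x, f x * fderiv ℝ ψ (x + w) (EuclideanSpace.single j 1) =
      ∫ x, f x * fderiv ℝ ψ (x + w) z := by
    intro z w
    simp only [← integral_const_mul]
    rw [← integral_finsetSum _ fun j _ => ?_]
    · congr 1
      funext x
      rw [IsDefiningFunction.fderiv_apply_eq_sum ψ (x + w) z, Finset.mul_sum]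
      exact Finset.sum_congr rfl fun j _ => by ring
    · refine Integrable.const_mul ?_ _
      have h := (hψ.fderiv_apply (EuclideanSpace.single j 1)).comp_add_right (V := Set.univ)
        (z := w) fun _ _ => trivial
      exact IsDefiningFunction.integrable_mul_test hf h.contDiff.continuous h.hasCompactSupport
  have i2 := integrable_finsetSum Finset.univ fun j _ => i1 j
  simp only [segmentAverage]
  rw [Finset.sum_congr rfl fun j _ => integral_translationAverage_mul (measurable_coord j)
    measurable_smul_swap (ae_abs_coord_le hν j) hf
    (hψ.fderiv_apply (EuclideanSpace.single j 1)).contDiff.continuous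
    (hψ.fderiv_apply (EuclideanSpace.single j 1)).hasCompactSupport,
    ← integral_finsetSum _ fun j _ => i1 j, integral_prod _ i2]
  have h1 : ∀ z : EuclideanSpace ℝ (Fin d), ∫ t in Set.Icc (0 : ℝ) 1,
      ∑ j, z j * ∫ x, f x * fderiv ℝ ψ (x + t • z) (EuclideanSpace.single j 1) =
      1 * (∫ x, f x * ψ (x + z)) - ∫ x, f x * ψ x := by
    intro z
    simp only [hsum]
    obtain ⟨B, hB⟩ := (hψ.fderiv_apply z).hasCompactSupport.exists_bound_of_continuous
      (hψ.fderiv_apply z).contDiff.continuous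
    rw [integral_integral_swap]
    · simp only [integral_const_mul, integral_fderiv_segment hψ.contDiff, mul_sub]
      have h := hψ.comp_add_right (V := Set.univ) (z := z) fun _ _ => trivial
      rw [integral_sub (IsDefiningFunction.integrable_mul_test hf h.contDiff.continuous
        h.hasCompactSupport) (IsDefiningFunction.integrable_mul_test hf hψ.contDiff.continuous
        hψ.hasCompactSupport), one_mul]
    · refine Integrable.mul_bdd (c := B) (hf.comp_snd _) ?_ (ae_of_all _ fun p => hB _)
      refine Continuous.aestronglyMeasurable ?_
      exact (hψ.fderiv_apply z).contDiff.continuous.comp (by fun_prop)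
  simp only [h1]
  have i3 := integrable_mul_integral_comp_add (P := ν) (a := fun _ => 1) (τ := id) (M := 1)
    measurable_const measurable_id (ae_of_all _ fun _ => by simp) hf hψ.contDiff.continuous
    hψ.hasCompactSupport
  rw [integral_translationAverage_mul (P := ν) (a := fun _ => 1) (τ := id) (M := 1)
    measurable_const measurable_id (ae_of_all _ fun _ => by simp) hf hψ.contDiff.continuous
    hψ.hasCompactSupport]
  simp only [id_eq] at i3 ⊢
  rw [integral_sub i3 (integrable_const _)]
  simp

end SegmentAverage

/-! ### Cutting off with bounded divergence. -/

section Cutoff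

variable {d : ℕ} {f ψ χ φ : EuclideanSpace ℝ (Fin d) → ℝ} {U V : Set (EuclideanSpace ℝ (Fin d))}
  {ν : Measure (EuclideanSpace ℝ (Fin d))} {ε : ℝ}

theorem exists_isTestFunction_eq_one {K W : Set (EuclideanSpace ℝ (Fin d))} (hK : IsCompact K)
    (hW : IsOpen W) (hKW : K ⊆ W) :
    ∃ χ, IsTestFunction W χ ∧ ∀ x ∈ K, χ =ᶠ[𝓝 x] fun _ => 1 := by
  obtain ⟨ε, hε, hεW⟩ := hK.exists_cthickening_subset_open hW hKW
  have hT : IsCompact (cthickening ε K) := hK.cthickening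
  obtain ⟨f, hf1, hf0, -⟩ := exists_contMDiffMap_one_nhds_of_subset_interior
    (modelWithCornersSelf ℝ (EuclideanSpace ℝ (Fin d))) (n := (⊤ : ℕ∞)) (s := K) (t := cthickening ε K)
    hK.isClosed ((self_subset_thickening hε K).trans
      (isOpen_thickening.subset_interior_iff.2 (thickening_subset_cthickening ε K)))
  have hs : tsupport f ⊆ cthickening ε K :=
    closure_minimal (fun x hx => by_contra fun h => hx (hf0 x h)) isClosed_cthickening
  refine ⟨f, ⟨f.contMDiff.contDiff, hT.of_isClosed_subset (isClosed_tsupport _) hs, hs.trans hεW⟩,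
    fun x hx => ?_⟩
  exact (eventually_nhdsSet_iff_forall.1 hf1) x hx

theorem exists_isProbabilityMeasure_norm_le (hε : 0 < ε) :
    ∃ ν : Measure (EuclideanSpace ℝ (Fin d)), IsProbabilityMeasure ν ∧ (∀ᵐ z ∂ν, ‖z‖ ≤ ε) ∧
      ∃ c : ℝ≥0∞, c ≠ ⊤ ∧ ν ≤ c • volume := by
  have h0 : volume (ball (0 : EuclideanSpace ℝ (Fin d)) ε) ≠ 0 := (measure_ball_pos _ _ hε).ne'
  refine ⟨ProbabilityTheory.cond volume (ball 0 ε),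
    ProbabilityTheory.cond_isProbabilityMeasure_of_finite h0 measure_ball_lt_top.ne,
    (ProbabilityTheory.ae_cond_mem measurableSet_ball).mono fun z hz => (mem_ball_zero_iff.1 hz).le,
    (volume (ball (0 : EuclideanSpace ℝ (Fin d)) ε))⁻¹, ENNReal.inv_ne_top.2 h0, ?_⟩
  rw [ProbabilityTheory.cond]
  gcongr
  exact Measure.restrict_le_self

/-- Averaging against a measure of density at most c is bounded pointwise by c times the L¹ norm.
This is the sole source of the boundedness of the divergence. -/
theorem memLp_top_translationAverage_id {c : ℝ≥0∞} (hc : c ≠ ⊤) (hν : ν ≤ c • volume)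
    [IsProbabilityMeasure ν] (hf : Integrable f) :
    MemLp (translationAverage ν (fun _ => 1) id f) ⊤ volume := by
  have hm := (integrable_translationAverage (P := ν) (a := fun _ => 1) (τ := id) (M := 1)
    measurable_const measurable_id (ae_of_all _ fun _ => by simp) hf).aestronglyMeasurable
  refine memLp_top_of_bound hm (c.toReal * ∫ x, ‖f x‖) (ae_of_all _ fun x => ?_)
  simp only [translationAverage, id, one_mul]
  have h1 : Integrable (fun z => ‖f (x - z)‖) (c • volume) :=
    ((hf.comp_sub_left x).norm).smul_measure hc
  calc _ ≤ ∫ z, ‖f (x - z)‖ ∂ν := norm_integral_le_integral_norm _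
    _ ≤ ∫ z, ‖f (x - z)‖ ∂(c • volume) :=
      integral_mono_measure hν (ae_of_all _ fun z => norm_nonneg _) h1
    _ = _ := by
      rw [integral_smul_measure, smul_eq_mul, integral_sub_left_eq_self (fun z => ‖f z‖) volume x]

theorem fderiv_fderiv_apply_comm (hχ : ContDiff ℝ ∞ χ) (x v w : EuclideanSpace ℝ (Fin d)) :
    fderiv ℝ (fun y => fderiv ℝ χ y v) x w = fderiv ℝ (fun y => fderiv ℝ χ y w) x v := by
  have h1 : DifferentiableAt ℝ (fderiv ℝ χ) x :=
    (hχ.fderiv_right (m := ∞) (by simp)).differentiable (by simp) x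
  have h2 : IsSymmSndFDerivAt ℝ χ x := hχ.contDiffAt.isSymmSndFDerivAt
    (by
      simp only [minSmoothness_of_isRCLikeNormedField]
      exact WithTop.coe_le_coe.2 (le_top : (2 : ℕ∞) ≤ ⊤))
  rw [fderiv_clm_apply h1 (differentiableAt_const v), fderiv_clm_apply h1 (differentiableAt_const w)]
  simpa using h2.eq w v

/-- Cutting off a divergence-free field, with an antisymmetric correction which makes the divergence
of the result bounded. -/
noncomputable def cutoffField (ν : Measure (EuclideanSpace ℝ (Fin d)))
    (χ : EuclideanSpace ℝ (Fin d) → ℝ) (F : Fin d → EuclideanSpace ℝ (Fin d) → ℝ)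
    (j : Fin d) (x : EuclideanSpace ℝ (Fin d)) : ℝ :=
  F j x * χ x + ∑ l, (segmentAverage ν l (F j) x - segmentAverage ν j (F l) x) *
    fderiv ℝ χ x (EuclideanSpace.single l 1)

/-- With S_{jl} the antisymmetric difference of segment averages, ∑_j ∂_j S_{jl} equals the ball
average of F_l minus F_l: the averages of the divergence-free field contribute nothing. Multiplied
by ∂_l χ and summed over l, this cancels the term F · ∇χ coming from χF and leaves the averaged one.
-/
theorem sum_integral_cutoffField [IsProbabilityMeasure ν] (hν : ∀ᵐ z ∂ν, ‖z‖ ≤ ε)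
    (hUV' : U ⊆ V) (hUV : ∀ x ∈ U, ∀ z, ‖z‖ ≤ ε → x - z ∈ V)
    {F : Fin d → EuclideanSpace ℝ (Fin d) → ℝ} (hF : ∀ j, Integrable (F j))
    (hdiv : ∀ φ, IsTestFunction V φ →
      ∑ j, ∫ x, F j x * fderiv ℝ φ x (EuclideanSpace.single j 1) = 0)
    (hχ : IsTestFunction U χ) (hφ : IsTestFunction Set.univ φ) :
    ∑ j, ∫ x, cutoffField ν χ F j x * fderiv ℝ φ x (EuclideanSpace.single j 1) =
      -∫ x, (∑ l, translationAverage ν (fun _ => 1) id (F l) x *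
        fderiv ℝ χ x (EuclideanSpace.single l 1)) * φ x := by
  set e : Fin d → EuclideanSpace ℝ (Fin d) := fun l => EuclideanSpace.single l 1 with he
  set S : Fin d → Fin d → EuclideanSpace ℝ (Fin d) → ℝ := fun j l x =>
    segmentAverage ν l (F j) x - segmentAverage ν j (F l) x with hS
  have hSi : ∀ j l, Integrable (S j l) := fun j l =>
    (integrable_segmentAverage hν l (hF j)).sub (integrable_segmentAverage hν j (hF l))
  have hint : ∀ {G ψ : EuclideanSpace ℝ (Fin d) → ℝ}, Integrable G → IsTestFunction U ψ →
      Integrable fun x => G x * ψ x := fun hG hψ =>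
    IsDefiningFunction.integrable_mul_test hG hψ.contDiff.continuous hψ.hasCompactSupport
  have hχφ : IsTestFunction U fun x => χ x * φ x := hχ.mul_contDiff hφ.contDiff
  have hψ : ∀ l, IsTestFunction U fun x => fderiv ℝ χ x (e l) * φ x := fun l =>
    (hχ.fderiv_apply (e l)).mul_contDiff hφ.contDiff
  have hH : ∀ j l, IsTestFunction U fun x => fderiv ℝ (fun y => fderiv ℝ χ y (e l)) x (e j) * φ x :=
    fun j l => ((hχ.fderiv_apply (e l)).fderiv_apply (e j)).mul_contDiff hφ.contDiff
  have e1 : ∀ j x, cutoffField ν χ F j x * fderiv ℝ φ x (e j) =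
      (F j x * fderiv ℝ (fun y => χ y * φ y) x (e j) - F j x * (fderiv ℝ χ x (e j) * φ x)) +
      ∑ l, (S j l x * fderiv ℝ (fun y => fderiv ℝ χ y (e l) * φ y) x (e j) -
        S j l x * (fderiv ℝ (fun y => fderiv ℝ χ y (e l)) x (e j) * φ x)) := by
    intro j x
    rw [cutoffField, add_mul, Finset.sum_mul,
      fderiv_mul_apply hχ.differentiable hφ.differentiable]
    congr 1
    · ring
    · refine Finset.sum_congr rfl fun l _ => ?_
      rw [fderiv_mul_apply (hχ.fderiv_apply (e l)).differentiable hφ.differentiable]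
      ring
  have e2 : ∀ j, ∫ x, cutoffField ν χ F j x * fderiv ℝ φ x (e j) =
      ((∫ x, F j x * fderiv ℝ (fun y => χ y * φ y) x (e j)) -
        ∫ x, F j x * (fderiv ℝ χ x (e j) * φ x)) +
      ∑ l, ((∫ x, S j l x * fderiv ℝ (fun y => fderiv ℝ χ y (e l) * φ y) x (e j)) -
        ∫ x, S j l x * (fderiv ℝ (fun y => fderiv ℝ χ y (e l)) x (e j) * φ x)) := by
    intro j
    have i1 := hint (hF j) (hχφ.fderiv_apply (e j))
    have i2 := hint (hF j) (hψ j)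
    have i3 := fun l => hint (hSi j l) ((hψ l).fderiv_apply (e j))
    have i4 := fun l => hint (hSi j l) (hH j l)
    have i12 : Integrable fun x => F j x * fderiv ℝ (fun y => χ y * φ y) x (e j) -
        F j x * (fderiv ℝ χ x (e j) * φ x) := i1.sub i2
    have i34 : ∀ l, Integrable fun x =>
        S j l x * fderiv ℝ (fun y => fderiv ℝ χ y (e l) * φ y) x (e j) -
        S j l x * (fderiv ℝ (fun y => fderiv ℝ χ y (e l)) x (e j) * φ x) :=
      fun l => (i3 l).sub (i4 l)
    simp only [e1]
    rw [integral_add i12 (integrable_finsetSum _ fun l _ => i34 l),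
      integral_sub i1 i2, integral_finsetSum _ fun l _ => i34 l]
    congr 1
    exact Finset.sum_congr rfl fun l _ => integral_sub (i3 l) (i4 l)
  -- An antisymmetric matrix is contracted with the symmetric Hessian of χ.
  have e3 : ∑ j, ∑ l, ∫ x, S j l x * (fderiv ℝ (fun y => fderiv ℝ χ y (e l)) x (e j) * φ x) = 0 := by
    have h1 : ∑ j, ∑ l, ∫ x, S j l x * (fderiv ℝ (fun y => fderiv ℝ χ y (e l)) x (e j) * φ x) =
        -∑ j, ∑ l, ∫ x, S j l x * (fderiv ℝ (fun y => fderiv ℝ χ y (e l)) x (e j) * φ x) := by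
      conv_lhs => rw [Finset.sum_comm]
      simp only [← Finset.sum_neg_distrib, ← integral_neg]
      refine Finset.sum_congr rfl fun l _ => Finset.sum_congr rfl fun j _ => ?_
      congr 1
      funext x
      rw [fderiv_fderiv_apply_comm hχ.contDiff x (e l) (e j)]
      simp only [hS]
      ring
    linarith
  have e4 : ∀ l, ∑ j, ∫ x, S j l x * fderiv ℝ (fun y => fderiv ℝ χ y (e l) * φ y) x (e j) =
      (∫ x, F l x * (fderiv ℝ χ x (e l) * φ x)) -
        ∫ x, translationAverage ν (fun _ => 1) id (F l) x * (fderiv ℝ χ x (e l) * φ x) := by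
    intro l
    simp only [hS, sub_mul]
    rw [Finset.sum_congr rfl fun j _ => integral_sub
      (hint (integrable_segmentAverage hν l (hF j)) ((hψ l).fderiv_apply (e j)))
      (hint (integrable_segmentAverage hν j (hF l)) ((hψ l).fderiv_apply (e j))),
      Finset.sum_sub_distrib, sum_integral_segmentAverage_eq_zero hν hUV hF hdiv (hψ l) l,
      sum_integral_segmentAverage_fderiv hν (hF l) (hψ l)]
    ring
  have e5 := hdiv _ (hχφ.mono hUV')
  have i5 : ∀ l, Integrable fun x => translationAverage ν (fun _ => 1) id (F l) x *
      (fderiv ℝ χ x (e l) * φ x) := fun l =>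
    hint (integrable_translationAverage (P := ν) (a := fun _ => 1) (τ := id) (M := 1)
      measurable_const measurable_id (ae_of_all _ fun _ => by simp) (hF l)) (hψ l)
  have e6 : ∑ j, ∑ l, ∫ x, S j l x * fderiv ℝ (fun y => fderiv ℝ χ y (e l) * φ y) x (e j) =
      ∑ l, ((∫ x, F l x * (fderiv ℝ χ x (e l) * φ x)) -
        ∫ x, translationAverage ν (fun _ => 1) id (F l) x * (fderiv ℝ χ x (e l) * φ x)) := by
    rw [Finset.sum_comm]
    exact Finset.sum_congr rfl fun l _ => e4 l
  simp only [Finset.sum_mul, mul_assoc]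
  rw [integral_finsetSum _ fun l _ => i5 l, Finset.sum_congr rfl fun j _ => e2 j]
  simp only [Finset.sum_add_distrib, Finset.sum_sub_distrib] at e6 ⊢
  rw [e5, e3, e6]
  ring

end Cutoff

/-- A divergence-free Sobolev field on an open set agrees, on a given compact subset, with a
Sobolev field whose divergence is bounded and whose support is a compact subset of the open set. -/
theorem exists_compactlySupported_extension {d : ℕ} {K W : Set (EuclideanSpace ℝ (Fin d))}
    (hK : IsCompact K) (hW : IsOpen W) (hKW : K ⊆ W) {q : ℝ≥0∞} (hq : 1 ≤ q) (hq' : q ≠ ⊤)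
    {b : EuclideanSpace ℝ (Fin d) → EuclideanSpace ℝ (Fin d)} (hb : VectorMemW1 W q b)
    (hdiv : HasWeakDivergence W b fun _ => 0) :
    ∃ b' : EuclideanSpace ℝ (Fin d) → EuclideanSpace ℝ (Fin d), VectorMemW1 Set.univ q b' ∧
      (∃ g, MemLp g ⊤ volume ∧ HasWeakDivergence Set.univ b' g) ∧ (∀ x ∈ K, b' x = b x) ∧
      HasCompactSupport b' ∧ tsupport b' ⊆ W := by
  obtain ⟨χ, hχ, hχK⟩ := exists_isTestFunction_eq_one hK hW hKW
  have hT : IsCompact (tsupport χ) := hχ.hasCompactSupport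
  obtain ⟨ε₀, hε₀, hεW⟩ := hT.exists_cthickening_subset_open hW hχ.tsupport_subset
  -- One ε for the neighbourhood `U` of the support of χ, another for the translations: segments of
  -- length at most ε issuing from `U` stay in `V`.
  obtain ⟨ε, hε, rfl⟩ : ∃ ε, 0 < ε ∧ ε₀ = 2 * ε := ⟨ε₀ / 2, by positivity, by ring⟩
  set U := thickening ε (tsupport χ) with hU
  set V := thickening (2 * ε) (tsupport χ) with hV
  have hUV' : U ⊆ V := thickening_mono (by linarith) _
  have hUV : ∀ x ∈ U, ∀ z, ‖z‖ ≤ ε → x - z ∈ V := by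
    intro x hx z hz
    obtain ⟨y, hy, hxy⟩ := mem_thickening_iff.1 hx
    refine mem_thickening_iff.2 ⟨y, hy, ?_⟩
    calc dist (x - z) y ≤ dist (x - z) x + dist x y := dist_triangle _ _ _
      _ < 2 * ε := by
        rw [dist_eq_norm, sub_sub_cancel_left, norm_neg]
        linarith
  have hVW : V ⊆ W := (thickening_subset_cthickening _ _).trans hεW
  have hVo : IsOpen V := isOpen_thickening
  have hUo : IsOpen U := isOpen_thickening
  have hVm : volume V ≠ ⊤ := hT.isBounded.thickening.measure_lt_top.ne
  have hχU : IsTestFunction U χ :=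
    ⟨hχ.contDiff, hχ.hasCompactSupport, self_subset_thickening hε _⟩
  -- The averages integrate over the whole space, so each component is replaced by a global
  -- integrable function that agrees with it almost everywhere on `V`.
  have hrep := fun j => ((hb j).1.mono_measure
    (Measure.restrict_mono_set volume hVW)).exists_integrable_representative hVo.measurableSet hVm hq
  choose F hF hFq hFb using hrep
  have hFV : ∀ j, MemW1 V q (F j) := fun j => by
    refine ⟨(hFq j).restrict _, fun i => ?_⟩
    obtain ⟨g, hg, hfg⟩ := (hb j).2 i
    exact ⟨g, hg.mono_measure (Measure.restrict_mono_set volume hVW), (hfg.mono hVW).congr_ae (hFb j)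
      EventuallyEq.rfl ((hF j).locallyIntegrable.locallyIntegrableOn _) (hfg.mono hVW).2.1⟩
  have hbl : ∀ j, LocallyIntegrableOn (fun x => b x j) W := fun j => ((hb j).2 j).choose_spec.2.1
  have hFdiv : ∀ φ, IsTestFunction V φ →
      ∑ j, ∫ x, F j x * fderiv ℝ φ x (EuclideanSpace.single j 1) = 0 := by
    intro φ hφ
    have hφW := hφ.mono hVW
    have h1 := hdiv.2.2 φ hφW
    simp only [zero_mul, integral_zero, neg_zero, IsDefiningFunction.inner_gradient_eq] at h1
    rw [integral_finsetSum _ fun j _ =>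
      ((hbl j).integrable_mul_test (hφW.fderiv_apply _)).integrableOn] at h1
    rw [← h1]
    refine Finset.sum_congr rfl fun j _ => ?_
    rw [hφW.setIntegral_mul_fderiv, ← hφ.setIntegral_mul_fderiv, ← hφ.setIntegral_mul_fderiv]
    exact (integral_congr_ae ((hFb j).mono fun x hx => by simp only [hx])).symm
  obtain ⟨ν, hν, hνε, c, hc, hνc⟩ := exists_isProbabilityMeasure_norm_le (d := d) hε
  -- The first term keeps `b` rather than its representative, so that equality on `K` holds at every
  -- point; there χ is locally constant and the correction vanishes.
  set B : Fin d → EuclideanSpace ℝ (Fin d) → ℝ := fun j x => b x j * χ x +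
    ∑ l, (segmentAverage ν l (F j) x - segmentAverage ν j (F l) x) *
      fderiv ℝ χ x (EuclideanSpace.single l 1) with hB
  have hBW : ∀ j, MemW1 Set.univ q (B j) := fun j =>
    ((hb j).mul_test hW hχ).add (MemW1.sum fun l _ => MemW1.mul_test hUo
      (((hFV j).segmentAverage hνε hUV hVo.measurableSet hVm hq hq' (hF j) (hFq j) l).sub
        ((hFV l).segmentAverage hνε hUV hVo.measurableSet hVm hq hq' (hF l) (hFq l) j))
      (hχU.fderiv_apply _))
  have hBL : ∀ j, MemLp (B j) q volume := fun j => by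
    have := (hBW j).1
    rwa [Measure.restrict_univ] at this
  have hBc : ∀ j, B j =ᵐ[volume] cutoffField ν χ F j := by
    intro j
    filter_upwards [(ae_restrict_iff' hVo.measurableSet).1 (hFb j)] with x hx
    simp only [hB, cutoffField]
    congr 1
    by_cases hxV : x ∈ V
    · rw [hx hxV]
    · rw [image_eq_zero_of_notMem_tsupport fun h => hxV (hUV' (hχU.tsupport_subset h)), mul_zero,
        mul_zero]
  have hg : MemLp (fun x => ∑ l, translationAverage ν (fun _ => 1) id (F l) x *
      fderiv ℝ χ x (EuclideanSpace.single l 1)) ⊤ volume := by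
    refine memLp_finsetSum _ fun l _ => ?_
    exact ((memLp_top_translationAverage_id hc hνc (hF l)).restrict U).mul_test hUo
      (hχU.fderiv_apply _)
  have hB0 : ∀ {x}, x ∉ tsupport χ → WithLp.toLp 2 (fun j => B j x) = 0 := by
    intro x hx
    have h1 : χ x = 0 := image_eq_zero_of_notMem_tsupport hx
    have h2 : fderiv ℝ χ x = 0 :=
      image_eq_zero_of_notMem_tsupport fun h => hx (tsupport_fderiv_subset ℝ h)
    ext j
    simp [hB, h1, h2]
  refine ⟨fun x => WithLp.toLp 2 fun j => B j x, hBW, ⟨_, hg, ?_, ?_, fun φ hφ => ?_⟩,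
    fun x hx => ?_, HasCompactSupport.intro hT fun x hx => hB0 hx,
    (closure_minimal (Function.support_subset_iff'.2 fun _ hx => hB0 hx) (isClosed_tsupport _)).trans
      hχ.tsupport_subset⟩
  · refine LocallyIntegrable.locallyIntegrableOn ?_ _
    refine MemLp.locallyIntegrable (p := q) ?_ hq
    exact MemLp.of_eval_piLp fun j => hBL j
  · exact (hg.locallyIntegrable le_top).locallyIntegrableOn _
  · simp only [Measure.restrict_univ, IsDefiningFunction.inner_gradient_eq]
    rw [← sum_integral_cutoffField hνε hUV' hUV hF hFdiv hχU hφ, integral_finsetSum _ fun j _ => ?_]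
    · refine Finset.sum_congr rfl fun j _ => integral_congr_ae ((hBc j).mono fun x hx => ?_)
      simp only [hx]
    · exact (((hBL j).locallyIntegrable hq).locallyIntegrableOn _).integrable_mul_test
        (hφ.fderiv_apply _)
  · ext j
    have h1 : χ x = 1 := (hχK x hx).self_of_nhds
    have h2 : fderiv ℝ χ x = 0 := by rw [(hχK x hx).fderiv_eq, fderiv_const_apply]
    simp [hB, h1, h2]

end Auxiliary

/-! ### Conclusion. -/

theorem proposition5p5 (d : ℕ) (hd : 2 ≤ d) (α : ℝ) (hα : 1 < α) (hα' : α < 2)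
    (q : ℝ) (hq : q = 2 * (d : ℝ) / ((d : ℝ) + α))
    (D : Set (EuclideanSpace ℝ (Fin d))) (hD : IsC11Domain D)
    (b : EuclideanSpace ℝ (Fin d) → EuclideanSpace ℝ (Fin d))
    (hb : VectorMemW1 D (ENNReal.ofReal q) b)
    (hdiv : HasWeakDivergence D b (fun _ => 0)) :
    ∃ δ : ℝ, 0 < δ ∧
      ∃ b' : EuclideanSpace ℝ (Fin d) → EuclideanSpace ℝ (Fin d),
        VectorMemW1 Set.univ (ENNReal.ofReal q) b' ∧
        (∃ g : EuclideanSpace ℝ (Fin d) → ℝ,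
          MemLp g ∞ volume ∧ HasWeakDivergence Set.univ b' g) ∧
        (∀ x ∈ D, b' x = b x) ∧
        HasCompactSupport b' ∧
        (∀ x, x ∉ thickening δ D → ContDiffAt ℝ ∞ b' x) := by
  have : Nonempty (Fin d) := ⟨⟨0, by omega⟩⟩
  have hd' : (2 : ℝ) ≤ d := by exact_mod_cast hd
  -- q ≥ 1 amounts to α ≤ d, which holds since α < 2 ≤ d.
  have hq1 : 1 ≤ ENNReal.ofReal q := by
    rw [ENNReal.one_le_ofReal, hq, le_div_iff₀ (by linarith)]
    linarith
  obtain ⟨W, hW, hDW, b₁, hb₁, hdiv₁, hbb₁⟩ :=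
    hD.exists_divergenceFree_extension hq1 ENNReal.ofReal_ne_top hb hdiv
  -- Intersecting with the 1-neighbourhood of `D` confines the support, so the field vanishes near
  -- every point outside that neighbourhood and δ = 1 works.
  obtain ⟨b', hb', hg, hb'b, hc, hs⟩ := exists_compactlySupported_extension
    hD.isBounded.isCompact_closure (hW.inter (isOpen_thickening (δ := 1)))
    (Set.subset_inter hDW (closure_subset_thickening one_pos D)) hq1 ENNReal.ofReal_ne_top
    (fun i => (hb₁ i).mono Set.inter_subset_left) (hdiv₁.mono Set.inter_subset_left)
  refine ⟨1, one_pos, b', hb', hg, fun x hx => ?_, hc, fun x hx => ?_⟩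
  · rw [hb'b x (subset_closure hx), hbb₁ x hx]
  · exact contDiffAt_const.congr_of_eventuallyEq
      (notMem_tsupport_iff_eventuallyEq.1 fun h => hx (hs h).2)
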